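/- Consider Bianchi type I space-times $ds^2=-dt^2+g_{ij}(t)\,dx^i dx^j$ ($g$ positive definite) solving Einstein's equations $R_{\mu\nu}-\tfrac12 R g_{\mu\nu}=T^{\rm pf}_{\mu\nu}+T^{\rm jf}_{\mu\nu}$ ($8\pi G=c=1$, no cosmological constant), where $T^{\rm pf}$ is the energy-momentum tensor of a perfect fluid comoving with $\partial_t$, with density $\rho(t)$ and pressure $p=(\gamma-1)\rho$, separately conserved, and $T^{\rm jf}_{\mu\nu}=\mathcal J_\mu\mathcal J_\nu-\tfrac12 g_{\mu\nu}\mathcal J_\alpha\mathcal J^\alpha$ for a homogeneous, purely spatial 1-form $\mathcal J(t)$ with $\nabla_{[\mu}\mathcal J_{\nu]}=0$ and $\nabla_\mu\mathcal J^\mu=0$. Let $\theta_{ij}=\tfrac12\dot g_{ij}$, $H=\tfrac13 g^{ij}\theta_{ij}$, and define $q$ by $\dot H=-(1+q)H^2$. In a spatial orthonormal frame $(e_1,e_2,e_3)$ with $e_1$ pointing along $\mathcal J\neq0$ put $\Sigma_{ab}=\theta_{ab}/H-\delta_{ab}$, $V_a=\mathcal J_a/(\sqrt6 H)$, $\Omega_{\rm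 pf}=\rho/(3H^2)$. The state space consists of all $(\Sigma,V,\Omega_{\rm pf})$ with $\Sigma$ symmetric and trace-free, $V_1>0=V_2=V_3$, $\Omega_{\rm pf}>0$ and $\tfrac16\Sigma_{ab}\Sigma^{ab}+V_aV^a+\Omega_{\rm pf}=1$. (1) For $\gamma>0$, there is a solution for $t>0$ with $\rho>0$, $\mathcal J\neq0$ and metric $$ds^2=-dt^2+t^2dx^2+t^{\frac{2-\gamma}{\gamma}}(dy^2+dz^2)$$ ("Wonderland") if and only if $\gamma\in(2/3,2)$. (2) For $\gamma\in(2/3,2)$ Wonderland is locally rotationally symmetric about the $x$-axis, $\mathcal J$ is aligned with that axis, it is self-similar (it has a proper homothetic vector field nowhere tangent to the surfaces $t=$ const), $H>0$, $q=\tfrac32\gamma-1$, and its state is constant, equal to the point $W_\gamma$ of the state space given by $\Sigma=\mathrm{diag}(-2\Sigma_+,\Sigma_+,\Sigma_+)$ with $\Sigma_+=-\tfrac{3\gamma-2}{4}$ (so $\Sigma_{11}>\Sigma_{22}=\Sigma_{33}$: prolate), $V_1=\tfrac14\sqrt{3(2-\gamma)(3\gamma-2)}$, $\Omega_{\rm pf}=\tfrac34(2-\gamma)$.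 (3) $W_\gamma$ tends to the flat FLRW state ($\Sigma=0,V=0,\Omega_{\rm pf}=1$) as $\gamma\to2/3^+$ and to the Kasner state ($\Sigma=\mathrm{diag}(2,-1,-1)$, i.e. $\Sigma_+=-1$, $V=0$, $\Omega_{\rm pf}=0$) as $\gamma\to2^-$. (4) For $\gamma\in(2/3,6/5]$, $W_\gamma$ is the global attractor of the state space: for every point of the state space, every $H_0>0$ and every $t_0$ there is a solution, defined for all $t\ge t_0$, with that state and $H=H_0$ at $t_0$; along every solution on an interval $(a,\infty)$ which at some time has $H>0$, $\rho>0$, $\mathcal J\ne0$, one has $H>0$ throughout, the state stays in the state space and converges to $W_\gamma$ as $t\to\infty$; and $W_\gamma$ is Lyapunov stable. -/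

import Mathlib

open Set Filter Topology
open scoped Matrix ContDiff

namespace BianchiI

noncomputable section

/-! ### Coordinate differential geometry on `ℝ⁴`, coordinates `x 0 = t`, `x 1, x 2, x 3` -/

/-- Points of the coordinate space `ℝ⁴`. -/
abbrev Point := Fin 4 → ℝ

/-- A field of symmetric (by use) covariant 2-tensors, given by its component matrix. -/
abbrev TensorField := Point → Matrix (Fin 4) (Fin 4) ℝ

/-- The partial derivative `∂_μ f` at `x`. -/
def pd (μ : Fin 4) (f : Point → ℝ) (x : Point) : ℝ :=
  lineDeriv ℝ f x (Pi.single μ 1)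

/-- The Christoffel symbol `Γ^α_{μν}` of the metric `G`. -/
def christoffel (G : TensorField) (α μ ν : Fin 4) (x : Point) : ℝ :=
  (1 / 2) * ∑ σ, (G x)⁻¹ α σ *
    (pd μ (fun y => G y σ ν) x + pd ν (fun y => G y σ μ) x - pd σ (fun y => G y μ ν) x)

/-- The Ricci tensor
`R_{μν} = ∂_α Γ^α_{μν} - ∂_ν Γ^α_{μα} + Γ^α_{αβ} Γ^β_{μν} - Γ^α_{νβ} Γ^β_{μα}`. -/
def ricci (G : TensorField) (x : Point) : Matrix (Fin 4) (Fin 4) ℝ :=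
  Matrix.of fun μ ν =>
    ∑ α, (pd α (christoffel G α μ ν) x - pd ν (christoffel G α μ α) x
      + ∑ β, (christoffel G α α β x * christoffel G β μ ν x
        - christoffel G α ν β x * christoffel G β μ α x))

/-- The scalar curvature `R = g^{μν} R_{μν}`. -/
def scalarCurvature (G : TensorField) (x : Point) : ℝ :=
  ∑ μ, ∑ ν, (G x)⁻¹ μ ν * ricci G x μ ν

/-- The Einstein tensor `R_{μν} - (1/2) R g_{μν}`. -/
def einstein (G : TensorField) (x : Point) : Matrix (Fin 4) (Fin 4) ℝ :=
  ricci G x - ((1 / 2) * scalarCurvature G x) • G x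

/-- The covariant derivative `∇_α T_{μν}`. -/
def covDeriv₂ (G T : TensorField) (α μ ν : Fin 4) (x : Point) : ℝ :=
  pd α (fun y => T y μ ν) x
    - ∑ β, (christoffel G β α μ x * T x β ν + christoffel G β α ν x * T x μ β)

/-- The divergence `∇^μ T_{μν}`. -/
def divergence (G T : TensorField) (ν : Fin 4) (x : Point) : ℝ :=
  ∑ α, ∑ μ, (G x)⁻¹ α μ * covDeriv₂ G T α μ ν x

/-- The covariant derivative `∇_μ A_ν` of a covector field. -/
def covDeriv₁ (G : TensorField) (A : Point → Fin 4 → ℝ) (μ ν : Fin 4) (x : Point) : ℝ :=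
  pd μ (fun y => A y ν) x - ∑ β, christoffel G β μ ν x * A x β

/-- The Lie derivative `(L_X g)_{μν} = X^α ∂_α g_{μν} + g_{αν} ∂_μ X^α + g_{μα} ∂_ν X^α`. -/
def lieDeriv (X : Point → Fin 4 → ℝ) (G : TensorField) (x : Point) :
    Matrix (Fin 4) (Fin 4) ℝ :=
  Matrix.of fun μ ν =>
    ∑ α, (X x α * pd α (fun y => G y μ ν) x
      + G x α ν * pd μ (fun y => X y α) x + G x μ α * pd ν (fun y => X y α) x)

/-! ### Bianchi type I models with a perfect fluid and a `j`-form -/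

/-- The fields of a Bianchi type I model: the spatial metric `g_ij(t)` in
`ds² = -dt² + g_ij(t) dx^i dx^j`, the energy density `ρ(t)` of the perfect fluid, and the
components `(J_0, J_1, J_2, J_3)(t)` of the homogeneous field strength in the coordinate basis.
The equations they obey are in `IsSolution`. -/
structure Model where
  g : ℝ → Matrix (Fin 3) (Fin 3) ℝ
  ρ : ℝ → ℝ
  J : ℝ → Fin 4 → ℝ

/-- The space-time metric `-dt² + g_ij(t) dx^i dx^j`. -/
def Model.metric (M : Model) : TensorField := fun x =>
  Matrix.of fun μ ν =>
    Fin.cases (Fin.cases (-1) (fun _ => 0) ν)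
      (fun i => Fin.cases 0 (fun j => M.g (x 0) i j) ν) μ

/-- The field strength as a covector field on space-time. -/
def Model.field (M : Model) : Point → Fin 4 → ℝ := fun x => M.J (x 0)

/-- Energy-momentum tensor `(ρ + p) u_μ u_ν + p g_{μν}` of the `γ`-law fluid, `p = (γ - 1) ρ`,
with 4-velocity `u = ∂/∂t`, so `u_μ = g_{μ0}`. -/
def Model.fluidTensor (γ : ℝ) (M : Model) : TensorField := fun x =>
  Matrix.of fun μ ν =>
    (M.ρ (x 0) + (γ - 1) * M.ρ (x 0)) * (M.metric x μ 0 * M.metric x ν 0)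
      + (γ - 1) * M.ρ (x 0) * M.metric x μ ν

/-- Energy-momentum tensor `J_μ J_ν - (1/2) g_{μν} J_α J^α` of the `j`-form. -/
def Model.formTensor (M : Model) : TensorField := fun x =>
  Matrix.of fun μ ν =>
    M.field x μ * M.field x ν
      - (1 / 2) * M.metric x μ ν *
        ∑ α, ∑ β, (M.metric x)⁻¹ α β * M.field x α * M.field x β

/-- `M` is, during the open time interval `I`, a Bianchi type I solution of the Einstein equations
(`8πG = c = 1`) with a `γ`-law perfect fluid and a purely spatial, source-free `j`-form, the two
fluids not interacting. -/
structure IsSolution (γ : ℝ) (M : Model) (I : Set ℝ) : Prop where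
  posDef : ∀ t ∈ I, (M.g t).PosDef
  contDiff_g : ∀ i j, ContDiffOn ℝ 2 (fun t => M.g t i j) I
  contDiff_ρ : ContDiffOn ℝ 1 M.ρ I
  contDiff_J : ∀ μ, ContDiffOn ℝ 1 (fun t => M.J t μ) I
  spatial : ∀ t ∈ I, M.J t 0 = 0
  einstein_eq : ∀ x : Point, x 0 ∈ I →
    einstein M.metric x = M.fluidTensor γ x + M.formTensor x
  fluid_eq : ∀ x : Point, x 0 ∈ I → ∀ ν, divergence M.metric (M.fluidTensor γ) ν x = 0
  closed : ∀ x : Point, x 0 ∈ I → ∀ μ ν,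
    covDeriv₁ M.metric M.field μ ν x - covDeriv₁ M.metric M.field ν μ x = 0
  coclosed : ∀ x : Point, x 0 ∈ I →
    ∑ μ, ∑ ν, (M.metric x)⁻¹ μ ν * covDeriv₁ M.metric M.field μ ν x = 0

/-! ### Kinematics and expansion-normalized variables -/

/-- The expansion tensor `θ_ij = ∇_i u_j = (1/2) dg_ij/dt` of the normal congruence. -/
def Model.expansion (M : Model) (t : ℝ) : Matrix (Fin 3) (Fin 3) ℝ :=
  Matrix.of fun i j => (1 / 2) * deriv (fun s => M.g s i j) t

/-- The Hubble parameter `H = (1/3) g^{ij} θ_ij`. -/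
def Model.hubble (M : Model) (t : ℝ) : ℝ :=
  (1 / 3) * ((M.g t)⁻¹ * M.expansion t).trace

/-- The deceleration parameter `q`, defined by `dH/dt = -(1 + q) H²` (used where `H ≠ 0`). -/
def Model.deceleration (M : Model) (t : ℝ) : ℝ :=
  -1 - deriv M.hubble t / M.hubble t ^ 2

/-- The components of the spatial part of the field strength in the frame whose vectors are the
columns of `E`. -/
def Model.frameField (M : Model) (t : ℝ) (E : Matrix (Fin 3) (Fin 3) ℝ) : Fin 3 → ℝ :=
  (fun i : Fin 3 => M.J t i.succ) ᵥ* E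

/-- The columns of `E` form a spatial orthonormal frame at time `t` whose first vector points along
the (nonzero) spatial field strength. -/
structure IsAlignedFrame (M : Model) (t : ℝ) (E : Matrix (Fin 3) (Fin 3) ℝ) : Prop where
  orthonormal : Eᵀ * M.g t * E = 1
  pos : 0 < M.frameField t E 0
  zero₁ : M.frameField t E 1 = 0
  zero₂ : M.frameField t E 2 = 0

/-- Expansion-normalized variables: shear `Σ_ab`, field strength `V_a`, fluid density `Ω_pf`. -/
abbrev State := Matrix (Fin 3) (Fin 3) ℝ × (Fin 3 → ℝ) × ℝ

/-- `Σ_ab = σ_ab / H = θ_ab / H - δ_ab`, `V_a = v_a / (√6 H)`, `Ω_pf = ρ / (3 H²)`, with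
components in the frame `E`. -/
def Model.state (M : Model) (t : ℝ) (E : Matrix (Fin 3) (Fin 3) ℝ) : State :=
  ((M.hubble t)⁻¹ • (Eᵀ * M.expansion t * E) - 1,
    (Real.sqrt 6 * M.hubble t)⁻¹ • M.frameField t E,
    M.ρ t / (3 * M.hubble t ^ 2))

/-- The type I state space, with both the fluid and the (purely spatial) `j`-form present, in frames
aligned with the field strength; the last condition is the Hamiltonian constraint
`Σ² + V² + Ω_pf = 1`, with `Σ² = Σ_ab Σ^ab / 6`. -/
def stateSpace : Set State :=
  {S | S.1ᵀ = S.1 ∧ S.1.trace = 0 ∧ 0 < S.2.1 0 ∧ S.2.1 1 = 0 ∧ S.2.1 2 = 0 ∧ 0 < S.2.2 ∧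
    (1 / 6) * (S.1 * S.1).trace + ∑ a, S.2.1 a ^ 2 + S.2.2 = 1}

/-- `S` is the global attractor of the type I state space: every point of the state space evolves
for all future times, every orbit stays in the state space and converges to `S`, and `S` is
(Lyapunov) stable. -/
structure IsGlobalAttractor (γ : ℝ) (S : State) : Prop where
  evolves : ∀ S₀ ∈ stateSpace, ∀ H₀ > 0, ∀ t₀ : ℝ, ∃ a < t₀, ∃ (M : Model) (E : _),
    IsSolution γ M (Ioi a) ∧ IsAlignedFrame M t₀ E ∧ M.hubble t₀ = H₀ ∧ M.state t₀ E = S₀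
  invariant : ∀ (a : ℝ) (M : Model), IsSolution γ M (Ioi a) → ∀ t₀ > a,
    0 < M.hubble t₀ → 0 < M.ρ t₀ → M.J t₀ ≠ 0 →
    ∀ t > a, 0 < M.hubble t ∧ ∀ E, IsAlignedFrame M t E → M.state t E ∈ stateSpace
  attracts : ∀ (a : ℝ) (M : Model), IsSolution γ M (Ioi a) → ∀ t₀ > a,
    0 < M.hubble t₀ → 0 < M.ρ t₀ → M.J t₀ ≠ 0 →
    ∀ E : ℝ → Matrix (Fin 3) (Fin 3) ℝ, (∀ t > a, IsAlignedFrame M t (E t)) →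
      Tendsto (fun t => M.state t (E t)) atTop (𝓝 S)
  stable : ∀ U ∈ 𝓝 S, ∃ U₀ ∈ 𝓝 S, ∀ (a : ℝ) (M : Model), IsSolution γ M (Ioi a) → ∀ t₀ > a,
    0 < M.hubble t₀ → 0 < M.ρ t₀ →
    ∀ E₀, IsAlignedFrame M t₀ E₀ → M.state t₀ E₀ ∈ U₀ →
      ∀ t ≥ t₀, ∀ E, IsAlignedFrame M t E → M.state t E ∈ U

/-! ### Symmetries -/

/-- The rotation by `φ` about the `x`-axis, as a linear map of `ℝ⁴`. -/
def rotX (φ : ℝ) : Matrix (Fin 4) (Fin 4) ℝ :=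
  !![1, 0, 0, 0;
     0, 1, 0, 0;
     0, 0, Real.cos φ, -Real.sin φ;
     0, 0, Real.sin φ, Real.cos φ]

/-- Local rotational symmetry with axis along `x`: the rotations about the `x`-axis are isometries
and preserve the field strength (the density depends on `t` only). Together with the spatial
translations this gives a rotation group about every point. -/
def IsLRSAboutX (M : Model) (I : Set ℝ) : Prop :=
  ∀ (φ : ℝ) (x : Point), x 0 ∈ I →
    (rotX φ)ᵀ * M.metric (rotX φ *ᵥ x) * rotX φ = M.metric x ∧
    M.field (rotX φ *ᵥ x) ᵥ* rotX φ = M.field x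

/-- Self-similarity: there is a proper homothetic vector field, `L_X g = 2 c g` with a constant
`c ≠ 0`, nowhere tangent to the surfaces of homogeneity. -/
def IsSelfSimilar (M : Model) (I : Set ℝ) : Prop :=
  ∃ X : Point → Fin 4 → ℝ, ContDiffOn ℝ ∞ X {x | x 0 ∈ I} ∧ ∃ c : ℝ, c ≠ 0 ∧
    ∀ x : Point, x 0 ∈ I → X x 0 ≠ 0 ∧ lieDeriv X M.metric x = (2 * c) • M.metric x

/-! ### Wonderland -/

/-- The spatial part of `-dt² + t² dx² + t^{(2-γ)/γ} (dy² + dz²)`. -/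
def wonderlandMetric (γ t : ℝ) : Matrix (Fin 3) (Fin 3) ℝ :=
  Matrix.diagonal ![t ^ 2, t ^ ((2 - γ) / γ), t ^ ((2 - γ) / γ)]

/-- `M` is Wonderland: a solution for `t > 0` with the Wonderland line element that contains both
the perfect fluid and a `j`-form. -/
structure IsWonderland (γ : ℝ) (M : Model) : Prop where
  metric_eq : M.g = wonderlandMetric γ
  solution : IsSolution γ M (Ioi 0)
  fluid_pos : ∀ t > 0, 0 < M.ρ t
  field_ne : ∀ t > 0, M.J t ≠ 0

/-- The expansion-normalized state with `Σ_ab = diag(-2Σ₊, Σ₊, Σ₊)`, `Σ₊ = -(3γ-2)/4`,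
`V_1 = √(3(2-γ)(3γ-2))/4`, `Ω_pf = 3(2-γ)/4`. -/
def wonderlandState (γ : ℝ) : State :=
  (Matrix.diagonal ![(3 * γ - 2) / 2, -(3 * γ - 2) / 4, -(3 * γ - 2) / 4],
    ![Real.sqrt (3 * (2 - γ) * (3 * γ - 2)) / 4, 0, 0],
    3 * (2 - γ) / 4)

/-- The flat FLRW state: no shear, no `j`-form, `Ω_pf = 1`. -/
def flrwState : State := (0, 0, 1)

/-- The LRS Kasner state with `Σ₊ = -1`: no matter, `Σ_ab = diag(2, -1, -1)`. -/
def kasnerState : State := (Matrix.diagonal ![2, -1, -1], 0, 0)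

end

end BianchiI

namespace BianchiI

noncomputable section

/-! ### Curvature of the metric `-dt² + g_ij(t) dx^i dx^j` -/

/-- The block matrix with a scalar time-time entry and a spatial block. -/
def block (a : ℝ) (A : Matrix (Fin 3) (Fin 3) ℝ) : Matrix (Fin 4) (Fin 4) ℝ :=
  Matrix.of fun μ ν =>
    Fin.cases (Fin.cases a (fun _ => 0) ν) (fun i => Fin.cases 0 (fun j => A i j) ν) μ

@[simp] lemma block_zero_zero (a : ℝ) (A : Matrix (Fin 3) (Fin 3) ℝ) : block a A 0 0 = a := rfl

@[simp] lemma block_zero_succ (a : ℝ) (A : Matrix (Fin 3) (Fin 3) ℝ) (j : Fin 3) :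
    block a A 0 j.succ = 0 := rfl

@[simp] lemma block_succ_zero (a : ℝ) (A : Matrix (Fin 3) (Fin 3) ℝ) (i : Fin 3) :
    block a A i.succ 0 = 0 := rfl

@[simp] lemma block_succ_succ (a : ℝ) (A : Matrix (Fin 3) (Fin 3) ℝ) (i j : Fin 3) :
    block a A i.succ j.succ = A i j := rfl

lemma sum_fin_four (f : Fin 4 → ℝ) : ∑ μ, f μ = f 0 + ∑ i : Fin 3, f i.succ :=
  Fin.sum_univ_succ f

lemma matrix_four_ext {A B : Matrix (Fin 4) (Fin 4) ℝ} (h00 : A 0 0 = B 0 0)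
    (h0 : ∀ j : Fin 3, A 0 j.succ = B 0 j.succ) (h1 : ∀ i : Fin 3, A i.succ 0 = B i.succ 0)
    (h2 : ∀ i j : Fin 3, A i.succ j.succ = B i.succ j.succ) : A = B := by
  ext μ ν
  refine Fin.cases ?_ (fun i => ?_) μ <;> refine Fin.cases ?_ (fun j => ?_) ν
  exacts [h00, h0 j, h1 i, h2 i j]

lemma block_mul (a b : ℝ) (A B : Matrix (Fin 3) (Fin 3) ℝ) :
    block a A * block b B = block (a * b) (A * B) := by
  apply matrix_four_ext <;> intros <;> simp [Matrix.mul_apply, sum_fin_four]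

lemma block_one : block 1 1 = 1 := by
  apply matrix_four_ext <;> intros <;>
    simp [Matrix.one_apply, Fin.succ_ne_zero, (Fin.succ_ne_zero _).symm]

lemma metric_eq_block (M : Model) (x : Point) : M.metric x = block (-1) (M.g (x 0)) := rfl

lemma metric_inv (M : Model) {x : Point} (h : IsUnit (M.g (x 0)).det) :
    (M.metric x)⁻¹ = block (-1) (M.g (x 0))⁻¹ := by
  apply Matrix.inv_eq_right_inv
  rw [metric_eq_block, block_mul, Matrix.mul_nonsing_inv _ h, neg_one_mul, neg_neg, block_one]

lemma pd_zero_of_eqOn {I : Set ℝ} (hI : IsOpen I) {f : Point → ℝ} {F : ℝ → ℝ}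
    (h : ∀ y : Point, y 0 ∈ I → f y = F (y 0)) {x : Point} (hx : x 0 ∈ I) :
    pd 0 f x = deriv F (x 0) := by
  have hnhds : ∀ᶠ t : ℝ in 𝓝 0, x 0 + t ∈ I := by
    have : ContinuousAt (fun t : ℝ => x 0 + t) 0 := by fun_prop
    exact this.eventually_mem (by simpa using hI.mem_nhds hx)
  have : (fun t : ℝ => f (x + t • Pi.single 0 1)) =ᶠ[𝓝 0] fun t => F (x 0 + t) := by
    filter_upwards [hnhds] with t ht
    rw [h] <;> simp [ht]
  rw [pd, lineDeriv, this.deriv_eq, deriv_comp_const_add, add_zero]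

lemma pd_succ_of_eqOn {I : Set ℝ} {f : Point → ℝ} {F : ℝ → ℝ}
    (h : ∀ y : Point, y 0 ∈ I → f y = F (y 0)) {x : Point} (hx : x 0 ∈ I) (i : Fin 3) :
    pd i.succ f x = 0 := by
  have : (fun t : ℝ => f (x + t • Pi.single i.succ 1)) = fun _ => F (x 0) := by
    funext t
    rw [h] <;> simp [hx, (Fin.succ_ne_zero i).symm]
  rw [pd, lineDeriv, this, deriv_const]

@[simp] lemma pd_const (μ : Fin 4) (c : ℝ) (x : Point) : pd μ (fun _ => c) x = 0 := by
  simp [pd, lineDeriv]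

lemma pd_zero_comp (F : ℝ → ℝ) (x : Point) : pd 0 (fun y => F (y 0)) x = deriv F (x 0) :=
  pd_zero_of_eqOn isOpen_univ (fun _ _ => rfl) (mem_univ _)

lemma pd_succ_comp (F : ℝ → ℝ) (x : Point) (i : Fin 3) : pd i.succ (fun y => F (y 0)) x = 0 :=
  pd_succ_of_eqOn (I := univ) (fun _ _ => rfl) (mem_univ _) i

/-- The mixed expansion tensor `g^{ik} θ_kj`. -/
def Model.mixed (M : Model) (t : ℝ) : Matrix (Fin 3) (Fin 3) ℝ := (M.g t)⁻¹ * M.expansion t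

lemma pd_zero_metric_succ (M : Model) (x : Point) (i j : Fin 3) :
    pd 0 (fun y => M.metric y i.succ j.succ) x = 2 * M.expansion (x 0) i j := by
  have := pd_zero_comp (fun t => M.g t i j) x
  simp only [metric_eq_block, block_succ_succ, this, Model.expansion, Matrix.of_apply]
  ring

lemma pd_succ_metric (M : Model) (x : Point) (k : Fin 3) (μ ν : Fin 4) :
    pd k.succ (fun y => M.metric y μ ν) x = 0 :=
  pd_succ_comp (fun t => block (-1) (M.g t) μ ν) x k

lemma pd_metric_zero_left (M : Model) (x : Point) (μ ν : Fin 4) :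
    pd μ (fun y => M.metric y 0 ν) x = 0 := by
  refine Fin.cases ?_ (fun j => ?_) ν <;> simp [metric_eq_block]

lemma pd_metric_zero_right (M : Model) (x : Point) (μ ν : Fin 4) :
    pd μ (fun y => M.metric y ν 0) x = 0 := by
  refine Fin.cases ?_ (fun j => ?_) ν <;> simp [metric_eq_block]

lemma christoffel_zero_zero (M : Model) (α : Fin 4) (x : Point) :
    christoffel M.metric α 0 0 x = 0 := by
  simp [christoffel, pd_metric_zero_left, pd_metric_zero_right]

section Christoffel

variable (M : Model) {x : Point} (h : IsUnit (M.g (x 0)).det)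
include h

lemma christoffel_zero_zero_succ (j : Fin 3) : christoffel M.metric 0 0 j.succ x = 0 := by
  simp [christoffel, pd_metric_zero_left, pd_metric_zero_right, metric_inv M h, sum_fin_four]

lemma christoffel_zero_succ_zero (j : Fin 3) : christoffel M.metric 0 j.succ 0 x = 0 := by
  simp [christoffel, pd_metric_zero_left, pd_metric_zero_right, metric_inv M h, sum_fin_four]

lemma christoffel_zero_succ_succ (i j : Fin 3) :
    christoffel M.metric 0 i.succ j.succ x = M.expansion (x 0) i j := by
  simp [christoffel, pd_succ_metric, pd_zero_metric_succ, metric_inv M h, sum_fin_four]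

lemma christoffel_succ_zero_succ (k j : Fin 3) :
    christoffel M.metric k.succ 0 j.succ x = M.mixed (x 0) k j := by
  simp only [christoffel, metric_inv M h, sum_fin_four, pd_metric_zero_left,
    pd_zero_metric_succ, block_succ_zero, block_succ_succ, Model.mixed, Matrix.mul_apply,
    pd_metric_zero_right]
  simp only [mul_zero, zero_add, add_zero, sub_zero, Finset.mul_sum]
  exact Finset.sum_congr rfl fun _ _ => by ring

lemma christoffel_succ_succ_zero (k j : Fin 3) :
    christoffel M.metric k.succ j.succ 0 x = M.mixed (x 0) k j := by
  rw [← christoffel_succ_zero_succ M h]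
  simp only [christoffel, sum_fin_four, pd_metric_zero_left,
    pd_zero_metric_succ, pd_metric_zero_right]
  simp

lemma christoffel_succ_succ_succ (k i j : Fin 3) :
    christoffel M.metric k.succ i.succ j.succ x = 0 := by
  simp [christoffel, metric_inv M h, sum_fin_four, pd_succ_metric]

end Christoffel

section Ricci

variable (M : Model) {I : Set ℝ} (hI : IsOpen I) (h : ∀ t ∈ I, IsUnit (M.g t).det)
  {x : Point} (hx : x 0 ∈ I)
include hI h hx

lemma pd_zero_christoffel {F : ℝ → ℝ} {α μ ν : Fin 4}
    (hF : ∀ y : Point, IsUnit (M.g (y 0)).det → christoffel M.metric α μ ν y = F (y 0)) :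
    pd 0 (christoffel M.metric α μ ν) x = deriv F (x 0) :=
  pd_zero_of_eqOn hI (fun y hy => hF y (h _ hy)) hx

omit hI in
lemma pd_succ_christoffel (i : Fin 3) (α μ ν : Fin 4) :
    pd i.succ (christoffel M.metric α μ ν) x = 0 := by
  have key : ∀ F : ℝ → ℝ,
      (∀ y : Point, IsUnit (M.g (y 0)).det → christoffel M.metric α μ ν y = F (y 0)) →
      pd i.succ (christoffel M.metric α μ ν) x = 0 := fun F hF =>
    pd_succ_of_eqOn (fun y hy => hF y (h _ hy)) hx i
  induction α using Fin.cases <;> induction μ using Fin.cases <;> induction ν using Fin.cases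
  · exact key (fun _ => 0) fun y _ => christoffel_zero_zero M _ y
  · exact key (fun _ => 0) fun y hy => christoffel_zero_zero_succ M hy _
  · exact key (fun _ => 0) fun y hy => christoffel_zero_succ_zero M hy _
  · exact key (fun t => M.expansion t _ _) fun y hy => christoffel_zero_succ_succ M hy _ _
  · exact key (fun _ => 0) fun y _ => christoffel_zero_zero M _ y
  · exact key (fun t => M.mixed t _ _) fun y hy => christoffel_succ_zero_succ M hy _ _
  · exact key (fun t => M.mixed t _ _) fun y hy => christoffel_succ_succ_zero M hy _ _
  · exact key (fun _ => 0) fun y hy => christoffel_succ_succ_succ M hy _ _ _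

lemma ricci_zero_zero :
    ricci M.metric x 0 0 = -(∑ i, deriv (fun t => M.mixed t i i) (x 0))
      - (M.mixed (x 0) * M.mixed (x 0)).trace := by
  have hu := h _ hx
  have e1 := pd_zero_christoffel M hI h hx (fun y _ => christoffel_zero_zero M 0 y)
    (F := fun _ => 0)
  have e2 : ∀ i j : Fin 3, pd 0 (christoffel M.metric i.succ 0 j.succ) x
      = deriv (fun t => M.mixed t i j) (x 0) := fun i j =>
    pd_zero_christoffel M hI h hx (fun y hy => christoffel_succ_zero_succ M hy i j)
  simp only [ricci, Matrix.of_apply, sum_fin_four, pd_succ_christoffel M h hx, e1, e2,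
    christoffel_zero_zero M, christoffel_zero_zero_succ M hu,
    christoffel_succ_zero_succ M hu, Matrix.trace, Matrix.diag_apply,
    Matrix.mul_apply]
  simp only [deriv_const, mul_zero, sub_zero, zero_sub, zero_add, add_zero,
    Finset.sum_const_zero, Finset.sum_add_distrib, Finset.sum_neg_distrib]
  ring

lemma ricci_zero_succ (j : Fin 3) : ricci M.metric x 0 j.succ = 0 := by
  have hu := h _ hx
  have e1 := pd_zero_christoffel M hI h hx (fun y hy => christoffel_zero_zero_succ M hy j)
    (F := fun _ => 0)
  simp only [ricci, Matrix.of_apply, sum_fin_four, pd_succ_christoffel M h hx, e1,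
    christoffel_zero_zero M, christoffel_zero_zero_succ M hu, christoffel_zero_succ_zero M hu,
    christoffel_succ_zero_succ M hu, christoffel_succ_succ_succ M hu]
  simp

lemma ricci_succ_zero (i : Fin 3) : ricci M.metric x i.succ 0 = 0 := by
  have hu := h _ hx
  have e1 := pd_zero_christoffel M hI h hx (fun y hy => christoffel_zero_succ_zero M hy i)
    (F := fun _ => 0)
  have e2 : ∀ k l j : Fin 3, pd 0 (christoffel M.metric k.succ l.succ j.succ) x = 0 :=
    fun k l j => (pd_zero_christoffel M hI h hx (F := fun _ => 0)
      (fun y hy => christoffel_succ_succ_succ M hy k l j)).trans (deriv_const _ _)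
  simp only [ricci, Matrix.of_apply, sum_fin_four, pd_succ_christoffel M h hx, e1, e2,
    christoffel_zero_zero M, christoffel_zero_zero_succ M hu, christoffel_zero_succ_zero M hu,
    christoffel_succ_zero_succ M hu, christoffel_succ_succ_succ M hu,
    christoffel_succ_succ_zero M hu]
  simp

lemma ricci_succ_succ (i j : Fin 3) :
    ricci M.metric x i.succ j.succ = deriv (fun t => M.expansion t i j) (x 0)
      + (M.mixed (x 0)).trace * M.expansion (x 0) i j
      - ((M.expansion (x 0) * M.mixed (x 0)) j i + (M.expansion (x 0) * M.mixed (x 0)) i j) := by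
  have hu := h _ hx
  have e1 := pd_zero_christoffel M hI h hx (fun y hy => christoffel_zero_succ_succ M hy i j)
    (F := fun t => M.expansion t i j)
  simp only [ricci, Matrix.of_apply, sum_fin_four, pd_succ_christoffel M h hx, e1,
    christoffel_zero_zero M, christoffel_zero_zero_succ M hu, christoffel_zero_succ_zero M hu,
    christoffel_succ_succ_succ M hu,
    christoffel_succ_succ_zero M hu, christoffel_zero_succ_succ M hu, Matrix.trace,
    Matrix.diag_apply, Matrix.mul_apply]
  simp only [mul_zero, zero_mul, sub_zero, zero_sub, zero_add, add_zero,
    Finset.sum_const_zero, Finset.sum_neg_distrib, Finset.sum_sub_distrib,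
    Finset.sum_mul]
  have e3 : ∀ k, M.mixed (x 0) k j * M.expansion (x 0) i k
      = M.expansion (x 0) i k * M.mixed (x 0) k j := fun k => mul_comm _ _
  simp only [e3]
  ring

end Ricci

/-! ### The field equations as ordinary differential equations -/

/-- The spatial components of the field strength. -/
def Model.spatialField (M : Model) (t : ℝ) : Fin 3 → ℝ := fun i => M.J t i.succ

/-- The square `J_α J^α` of the spatial field strength. -/
def Model.fieldSq (M : Model) (t : ℝ) : ℝ :=
  M.spatialField t ⬝ᵥ ((M.g t)⁻¹ *ᵥ M.spatialField t)

/-- The evolution equations of a Bianchi type I model in the coordinate basis. -/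
structure IsEvolution (γ : ℝ) (M : Model) (I : Set ℝ) : Prop where
  posDef : ∀ t ∈ I, (M.g t).PosDef
  contDiff_g : ∀ i j, ContDiffOn ℝ 2 (fun t => M.g t i j) I
  contDiff_ρ : ContDiffOn ℝ 1 M.ρ I
  contDiff_J : ∀ μ, ContDiffOn ℝ 1 (fun t => M.J t μ) I
  spatial : ∀ t ∈ I, M.J t 0 = 0
  expansion_eq : ∀ t ∈ I, ∀ i j, deriv (fun s => M.expansion s i j) t
    = 2 * (M.expansion t * M.mixed t) i j - (M.mixed t).trace * M.expansion t i j
      + M.spatialField t i * M.spatialField t j + (2 - γ) / 2 * M.ρ t * M.g t i j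
  raychaudhuri : ∀ t ∈ I, ∑ i, deriv (fun s => M.mixed s i i) t
    = -(M.mixed t * M.mixed t).trace - (3 * γ - 2) / 2 * M.ρ t
  fluid : ∀ t ∈ I, deriv M.ρ t = -γ * (M.mixed t).trace * M.ρ t
  field : ∀ t ∈ I, ∀ i : Fin 3, deriv (fun s => M.J s i.succ) t = 0

section Components

variable {M : Model} {I : Set ℝ}

lemma isUnit_det_of_posDef {A : Matrix (Fin 3) (Fin 3) ℝ} (h : A.PosDef) : IsUnit A.det :=
  h.det_pos.ne'.isUnit

lemma symm_of_posDef {A : Matrix (Fin 3) (Fin 3) ℝ} (h : A.PosDef) : Aᵀ = A := by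
  simpa [Matrix.IsHermitian] using h.isHermitian

lemma inv_symm_of_posDef {A : Matrix (Fin 3) (Fin 3) ℝ} (h : A.PosDef) : (A⁻¹)ᵀ = A⁻¹ := by
  rw [Matrix.transpose_nonsing_inv, symm_of_posDef h]

lemma expansion_symm (hI : IsOpen I) (h : ∀ t ∈ I, (M.g t).PosDef) {t : ℝ} (ht : t ∈ I) :
    (M.expansion t)ᵀ = M.expansion t := by
  ext i j
  simp only [Model.expansion, Matrix.transpose_apply, Matrix.of_apply]
  congr 1
  refine Filter.EventuallyEq.deriv_eq ?_
  filter_upwards [hI.mem_nhds ht] with s hs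
  exact congrFun (congrFun (symm_of_posDef (h s hs)) i) j

lemma expansion_mul_mixed_symm (hI : IsOpen I) (h : ∀ t ∈ I, (M.g t).PosDef) {t : ℝ} (ht : t ∈ I) :
    (M.expansion t * M.mixed t)ᵀ = M.expansion t * M.mixed t := by
  rw [Model.mixed, ← Matrix.mul_assoc, Matrix.transpose_mul, Matrix.transpose_mul,
    expansion_symm hI h ht, inv_symm_of_posDef (h t ht), Matrix.mul_assoc]

lemma sum_inv_mul_self {A : Matrix (Fin 3) (Fin 3) ℝ} (h : A.PosDef) :
    ∑ i, ∑ j, A⁻¹ i j * A i j = 3 := by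
  have h1 : (A⁻¹ * A).trace = 3 := by
    rw [Matrix.nonsing_inv_mul _ (isUnit_det_of_posDef h)]; simp
  rw [← h1]
  simp only [Matrix.trace, Matrix.diag_apply, Matrix.mul_apply]
  refine Finset.sum_congr rfl fun i _ => Finset.sum_congr rfl fun j _ => ?_
  rw [show A i j = A j i from congrFun (congrFun (symm_of_posDef h) j) i]

lemma formTensor_contraction {x : Point} (h : (M.g (x 0)).PosDef) (hJ : M.J (x 0) 0 = 0) :
    ∑ α, ∑ β, (M.metric x)⁻¹ α β * M.field x α * M.field x β = M.fieldSq (x 0) := by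
  simp only [metric_inv M (isUnit_det_of_posDef h), sum_fin_four, Model.field, hJ, Model.fieldSq,
    dotProduct, Matrix.mulVec, block_succ_succ, Model.spatialField, Finset.mul_sum]
  simp only [mul_zero, zero_mul, Finset.sum_const_zero, zero_add]
  exact Finset.sum_congr rfl fun i _ => Finset.sum_congr rfl fun j _ => by ring

lemma sum_inv_mul_field {t : ℝ} :
    ∑ i, ∑ j, (M.g t)⁻¹ i j * (M.spatialField t i * M.spatialField t j) = M.fieldSq t := by
  simp only [Model.fieldSq, dotProduct, Matrix.mulVec, Finset.mul_sum]
  exact Finset.sum_congr rfl fun i _ => Finset.sum_congr rfl fun j _ => by ring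

/-- The Einstein equations in trace-reversed form. -/
lemma einstein_iff (γ : ℝ) (hI : IsOpen I) (h : ∀ t ∈ I, (M.g t).PosDef)
    (hJ : ∀ t ∈ I, M.J t 0 = 0) {x : Point} (hx : x 0 ∈ I) :
    einstein M.metric x = M.fluidTensor γ x + M.formTensor x ↔
      ricci M.metric x 0 0 = (3 * γ - 2) / 2 * M.ρ (x 0) ∧
      ∀ i j : Fin 3, ricci M.metric x i.succ j.succ
        = M.spatialField (x 0) i * M.spatialField (x 0) j
          + (2 - γ) / 2 * M.ρ (x 0) * M.g (x 0) i j := by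
  have hu : ∀ t ∈ I, IsUnit (M.g t).det := fun t ht => isUnit_det_of_posDef (h t ht)
  set R := ricci M.metric x with hR
  set N := M.fieldSq (x 0) with hN
  have r0 : ∀ j : Fin 3, R 0 j.succ = 0 := fun j => ricci_zero_succ M hI hu hx j
  have r1 : ∀ j : Fin 3, R j.succ 0 = 0 := fun j => ricci_succ_zero M hI hu hx j
  have hscal : scalarCurvature M.metric x
      = -R 0 0 + ∑ i : Fin 3, ∑ j : Fin 3, (M.g (x 0))⁻¹ i j * R i.succ j.succ := by
    simp only [scalarCurvature, metric_inv M (hu _ hx), sum_fin_four, ← hR, r0, r1]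
    simp
  have hS : ∀ μ ν, (M.fluidTensor γ x + M.formTensor x) μ ν
      = γ * M.ρ (x 0) * (M.metric x μ 0 * M.metric x ν 0)
        + (γ - 1) * M.ρ (x 0) * M.metric x μ ν
        + (M.field x μ * M.field x ν - (1 / 2) * M.metric x μ ν * N) := by
    intro μ ν
    simp only [Matrix.add_apply, Model.fluidTensor, Model.formTensor, Matrix.of_apply,
      formTensor_contraction (h _ hx) (hJ _ hx), ← hN]
    ring
  have hE : ∀ μ ν, einstein M.metric x μ ν
      = R μ ν - (1 / 2) * scalarCurvature M.metric x * M.metric x μ ν := by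
    intro μ ν
    simp [einstein, ← hR]
  have hf0 : M.field x 0 = 0 := hJ _ hx
  have hfi : ∀ i : Fin 3, M.field x i.succ = M.spatialField (x 0) i := fun _ => rfl
  have hP3 := sum_inv_mul_self (h _ hx)
  have hPJ := sum_inv_mul_field (M := M) (t := x 0)
  have hsum : ∀ a b : ℝ, ∑ i : Fin 3, ∑ j : Fin 3, (M.g (x 0))⁻¹ i j *
      (a * (M.spatialField (x 0) i * M.spatialField (x 0) j) + b * M.g (x 0) i j)
      = a * N + b * 3 := by
    intro a b
    rw [hN, ← hPJ, ← hP3]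
    simp only [Finset.mul_sum, ← Finset.sum_add_distrib]
    exact Finset.sum_congr rfl fun i _ => Finset.sum_congr rfl fun j _ => by ring
  constructor
  · intro he
    have e00 := congrFun (congrFun he 0) 0
    rw [hE, hS] at e00
    have eij : ∀ i j : Fin 3, R i.succ j.succ
        = 1 * (M.spatialField (x 0) i * M.spatialField (x 0) j)
          + ((1 / 2) * scalarCurvature M.metric x + (γ - 1) * M.ρ (x 0) - N / 2)
            * M.g (x 0) i j := by
      intro i j
      have := congrFun (congrFun he i.succ) j.succ
      rw [hE, hS] at this
      simp only [metric_eq_block, block_succ_succ, block_succ_zero, hfi] at this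
      linear_combination this
    simp only [metric_eq_block, block_zero_zero, hf0] at e00
    simp only [eij, hsum] at hscal
    have hsc : scalarCurvature M.metric x = N + (4 - 3 * γ) * M.ρ (x 0) := by
      linear_combination e00 - hscal
    refine ⟨by linear_combination e00 - (1 / 2) * hsc, fun i j => ?_⟩
    rw [eij, hsc]
    ring
  · rintro ⟨e00, eij⟩
    have hsc : scalarCurvature M.metric x = N + (4 - 3 * γ) * M.ρ (x 0) := by
      rw [hscal]
      have : ∀ i j : Fin 3, R i.succ j.succ
        = 1 * (M.spatialField (x 0) i * M.spatialField (x 0) j)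
          + ((2 - γ) / 2 * M.ρ (x 0)) * M.g (x 0) i j := fun i j => by rw [eij]; ring
      simp only [this, hsum, e00]
      ring
    apply matrix_four_ext <;> intros <;>
      rw [hE, hS, hsc] <;>
      simp only [metric_eq_block, block_zero_zero, block_zero_succ, block_succ_zero,
        block_succ_succ, hf0, hfi, e00, eij, r0, r1] <;> ring

lemma fluidTensor_eq_block (γ : ℝ) (M : Model) (x : Point) :
    M.fluidTensor γ x = block (M.ρ (x 0)) (((γ - 1) * M.ρ (x 0)) • M.g (x 0)) := by
  apply matrix_four_ext <;> intros <;>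
    simp [Model.fluidTensor, metric_eq_block]

lemma covDeriv₂_fluid_zero_zero (γ : ℝ) (M : Model) (x : Point) :
    covDeriv₂ M.metric (M.fluidTensor γ) 0 0 0 x = deriv M.ρ (x 0) := by
  have := pd_zero_comp M.ρ x
  simp [covDeriv₂, fluidTensor_eq_block, christoffel_zero_zero, this]

lemma covDeriv₂_fluid_zero_zero_succ (γ : ℝ) {x : Point} (h : IsUnit (M.g (x 0)).det)
    (j : Fin 3) : covDeriv₂ M.metric (M.fluidTensor γ) 0 0 j.succ x = 0 := by
  simp [covDeriv₂, sum_fin_four, fluidTensor_eq_block, christoffel_zero_zero,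
    christoffel_zero_zero_succ M h]

lemma covDeriv₂_fluid_succ_succ_zero (γ : ℝ) {x : Point} (h : IsUnit (M.g (x 0)).det)
    (i j : Fin 3) :
    covDeriv₂ M.metric (M.fluidTensor γ) i.succ j.succ 0 x
      = -(M.ρ (x 0) * M.expansion (x 0) i j)
        - (γ - 1) * M.ρ (x 0) * M.expansion (x 0) j i := by
  have e : ∑ k, M.mixed (x 0) k i * ((γ - 1) * M.ρ (x 0) * M.g (x 0) j k)
      = (γ - 1) * M.ρ (x 0) * M.expansion (x 0) j i := by
    have : M.g (x 0) * M.mixed (x 0) = M.expansion (x 0) := by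
      rw [Model.mixed, Matrix.mul_nonsing_inv_cancel_left _ _ h]
    rw [← this, Matrix.mul_apply, Finset.mul_sum]
    exact Finset.sum_congr rfl fun k _ => by ring
  simp only [covDeriv₂, sum_fin_four, fluidTensor_eq_block, block_succ_zero, block_zero_zero,
    block_succ_succ, Matrix.smul_apply, smul_eq_mul, pd_const, christoffel_zero_succ_succ M h,
    christoffel_succ_succ_succ M h, christoffel_succ_succ_zero M h, mul_zero, zero_add,
    add_zero, e]
  ring

lemma covDeriv₂_fluid_succ_succ_succ (γ : ℝ) {x : Point} (h : IsUnit (M.g (x 0)).det)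
    (i j k : Fin 3) : covDeriv₂ M.metric (M.fluidTensor γ) i.succ j.succ k.succ x = 0 := by
  have := pd_succ_comp (fun t => (γ - 1) * M.ρ t * M.g t j k) x i
  simp [covDeriv₂, sum_fin_four, fluidTensor_eq_block, christoffel_succ_succ_succ M h, this]

lemma divergence_fluid_zero (γ : ℝ) {x : Point} (hI : IsOpen I) (h : ∀ t ∈ I, (M.g t).PosDef)
    (hx : x 0 ∈ I) :
    divergence M.metric (M.fluidTensor γ) 0 x
      = -deriv M.ρ (x 0) - γ * (M.mixed (x 0)).trace * M.ρ (x 0) := by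
  have hu := isUnit_det_of_posDef (h _ hx)
  have hs : ∀ i j, M.expansion (x 0) i j = M.expansion (x 0) j i := fun i j =>
    congrFun (congrFun (expansion_symm hI h hx) j) i
  have htr : (M.mixed (x 0)).trace
      = ∑ i, ∑ j, (M.g (x 0))⁻¹ i j * M.expansion (x 0) j i := by
    simp [Matrix.trace, Model.mixed, Matrix.mul_apply]
  simp only [divergence, sum_fin_four, metric_inv M hu, block_zero_zero, block_zero_succ,
    block_succ_zero, block_succ_succ, covDeriv₂_fluid_zero_zero, zero_mul,
    covDeriv₂_fluid_succ_succ_zero γ hu, Finset.sum_const_zero, add_zero, zero_add]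
  rw [htr, mul_assoc, Finset.sum_mul, Finset.mul_sum, neg_one_mul,
    sub_eq_add_neg (-deriv M.ρ (x 0)), ← Finset.sum_neg_distrib]
  congr 1
  refine Finset.sum_congr rfl fun i _ => ?_
  rw [Finset.sum_mul, Finset.mul_sum, ← Finset.sum_neg_distrib]
  refine Finset.sum_congr rfl fun j _ => ?_
  rw [hs i j]
  ring

lemma divergence_fluid_succ (γ : ℝ) {x : Point} (h : IsUnit (M.g (x 0)).det) (k : Fin 3) :
    divergence M.metric (M.fluidTensor γ) k.succ x = 0 := by
  simp [divergence, sum_fin_four, metric_inv M h, covDeriv₂_fluid_zero_zero_succ γ h,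
    covDeriv₂_fluid_succ_succ_succ γ h]

lemma christoffel_symm (hI : IsOpen I) (h : ∀ t ∈ I, (M.g t).PosDef) {x : Point} (hx : x 0 ∈ I)
    (α μ ν : Fin 4) : christoffel M.metric α μ ν x = christoffel M.metric α ν μ x := by
  have hu := isUnit_det_of_posDef (h _ hx)
  induction α using Fin.cases <;> induction μ using Fin.cases <;> induction ν using Fin.cases <;>
    simp only [christoffel_zero_zero_succ M hu, christoffel_zero_succ_zero M hu,
      christoffel_succ_succ_succ M hu, christoffel_succ_zero_succ M hu,
      christoffel_succ_succ_zero M hu, christoffel_zero_succ_succ M hu]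
  rename_i i j
  exact congrFun (congrFun (expansion_symm hI h hx) j) i

lemma closed_iff (hI : IsOpen I) (h : ∀ t ∈ I, (M.g t).PosDef) {x : Point} (hx : x 0 ∈ I) :
    (∀ μ ν, covDeriv₁ M.metric M.field μ ν x - covDeriv₁ M.metric M.field ν μ x = 0) ↔
      ∀ i : Fin 3, deriv (fun s => M.J s i.succ) (x 0) = 0 := by
  have key : ∀ μ ν, covDeriv₁ M.metric M.field μ ν x - covDeriv₁ M.metric M.field ν μ x
      = pd μ (fun y => M.field y ν) x - pd ν (fun y => M.field y μ) x := by
    intro μ ν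
    simp only [covDeriv₁, christoffel_symm hI h hx _ μ ν]
    ring
  have e0 : ∀ ν, pd 0 (fun y => M.field y ν) x = deriv (fun s => M.J s ν) (x 0) := fun ν =>
    pd_zero_comp (fun s => M.J s ν) x
  have e1 : ∀ (i : Fin 3) ν, pd i.succ (fun y => M.field y ν) x = 0 := fun i ν =>
    pd_succ_comp (fun s => M.J s ν) x i
  simp only [key]
  constructor
  · intro H i
    simpa [e0, e1] using H 0 i.succ
  · intro H μ ν
    induction μ using Fin.cases <;> induction ν using Fin.cases <;> simp [e0, e1, H]

lemma coclosed_of_spatial (hI : IsOpen I) (h : ∀ t ∈ I, (M.g t).PosDef)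
    (hJ : ∀ t ∈ I, M.J t 0 = 0) {x : Point} (hx : x 0 ∈ I) :
    ∑ μ, ∑ ν, (M.metric x)⁻¹ μ ν * covDeriv₁ M.metric M.field μ ν x = 0 := by
  have hu := isUnit_det_of_posDef (h _ hx)
  have e0 : pd 0 (fun y => M.field y 0) x = 0 :=
    (pd_zero_of_eqOn hI (F := fun _ => 0) (fun y hy => hJ _ hy) hx).trans (deriv_const _ _)
  have e1 : ∀ (i : Fin 3) ν, pd i.succ (fun y => M.field y ν) x = 0 := fun i ν =>
    pd_succ_comp (fun s => M.J s ν) x i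
  have hf0 : M.field x 0 = 0 := hJ _ hx
  simp [sum_fin_four, metric_inv M hu, covDeriv₁, e0, e1, hf0, christoffel_zero_zero,
    christoffel_succ_succ_succ M hu]

/-- The field equations are equivalent to the evolution equations. -/
theorem isSolution_iff_isEvolution (γ : ℝ) (hI : IsOpen I) :
    IsSolution γ M I ↔ IsEvolution γ M I := by
  have hric : ∀ (_ : ∀ t ∈ I, (M.g t).PosDef) {x : Point} (_ : x 0 ∈ I) (i j : Fin 3),
      ricci M.metric x i.succ j.succ = deriv (fun t => M.expansion t i j) (x 0)
        + (M.mixed (x 0)).trace * M.expansion (x 0) i j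
        - 2 * (M.expansion (x 0) * M.mixed (x 0)) i j := by
    intro h x hx i j
    rw [ricci_succ_succ M hI (fun t ht => isUnit_det_of_posDef (h t ht)) hx,
      show (M.expansion (x 0) * M.mixed (x 0)) j i = (M.expansion (x 0) * M.mixed (x 0)) i j from
        congrFun (congrFun (expansion_mul_mixed_symm hI h hx) i) j]
    ring
  constructor
  · intro h
    have hu : ∀ t ∈ I, IsUnit (M.g t).det := fun t ht => isUnit_det_of_posDef (h.posDef t ht)
    refine ⟨h.posDef, h.contDiff_g, h.contDiff_ρ, h.contDiff_J, h.spatial, ?_, ?_, ?_, ?_⟩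
    · intro t ht i j
      have := ((einstein_iff γ hI h.posDef h.spatial (x := fun _ => t) ht).1
        (h.einstein_eq _ ht)).2 i j
      rw [hric h.posDef ht] at this
      linear_combination this
    · intro t ht
      have := ((einstein_iff γ hI h.posDef h.spatial (x := fun _ => t) ht).1
        (h.einstein_eq _ ht)).1
      rw [ricci_zero_zero M hI hu ht] at this
      linear_combination -this
    · intro t ht
      have := h.fluid_eq (fun _ => t) ht 0
      rw [divergence_fluid_zero γ hI h.posDef ht] at this
      linear_combination -this
    · intro t ht
      exact (closed_iff hI h.posDef (x := fun _ => t) ht).1 (h.closed _ ht)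
  · intro h
    have hu : ∀ t ∈ I, IsUnit (M.g t).det := fun t ht => isUnit_det_of_posDef (h.posDef t ht)
    refine ⟨h.posDef, h.contDiff_g, h.contDiff_ρ, h.contDiff_J, h.spatial, ?_, ?_, ?_, ?_⟩
    · intro x hx
      refine (einstein_iff γ hI h.posDef h.spatial hx).2 ⟨?_, fun i j => ?_⟩
      · rw [ricci_zero_zero M hI hu hx]
        linear_combination -h.raychaudhuri _ hx
      · rw [hric h.posDef hx]
        linear_combination h.expansion_eq _ hx i j
    · intro x hx ν
      induction ν using Fin.cases
      · rw [divergence_fluid_zero γ hI h.posDef hx]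
        linear_combination -h.fluid _ hx
      · exact divergence_fluid_succ γ (hu _ hx) _
    · intro x hx
      exact (closed_iff hI h.posDef hx).2 (h.field _ hx)
    · intro x hx
      exact coclosed_of_spatial hI h.posDef h.spatial hx

end Components

/-! ### Entrywise derivatives of matrix-valued functions -/

/-- Entrywise derivative of a matrix-valued function of time. -/
def HasEntryDeriv (A : ℝ → Matrix (Fin 3) (Fin 3) ℝ) (A' : Matrix (Fin 3) (Fin 3) ℝ) (t : ℝ) :
    Prop :=
  ∀ i j, HasDerivAt (fun s => A s i j) (A' i j) t

namespace HasEntryDeriv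

variable {A B : ℝ → Matrix (Fin 3) (Fin 3) ℝ} {A' B' : Matrix (Fin 3) (Fin 3) ℝ} {t : ℝ}

lemma congr_deriv (hA : HasEntryDeriv A A' t) (h : A' = B') : HasEntryDeriv A B' t := h ▸ hA

lemma mul (hA : HasEntryDeriv A A' t) (hB : HasEntryDeriv B B' t) :
    HasEntryDeriv (fun s => A s * B s) (A' * B t + A t * B') t := by
  intro i j
  simp only [Matrix.mul_apply, Matrix.add_apply, ← Finset.sum_add_distrib]
  exact HasDerivAt.fun_sum fun k _ => (hA i k).mul (hB k j)

lemma transpose (hA : HasEntryDeriv A A' t) : HasEntryDeriv (fun s => (A s)ᵀ) A'ᵀ t :=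
  fun i j => hA j i

lemma trace (hA : HasEntryDeriv A A' t) : HasDerivAt (fun s => (A s).trace) A'.trace t := by
  simp only [Matrix.trace, Matrix.diag_apply]
  exact HasDerivAt.fun_sum fun i _ => hA i i

lemma differentiableAt_det (hA : HasEntryDeriv A A' t) :
    DifferentiableAt ℝ (fun s => (A s).det) t := by
  simp only [Matrix.det_fin_three]
  have h : ∀ i j, DifferentiableAt ℝ (fun s => A s i j) t := fun i j => (hA i j).differentiableAt
  fun_prop (disch := exact h _ _)

lemma differentiableAt_adjugate (hA : HasEntryDeriv A A' t) (i j : Fin 3) :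
    DifferentiableAt ℝ (fun s => (A s).adjugate i j) t := by
  simp only [Matrix.adjugate_apply]
  refine HasEntryDeriv.differentiableAt_det (A := fun s => (A s).updateRow j (Pi.single i 1))
    (A' := A'.updateRow j 0) fun k l => ?_
  simp only [Matrix.updateRow_apply]
  split_ifs
  · exact hasDerivAt_const _ _
  · exact hA k l

lemma inv (hA : HasEntryDeriv A A' t) (h : ∀ᶠ s in 𝓝 t, IsUnit (A s).det) :
    HasEntryDeriv (fun s => (A s)⁻¹) (-((A t)⁻¹ * A' * (A t)⁻¹)) t := by
  have hu := h.self_of_nhds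
  have hd : ∀ i j, DifferentiableAt ℝ (fun s => (A s)⁻¹ i j) t := by
    intro i j
    simp only [Matrix.inv_def, Ring.inverse_eq_inv', Matrix.smul_apply, smul_eq_mul]
    exact (hA.differentiableAt_det.inv hu.ne_zero).mul (hA.differentiableAt_adjugate i j)
  set P' : Matrix (Fin 3) (Fin 3) ℝ := Matrix.of fun i j => deriv (fun s => (A s)⁻¹ i j) t
  have hP : HasEntryDeriv (fun s => (A s)⁻¹) P' t := fun i j => (hd i j).hasDerivAt
  have h0 : P' * A t + (A t)⁻¹ * A' = 0 := by
    ext i j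
    refine (hP.mul hA i j).unique ?_
    refine (hasDerivAt_const t ((1 : Matrix (Fin 3) (Fin 3) ℝ) i j)).congr_of_eventuallyEq ?_
    filter_upwards [h] with s hs
    rw [Matrix.nonsing_inv_mul _ hs]
  have h1 : P' = -((A t)⁻¹ * A' * (A t)⁻¹) := by
    rw [← Matrix.mul_nonsing_inv_cancel_right (A t) P' hu, eq_neg_of_add_eq_zero_left h0,
      Matrix.neg_mul]
  exact h1 ▸ hP

end HasEntryDeriv

/-! ### Evolution of the mixed expansion tensor -/

namespace IsEvolution

variable {γ : ℝ} {M : Model} {I : Set ℝ} (h : IsEvolution γ M I) (hI : IsOpen I)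
  {t : ℝ} (ht : t ∈ I)
include h hI ht

lemma hasEntryDeriv_g : HasEntryDeriv M.g ((2 : ℝ) • M.expansion t) t := by
  intro i j
  refine (((h.contDiff_g i j).differentiableOn (by norm_num)).differentiableAt
    (hI.mem_nhds ht)).hasDerivAt.congr_deriv ?_
  simp [Model.expansion]

lemma hasEntryDeriv_expansion : HasEntryDeriv M.expansion
    ((2 : ℝ) • (M.expansion t * M.mixed t) - (M.mixed t).trace • M.expansion t
      + Matrix.vecMulVec (M.spatialField t) (M.spatialField t)
      + ((2 - γ) / 2 * M.ρ t) • M.g t) t := by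
  intro i j
  have hd : DifferentiableAt ℝ (deriv fun s => M.g s i j) t :=
    (((h.contDiff_g i j).deriv_of_isOpen hI (m := 1) (by norm_num)).differentiableOn
      (by norm_num)).differentiableAt (hI.mem_nhds ht)
  have hd' : DifferentiableAt ℝ (fun s => M.expansion s i j) t := by
    simpa only [Model.expansion, Matrix.of_apply] using hd.const_mul (1 / 2)
  refine hd'.hasDerivAt.congr_deriv ?_
  rw [h.expansion_eq t ht i j]
  simp [Matrix.vecMulVec_apply]

lemma isUnit_det_eventually : ∀ᶠ s in 𝓝 t, IsUnit (M.g s).det := by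
  filter_upwards [hI.mem_nhds ht] with s hs using isUnit_det_of_posDef (h.posDef s hs)

lemma hasEntryDeriv_inv :
    HasEntryDeriv (fun s => (M.g s)⁻¹) (-(2 : ℝ) • (M.mixed t * (M.g t)⁻¹)) t := by
  refine ((h.hasEntryDeriv_g hI ht).inv (h.isUnit_det_eventually hI ht)).congr_deriv ?_
  simp [Model.mixed]

lemma hasEntryDeriv_mixed : HasEntryDeriv M.mixed
    (-(M.mixed t).trace • M.mixed t
      + Matrix.vecMulVec ((M.g t)⁻¹ *ᵥ M.spatialField t) (M.spatialField t)
      + ((2 - γ) / 2 * M.ρ t) • (1 : Matrix (Fin 3) (Fin 3) ℝ)) t := by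
  have hu := isUnit_det_of_posDef (h.posDef t ht)
  refine ((h.hasEntryDeriv_inv hI ht).mul (h.hasEntryDeriv_expansion hI ht)).congr_deriv ?_
  have e : M.mixed t * (M.g t)⁻¹ * M.expansion t = (M.g t)⁻¹ * (M.expansion t * M.mixed t) := by
    simp only [Model.mixed, Matrix.mul_assoc]
  have e2 : (M.g t)⁻¹ * M.expansion t = M.mixed t := rfl
  simp only [Matrix.mul_add, Matrix.mul_sub, Matrix.mul_smul, Matrix.smul_mul, e, e2,
    Matrix.mul_vecMulVec, Matrix.nonsing_inv_mul _ hu]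
  module

lemma hasDerivAt_trace : HasDerivAt (fun s => (M.mixed s).trace)
    (-(M.mixed t).trace ^ 2 + M.fieldSq t + 3 / 2 * (2 - γ) * M.ρ t) t := by
  refine (h.hasEntryDeriv_mixed hI ht).trace.congr_deriv ?_
  simp only [Matrix.trace_add, Matrix.trace_smul, Matrix.trace_vecMulVec, Matrix.trace_one,
    Model.fieldSq, Fintype.card_fin, smul_eq_mul, dotProduct_comm (M.spatialField t)]
  push_cast
  ring

lemma constraint : (M.mixed t).trace ^ 2 - (M.mixed t * M.mixed t).trace
    = 2 * M.ρ t + M.fieldSq t := by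
  have h1 := (h.hasDerivAt_trace hI ht).deriv
  have h2 : deriv (fun s => (M.mixed s).trace) t = ∑ i, deriv (fun s => M.mixed s i i) t := by
    simp only [Matrix.trace, Matrix.diag_apply]
    exact deriv_fun_sum fun i _ => (h.hasEntryDeriv_mixed hI ht i i).differentiableAt
  rw [h2, h.raychaudhuri t ht] at h1
  linear_combination h1

lemma hasDerivAt_ρ : HasDerivAt M.ρ (-γ * (M.mixed t).trace * M.ρ t) t := by
  rw [← h.fluid t ht]
  exact ((h.contDiff_ρ.differentiableOn (by norm_num)).differentiableAt
    (hI.mem_nhds ht)).hasDerivAt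

lemma hasDerivAt_spatialField (i : Fin 3) : HasDerivAt (fun s => M.spatialField s i) 0 t := by
  rw [← h.field t ht i]
  exact (((h.contDiff_J i.succ).differentiableOn (by norm_num)).differentiableAt
    (hI.mem_nhds ht)).hasDerivAt

end IsEvolution

/-! ### Moments of the expansion tensor along the field strength -/

/-- The quadratic form `J_i A^{ij} J_j`. -/
def Model.form (M : Model) (t : ℝ) (A : Matrix (Fin 3) (Fin 3) ℝ) : ℝ :=
  M.spatialField t ⬝ᵥ (A *ᵥ M.spatialField t)

/-- The moment `J_i (K^n)^i_k g^{kj} J_j` of the mixed expansion tensor `K`. -/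
def Model.moment (M : Model) (n : ℕ) (t : ℝ) : ℝ := M.form t (M.mixed t ^ n * (M.g t)⁻¹)

lemma Model.moment_zero (M : Model) (t : ℝ) : M.moment 0 t = M.fieldSq t := by
  simp [Model.moment, Model.form, Model.fieldSq]

lemma Model.form_add (M : Model) (t : ℝ) (A B : Matrix (Fin 3) (Fin 3) ℝ) :
    M.form t (A + B) = M.form t A + M.form t B := by
  simp [Model.form, Matrix.add_mulVec]

lemma Model.form_smul (M : Model) (t : ℝ) (c : ℝ) (A : Matrix (Fin 3) (Fin 3) ℝ) :
    M.form t (c • A) = c * M.form t A := by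
  simp [Model.form, Matrix.smul_mulVec]

lemma Model.form_mul_vecMulVec_mul (M : Model) (t : ℝ) (A B C : Matrix (Fin 3) (Fin 3) ℝ) :
    M.form t (A * (Matrix.vecMulVec (B *ᵥ M.spatialField t) (M.spatialField t) * C))
      = M.form t (A * B) * M.form t C := by
  rw [Matrix.vecMulVec_mul, Matrix.mul_vecMulVec, Model.form, Model.form, Model.form,
    Matrix.vecMulVec_mulVec, Matrix.mulVec_mulVec, dotProduct_smul, ← Matrix.dotProduct_mulVec]
  simp [mul_comm]

namespace IsEvolution

variable {γ : ℝ} {M : Model} {I : Set ℝ} (h : IsEvolution γ M I) (hI : IsOpen I)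
  {t : ℝ} (ht : t ∈ I)
include h hI ht

lemma hasDerivAt_form {A : ℝ → Matrix (Fin 3) (Fin 3) ℝ} {A' : Matrix (Fin 3) (Fin 3) ℝ}
    (hA : HasEntryDeriv A A' t) : HasDerivAt (fun s => M.form s (A s)) (M.form t A') t := by
  simp only [Model.form, dotProduct, Matrix.mulVec]
  refine HasDerivAt.congr_deriv (HasDerivAt.fun_sum fun i _ =>
    (h.hasDerivAt_spatialField hI ht i).mul (HasDerivAt.fun_sum fun j _ =>
      (hA i j).mul (h.hasDerivAt_spatialField hI ht j))) ?_
  simp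

/-- Derivative of `K^n g⁻¹` from that of `K^(n-1) g⁻¹`. -/
lemma hasEntryDeriv_pow_succ {n : ℕ} {Q : Matrix (Fin 3) (Fin 3) ℝ}
    (hQ : HasEntryDeriv (fun s => M.mixed s ^ n * (M.g s)⁻¹) Q t) :
    HasEntryDeriv (fun s => M.mixed s ^ (n + 1) * (M.g s)⁻¹)
      (-(M.mixed t).trace • (M.mixed t ^ (n + 1) * (M.g t)⁻¹)
        + Matrix.vecMulVec ((M.g t)⁻¹ *ᵥ M.spatialField t) (M.spatialField t)
          * (M.mixed t ^ n * (M.g t)⁻¹)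
        + ((2 - γ) / 2 * M.ρ t) • (M.mixed t ^ n * (M.g t)⁻¹) + M.mixed t * Q) t := by
  simp only [pow_succ', Matrix.mul_assoc]
  refine ((h.hasEntryDeriv_mixed hI ht).mul hQ).congr_deriv ?_
  simp only [Matrix.add_mul, Matrix.smul_mul, Matrix.one_mul]

lemma hasEntryDeriv_pow_zero :
    HasEntryDeriv (fun s => M.mixed s ^ 0 * (M.g s)⁻¹) (-(2 : ℝ) • (M.mixed t * (M.g t)⁻¹)) t := by
  simpa only [pow_zero, Matrix.one_mul] using h.hasEntryDeriv_inv hI ht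

lemma hasDerivAt_moment_zero : HasDerivAt (M.moment 0) (-2 * M.moment 1 t) t := by
  refine (h.hasDerivAt_form hI ht (h.hasEntryDeriv_pow_zero hI ht)).congr_deriv ?_
  simp only [Model.form_smul, Model.moment, pow_one]

lemma hasDerivAt_moment_one : HasDerivAt (M.moment 1)
    (-(M.mixed t).trace * M.moment 1 t + M.moment 0 t ^ 2
      + (2 - γ) / 2 * M.ρ t * M.moment 0 t - 2 * M.moment 2 t) t := by
  refine (h.hasDerivAt_form hI ht
    (h.hasEntryDeriv_pow_succ hI ht (h.hasEntryDeriv_pow_zero hI ht))).congr_deriv ?_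
  have e := M.form_mul_vecMulVec_mul t 1 (M.g t)⁻¹
  simp only [Matrix.one_mul] at e
  simp only [Model.form_add, Model.form_smul, Model.moment, pow_zero, Matrix.one_mul, e,
    Matrix.mul_smul, zero_add, pow_one, pow_two, Matrix.mul_assoc]
  ring

lemma hasDerivAt_moment_two : HasDerivAt (M.moment 2)
    (-2 * (M.mixed t).trace * M.moment 2 t + 2 * M.moment 0 t * M.moment 1 t
      + (2 - γ) * M.ρ t * M.moment 1 t - 2 * M.moment 3 t) t := by
  refine (h.hasDerivAt_form hI ht (h.hasEntryDeriv_pow_succ hI ht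
    (h.hasEntryDeriv_pow_succ hI ht (h.hasEntryDeriv_pow_zero hI ht)))).congr_deriv ?_
  have e := M.form_mul_vecMulVec_mul t 1 (M.g t)⁻¹
  have e' := M.form_mul_vecMulVec_mul t (M.mixed t) (M.g t)⁻¹
  simp only [Matrix.one_mul] at e
  simp only [Model.form_add, Model.form_smul, Model.moment, pow_zero, Matrix.one_mul, e, e',
    Matrix.mul_smul, pow_succ, Matrix.mul_assoc, Matrix.mul_add]
  ring

lemma hasDerivAt_moment_three : HasDerivAt (M.moment 3)
    (-3 * (M.mixed t).trace * M.moment 3 t + 2 * M.moment 0 t * M.moment 2 t + M.moment 1 t ^ 2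
      + 3 / 2 * (2 - γ) * M.ρ t * M.moment 2 t - 2 * M.moment 4 t) t := by
  refine (h.hasDerivAt_form hI ht (h.hasEntryDeriv_pow_succ hI ht (h.hasEntryDeriv_pow_succ hI ht
    (h.hasEntryDeriv_pow_succ hI ht (h.hasEntryDeriv_pow_zero hI ht))))).congr_deriv ?_
  have e := M.form_mul_vecMulVec_mul t 1 (M.g t)⁻¹
  have e' := M.form_mul_vecMulVec_mul t (M.mixed t) (M.g t)⁻¹
  have e'' := M.form_mul_vecMulVec_mul t (M.mixed t * M.mixed t) (M.g t)⁻¹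
  simp only [Matrix.one_mul, Matrix.mul_assoc] at e e''
  simp only [Model.form_add, Model.form_smul, Model.moment, pow_zero, Matrix.one_mul, e, e', e'',
    Matrix.mul_smul, pow_succ, Matrix.mul_assoc, Matrix.mul_add]
  ring

end IsEvolution

/-! ### Aligned frames -/

lemma exists_orthogonal_vecMul_eq_single {f : Fin 3 → ℝ} (hf : f ≠ 0) :
    ∃ Q : Matrix (Fin 3) (Fin 3) ℝ, Qᵀ * Q = 1 ∧ ∃ r > 0, f ᵥ* Q = Pi.single 0 r := by
  set F : EuclideanSpace ℝ (Fin 3) := WithLp.toLp 2 f with hF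
  have hF0 : F ≠ 0 := by simpa [hF] using hf
  have hn : 0 < ‖F‖ := norm_pos_iff.2 hF0
  obtain ⟨b, hb⟩ := Orthonormal.exists_orthonormalBasis_extension_of_card_eq (𝕜 := ℝ)
    (E := EuclideanSpace ℝ (Fin 3)) (ι := Fin 3) (by simp) (v := fun _ => ‖F‖⁻¹ • F) (s := {0}) (by
      constructor
      · intro i
        simp [norm_smul, hn.ne']
      · intro i j hij
        exact absurd (Subsingleton.elim i j) hij)
  have hb0 : F = ‖F‖ • b 0 := by
    rw [hb 0 rfl, smul_smul, mul_inv_cancel₀ hn.ne', one_smul]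
  have hip : ∀ x y : EuclideanSpace ℝ (Fin 3), inner ℝ x y = ∑ i, x i * y i := fun x y => by
    simp [PiLp.inner_apply, mul_comm]
  refine ⟨Matrix.of fun i j => b j i, ?_, ‖F‖, hn, ?_⟩
  · ext i j
    rw [Matrix.mul_apply, Matrix.one_apply, ← orthonormal_iff_ite.1 b.orthonormal i j, hip]
    rfl
  · ext j
    have h1 : (f ᵥ* (Matrix.of fun i j => b j i)) j = inner ℝ F (b j) := by
      rw [hip]; rfl
    rw [h1, hb0, inner_smul_left, orthonormal_iff_ite.1 b.orthonormal 0 j, ← hb0]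
    simp [Pi.single_apply, eq_comm]

open scoped MatrixOrder in
lemma posDef_eq_transpose_mul_self {A : Matrix (Fin 3) (Fin 3) ℝ} (h : A.PosDef) :
    ∃ B, IsUnit B.det ∧ A = Bᵀ * B := by
  obtain ⟨B, hB⟩ := CStarAlgebra.nonneg_iff_eq_star_mul_self.1 h.posSemidef.nonneg
  rw [Matrix.star_eq_conjTranspose, Matrix.conjTranspose_eq_transpose_of_trivial] at hB
  refine ⟨B, ?_, hB⟩
  have := h.det_pos
  rw [hB, Matrix.det_mul] at this
  exact (right_ne_zero_of_mul this.ne').isUnit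

lemma exists_isAlignedFrame {M : Model} {t : ℝ} (h : (M.g t).PosDef)
    (hJ : M.spatialField t ≠ 0) : ∃ E, IsAlignedFrame M t E := by
  obtain ⟨B, hB, hgB⟩ := posDef_eq_transpose_mul_self h
  have hf : M.spatialField t ᵥ* B⁻¹ ≠ 0 := by
    intro h0
    apply hJ
    rw [← Matrix.vecMul_one (M.spatialField t), ← Matrix.nonsing_inv_mul B hB,
      ← Matrix.vecMul_vecMul, h0, Matrix.zero_vecMul]
  obtain ⟨Q, hQ, r, hr, hfQ⟩ := exists_orthogonal_vecMul_eq_single hf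
  have hff : M.frameField t (B⁻¹ * Q) = Pi.single 0 r := by
    rw [← hfQ, Matrix.vecMul_vecMul]; rfl
  refine ⟨B⁻¹ * Q, ?_, ?_, ?_, ?_⟩
  · rw [hgB, Matrix.transpose_mul, Matrix.mul_assoc, Matrix.mul_assoc, Matrix.mul_assoc,
      Matrix.mul_nonsing_inv_cancel_left _ _ hB, Matrix.transpose_nonsing_inv,
      Matrix.nonsing_inv_mul_cancel_left _ _ (by rwa [Matrix.det_transpose]), hQ]
  · simpa [hff] using hr
  · simp [hff]
  · simp [hff]

namespace IsAlignedFrame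

variable {M : Model} {t : ℝ} {E : Matrix (Fin 3) (Fin 3) ℝ} (hE : IsAlignedFrame M t E)
include hE

lemma inv_eq : (M.g t)⁻¹ = E * Eᵀ := by
  apply Matrix.inv_eq_left_inv
  rw [Matrix.mul_assoc]
  exact mul_eq_one_comm.1 hE.orthonormal

lemma frameField_eq : M.frameField t E = Pi.single 0 (M.frameField t E 0) := by
  ext i
  fin_cases i
  · simp
  · simpa using hE.zero₁
  · simpa using hE.zero₂

lemma mixed_pow_mul (n : ℕ) :
    M.mixed t ^ n * E = E * (Eᵀ * M.expansion t * E) ^ n := by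
  induction n with
  | zero => simp
  | succ n ih =>
    rw [pow_succ, Matrix.mul_assoc, pow_succ', ← Matrix.mul_assoc E, Model.mixed, hE.inv_eq]
    rw [show E * Eᵀ * M.expansion t * E = E * (Eᵀ * M.expansion t * E) by
      simp only [Matrix.mul_assoc]]
    rw [← hE.inv_eq, ← Model.mixed, ← Matrix.mul_assoc, ih]
    simp only [Matrix.mul_assoc, ← pow_succ, ← pow_succ']

lemma moment_eq (n : ℕ) :
    M.moment n t = M.frameField t E 0 ^ 2 * ((Eᵀ * M.expansion t * E) ^ n) 0 0 := by
  have h1 : M.moment n t = M.frameField t E ⬝ᵥ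
      ((Eᵀ * M.expansion t * E) ^ n *ᵥ M.frameField t E) := by
    rw [Model.moment, Model.form, hE.inv_eq, ← Matrix.mul_assoc, hE.mixed_pow_mul,
      Matrix.mul_assoc, ← Matrix.mulVec_mulVec, Matrix.dotProduct_mulVec, ← Matrix.mulVec_mulVec,
      Matrix.mulVec_transpose]
    rfl
  rw [h1, hE.frameField_eq]
  simp
  ring

lemma trace_mixed : (M.mixed t).trace = (Eᵀ * M.expansion t * E).trace := by
  rw [Model.mixed, hE.inv_eq, Matrix.mul_assoc, Matrix.trace_mul_comm]

lemma trace_mixed_sq : (M.mixed t * M.mixed t).trace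
    = ((Eᵀ * M.expansion t * E) * (Eᵀ * M.expansion t * E)).trace := by
  rw [Model.mixed, hE.inv_eq, Matrix.mul_assoc E, Matrix.mul_assoc E, Matrix.trace_mul_comm]
  simp only [Matrix.mul_assoc]

end IsAlignedFrame

/-! ### Frame-independent normalized variables -/

/-- `n·(1 + Σ)^k n` with `n` the unit vector along the field strength. -/
def Model.normMoment (M : Model) (k : ℕ) (t : ℝ) : ℝ :=
  (3 / (M.mixed t).trace) ^ k * M.moment k t / M.moment 0 t

/-- The square `V_a V^a` of the normalized field strength. -/
def Model.vSq (M : Model) (t : ℝ) : ℝ := 3 / 2 * M.moment 0 t / (M.mixed t).trace ^ 2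

/-- The normalized density. -/
def Model.omega (M : Model) (t : ℝ) : ℝ := 3 * M.ρ t / (M.mixed t).trace ^ 2

/-- `Σ_11`. -/
def Model.shear (M : Model) (t : ℝ) : ℝ := M.normMoment 1 t - 1

/-- `Σ_12² + Σ_13²`. -/
def Model.tilt (M : Model) (t : ℝ) : ℝ := M.normMoment 2 t - M.normMoment 1 t ^ 2

/-- `(Σ_AB - (1/2) δ_AB Σ_CC) Σ_1A Σ_1B`, indices `A, B` running over `2, 3`. -/
def Model.coupling (M : Model) (t : ℝ) : ℝ :=
  M.normMoment 3 t - 3 * M.normMoment 2 t + 3 * M.normMoment 1 t - 1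
    - M.shear t ^ 3 - 3 / 2 * M.shear t * M.tilt t

/-- The square of the trace-free part of `Σ_AB`, `A, B = 2, 3`, as given by the constraint. -/
def transverse (s w V W : ℝ) : ℝ := 6 * (1 - V - W) - 3 / 2 * s ^ 2 - 2 * w

lemma Model.hubble_eq (M : Model) (t : ℝ) : M.hubble t = (M.mixed t).trace / 3 := by
  rw [Model.hubble, Model.mixed]; ring

lemma one_add_pow_entries {A : Matrix (Fin 3) (Fin 3) ℝ} (hA : Aᵀ = A) :
    ((1 + A) ^ 1 : Matrix (Fin 3) (Fin 3) ℝ) 0 0 = 1 + A 0 0 ∧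
    ((1 + A) ^ 2 : Matrix (Fin 3) (Fin 3) ℝ) 0 0 = (1 + A 0 0) ^ 2 + A 0 1 ^ 2 + A 0 2 ^ 2 ∧
    ((1 + A) ^ 3 : Matrix (Fin 3) (Fin 3) ℝ) 0 0 = (1 + A 0 0) ^ 3 + 2 * (1 + A 0 0) * (A 0 1 ^ 2 + A 0 2 ^ 2)
      + (1 + A 1 1) * A 0 1 ^ 2 + (1 + A 2 2) * A 0 2 ^ 2 + 2 * A 1 2 * A 0 1 * A 0 2 ∧
    ((1 + A) ^ 4 : Matrix (Fin 3) (Fin 3) ℝ) 0 0 = ((1 + A 0 0) ^ 2 + A 0 1 ^ 2 + A 0 2 ^ 2) ^ 2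
      + ((1 + A 0 0) * A 0 1 + A 0 1 * (1 + A 1 1) + A 0 2 * A 1 2) ^ 2
      + ((1 + A 0 0) * A 0 2 + A 0 1 * A 1 2 + A 0 2 * (1 + A 2 2)) ^ 2 := by
  have h10 : A 1 0 = A 0 1 := congrFun (congrFun hA 0) 1
  have h20 : A 2 0 = A 0 2 := congrFun (congrFun hA 0) 2
  have h21 : A 2 1 = A 1 2 := congrFun (congrFun hA 1) 2
  refine ⟨by simp, ?_, ?_, ?_⟩
  · rw [pow_two]
    simp [Matrix.mul_apply, Fin.sum_univ_three, h10, h20]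
    ring
  · rw [pow_succ, pow_two]
    simp [Matrix.mul_apply, Fin.sum_univ_three, h10, h20, h21]
    ring
  · rw [show 4 = 2 * 2 by rfl, pow_mul, pow_two, pow_two]
    simp [Matrix.mul_apply, Fin.sum_univ_three, h10, h20, h21]
    ring

lemma trace_mul_self_of_symm {A : Matrix (Fin 3) (Fin 3) ℝ} (hA : Aᵀ = A) :
    (A * A).trace = A 0 0 ^ 2 + A 1 1 ^ 2 + A 2 2 ^ 2
      + 2 * (A 0 1 ^ 2 + A 0 2 ^ 2 + A 1 2 ^ 2) := by
  have h10 : A 1 0 = A 0 1 := congrFun (congrFun hA 0) 1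
  have h20 : A 2 0 = A 0 2 := congrFun (congrFun hA 0) 2
  have h21 : A 2 1 = A 1 2 := congrFun (congrFun hA 1) 2
  simp only [Matrix.trace_fin_three, Matrix.mul_apply, Fin.sum_univ_three, h10, h20, h21]
  ring

/-- The values of the normalized variables read off from the state in an aligned frame. -/
structure IsReadOff (S : State) (s w z V W : ℝ) : Prop where
  shear : S.1 0 0 = s
  tilt : S.1 0 1 ^ 2 + S.1 0 2 ^ 2 = w
  coupling : (S.1 1 1 - S.1 2 2) / 2 * (S.1 0 1 ^ 2 - S.1 0 2 ^ 2)
    + 2 * S.1 1 2 * S.1 0 1 * S.1 0 2 = z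
  transverse : (S.1 1 1 - S.1 2 2) ^ 2 / 2 + 2 * S.1 1 2 ^ 2 = transverse s w V W
  vSq : S.2.1 0 ^ 2 = V
  omega : S.2.2 = W

section ReadOff

variable {γ : ℝ} {M : Model} {I : Set ℝ} (h : IsEvolution γ M I) (hI : IsOpen I)
  {t : ℝ} (ht : t ∈ I) (hT : 0 < M.hubble t) {E : Matrix (Fin 3) (Fin 3) ℝ}
  (hE : IsAlignedFrame M t E)
include h hI ht hT hE

omit h hI ht hE in
lemma frame_expansion_eq :
    Eᵀ * M.expansion t * E = M.hubble t • (1 + (M.state t E).1) := by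
  simp [Model.state, hT.ne']

omit h hI ht in
lemma normMoment_eq (n : ℕ) : M.normMoment n t = ((1 + (M.state t E).1) ^ n) 0 0 := by
  have hv := hE.pos
  have hT' : (M.mixed t).trace = 3 * M.hubble t := by rw [Model.hubble_eq]; ring
  rw [Model.normMoment, hE.moment_eq, hE.moment_eq, frame_expansion_eq hT, hT']
  simp only [smul_pow, Matrix.smul_apply, smul_eq_mul, pow_zero, Matrix.one_apply_eq, div_pow,
    mul_pow]
  field_simp

omit hT hE in
lemma state_symm : (M.state t E).1ᵀ = (M.state t E).1 := by
  simp [Model.state, Matrix.transpose_mul, expansion_symm hI h.posDef ht, Matrix.mul_assoc]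

omit h hI ht in
lemma state_trace : (M.state t E).1.trace = 0 := by
  have h1 := congrArg Matrix.trace (frame_expansion_eq (E := E) hT)
  rw [← hE.trace_mixed, Matrix.trace_smul, Matrix.trace_add, Matrix.trace_one,
    show (M.mixed t).trace = 3 * M.hubble t by rw [Model.hubble_eq]; ring] at h1
  simp only [Fintype.card_fin, Nat.cast_ofNat, smul_eq_mul] at h1
  exact (mul_eq_zero.1 (show M.hubble t * (M.state t E).1.trace = 0 by
    linear_combination -h1)).resolve_left hT.ne'

omit h hI ht in
lemma state_vSq : (M.state t E).2.1 0 ^ 2 = M.vSq t := by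
  have hT' : (M.mixed t).trace = 3 * M.hubble t := by rw [Model.hubble_eq]; ring
  rw [Model.vSq, hE.moment_eq, hT']
  simp only [Model.state, Pi.smul_apply, smul_eq_mul, pow_zero, Matrix.one_apply_eq, mul_pow,
    inv_pow, Real.sq_sqrt (show (0 : ℝ) ≤ 6 by norm_num)]
  field_simp
  ring

omit h hI ht hE in
lemma state_omega : (M.state t E).2.2 = M.omega t := by
  have hT' : (M.mixed t).trace = 3 * M.hubble t := by rw [Model.hubble_eq]; ring
  rw [Model.omega, hT']
  simp only [Model.state]
  field_simp

lemma state_constraint : ((M.state t E).1 * (M.state t E).1).trace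
    = 6 * (1 - M.vSq t - M.omega t) := by
  have hT' : (M.mixed t).trace = 3 * M.hubble t := by rw [Model.hubble_eq]; ring
  have hc := h.constraint hI ht
  rw [hE.trace_mixed_sq, frame_expansion_eq hT, hT', ← M.moment_zero] at hc
  simp only [Matrix.smul_mul, Matrix.mul_smul, Matrix.trace_smul, Matrix.add_mul, Matrix.mul_add,
    Matrix.trace_add, Matrix.one_mul, Matrix.mul_one, state_trace hT hE, smul_eq_mul,
    Matrix.trace_one, Fintype.card_fin, Nat.cast_ofNat] at hc
  rw [Model.vSq, Model.omega, hT']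
  field_simp
  linear_combination -6 * hc

lemma isReadOff_state : IsReadOff (M.state t E) (M.shear t) (M.tilt t) (M.coupling t)
    (M.vSq t) (M.omega t) := by
  have hm := normMoment_eq hT hE
  obtain ⟨m1, m2, m3, -⟩ := one_add_pow_entries (state_symm h hI ht)
  rw [← hm] at m1 m2 m3
  have htr := state_trace hT hE
  have hc := state_constraint h hI ht hT hE
  rw [trace_mul_self_of_symm (state_symm h hI ht)] at hc
  rw [Matrix.trace_fin_three] at htr
  have e1 : M.shear t = (M.state t E).1 0 0 := by rw [Model.shear, m1]; ring
  have e2 : M.tilt t = (M.state t E).1 0 1 ^ 2 + (M.state t E).1 0 2 ^ 2 := by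
    rw [Model.tilt, m1, m2]; ring
  refine ⟨e1.symm, e2.symm, ?_, ?_, state_vSq hT hE, state_omega hT⟩
  · rw [Model.coupling, e1, e2, m1, m2, m3]
    linear_combination (-((M.state t E).1 0 1 ^ 2 + (M.state t E).1 0 2 ^ 2) / 2) * htr
  · rw [BianchiI.transverse, e1, e2, ← hc]
    linear_combination ((M.state t E).1 0 0 - (M.state t E).1 1 1 - (M.state t E).1 2 2) / 2 * htr

lemma normMoment_four : M.normMoment 4 t - 4 * M.normMoment 3 t + 6 * M.normMoment 2 t
      - 4 * M.normMoment 1 t + 1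
    = (M.shear t ^ 2 + M.tilt t) ^ 2 + M.shear t ^ 2 * M.tilt t / 4 + M.shear t * M.coupling t
      + transverse (M.shear t) (M.tilt t) (M.vSq t) (M.omega t) * M.tilt t / 2 := by
  have hm := normMoment_eq hT hE
  obtain ⟨m1, m2, m3, m4⟩ := one_add_pow_entries (state_symm h hI ht)
  have hr := isReadOff_state h hI ht hT hE
  have htr := state_trace hT hE
  rw [Matrix.trace_fin_three] at htr
  have h22 : (M.state t E).1 2 2 = -(M.state t E).1 0 0 - (M.state t E).1 1 1 := by
    linear_combination htr
  rw [hm, hm, hm, hm, m1, m2, m3, m4, ← hr.transverse, ← hr.coupling, ← hr.shear, ← hr.tilt, h22]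
  ring

lemma state_mem_stateSpace (hρ : 0 < M.ρ t) : M.state t E ∈ stateSpace := by
  have hp := hE.pos
  refine ⟨state_symm h hI ht, state_trace hT hE, ?_, ?_, ?_, ?_, ?_⟩
  · simp only [Model.state, Pi.smul_apply, smul_eq_mul]
    positivity
  · simp [Model.state, hE.zero₁]
  · simp [Model.state, hE.zero₂]
  · simp only [Model.state]
    positivity
  · have h1 : (M.state t E).2.1 1 = 0 := by simp [Model.state, hE.zero₁]
    have h2 : (M.state t E).2.1 2 = 0 := by simp [Model.state, hE.zero₂]
    rw [state_constraint h hI ht hT hE, Fin.sum_univ_three, h1, h2, state_vSq hT hE,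
      state_omega hT]
    ring

end ReadOff

/-! ### The reduced dynamical system -/

/-- The deceleration parameter as a function of the normalized variables; `σ = (3γ - 2)/2`. -/
def decel (σ V W : ℝ) : ℝ := 2 - 2 * V - (2 - σ) * W

/-- The closed system obeyed by `Σ_11`, `Σ_1A Σ_1A`, `Σ_1A Σ_AB Σ_1B`, `V²`, `Ω` and `H` on a set of
times, with `σ = (3γ - 2)/2`. -/
structure IsReducedFlow (σ : ℝ) (I : Set ℝ) (H s w z V W : ℝ → ℝ) : Prop where
  H_pos : ∀ t ∈ I, 0 < H t
  V_pos : ∀ t ∈ I, 0 < V t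
  W_pos : ∀ t ∈ I, 0 < W t
  w_nonneg : ∀ t ∈ I, 0 ≤ w t
  y_nonneg : ∀ t ∈ I, 0 ≤ transverse (s t) (w t) (V t) (W t)
  z_sq_le : ∀ t ∈ I, z t ^ 2 ≤ transverse (s t) (w t) (V t) (W t) * w t ^ 2 / 2
  H_deriv : ∀ t ∈ I, HasDerivAt H (-(1 + decel σ (V t) (W t)) * H t ^ 2) t
  s_deriv : ∀ t ∈ I, HasDerivAt s
    (H t * ((decel σ (V t) (W t) - 2) * s t + 4 * V t - 2 * w t)) t
  w_deriv : ∀ t ∈ I, HasDerivAt w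
    (H t * (2 * (decel σ (V t) (W t) - 2 + 3 / 2 * s t) * w t - 2 * z t)) t
  z_deriv : ∀ t ∈ I, HasDerivAt z
    (H t * (3 * (decel σ (V t) (W t) - 2 + s t) * z t + w t ^ 2
      - transverse (s t) (w t) (V t) (W t) * w t)) t
  V_deriv : ∀ t ∈ I, HasDerivAt V (H t * (2 * (decel σ (V t) (W t) - s t) * V t)) t
  W_deriv : ∀ t ∈ I, HasDerivAt W (H t * (2 * (decel σ (V t) (W t) - σ) * W t)) t

namespace IsEvolution

variable {γ : ℝ} {M : Model} {I : Set ℝ} (h : IsEvolution γ M I) (hI : IsOpen I)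
  {t : ℝ} (ht : t ∈ I) (hT : 0 < M.hubble t)
include h hI ht hT

lemma hasDerivAt_hubble : HasDerivAt M.hubble
    (-(1 + decel ((3 * γ - 2) / 2) (M.vSq t) (M.omega t)) * M.hubble t ^ 2) t := by
  have hT' : (M.mixed t).trace ≠ 0 := by
    rw [Model.hubble_eq] at hT; intro h0; simp [h0] at hT
  have := (h.hasDerivAt_trace hI ht).div_const 3
  simp only [← Model.hubble_eq] at this
  refine this.congr_deriv ?_
  rw [decel, Model.vSq, Model.omega, Model.hubble_eq, Model.moment_zero]
  field_simp
  ring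

lemma hasDerivAt_omega : HasDerivAt M.omega (M.hubble t *
    (2 * (decel ((3 * γ - 2) / 2) (M.vSq t) (M.omega t) - (3 * γ - 2) / 2) * M.omega t)) t := by
  have hT' : (M.mixed t).trace ≠ 0 := by
    rw [Model.hubble_eq] at hT; intro h0; simp [h0] at hT
  refine (((h.hasDerivAt_ρ hI ht).const_mul 3).div ((h.hasDerivAt_trace hI ht).pow 2)
    (pow_ne_zero 2 hT')).congr_deriv ?_
  rw [decel, Model.vSq, Model.omega, Model.hubble_eq, Model.moment_zero, Pi.pow_apply]
  field_simp
  ring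

variable (hk : 0 < M.moment 0 t)
include hk

lemma hasDerivAt_vSq : HasDerivAt M.vSq (M.hubble t *
    (2 * (decel ((3 * γ - 2) / 2) (M.vSq t) (M.omega t) - M.shear t) * M.vSq t)) t := by
  have hT' : (M.mixed t).trace ≠ 0 := by
    rw [Model.hubble_eq] at hT; intro h0; simp [h0] at hT
  refine (((h.hasDerivAt_moment_zero hI ht).const_mul (3 / 2)).div
    ((h.hasDerivAt_trace hI ht).pow 2) (pow_ne_zero 2 hT')).congr_deriv ?_
  rw [decel, Model.shear, Model.normMoment, Model.vSq, Model.omega, Model.hubble_eq,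
    ← Model.moment_zero, Pi.pow_apply]
  field_simp
  ring

/-- Derivative of a normalized moment in terms of that of the moment. -/
lemma hasDerivAt_normMoment {n : ℕ} {k' : ℝ} (hn : HasDerivAt (M.moment n) k' t) :
    HasDerivAt (M.normMoment n) (M.hubble t *
      ((n * (1 + decel ((3 * γ - 2) / 2) (M.vSq t) (M.omega t)) + 2 * M.normMoment 1 t)
        * M.normMoment n t + (3 / (M.mixed t).trace) ^ (n + 1) * k' / M.moment 0 t)) t := by
  have hT' : (M.mixed t).trace ≠ 0 := by
    rw [Model.hubble_eq] at hT; intro h0; simp [h0] at hT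
  have h3 := ((hasDerivAt_const t (3 : ℝ)).div (h.hasDerivAt_trace hI ht) hT').pow n
  refine ((h3.mul hn).div (h.hasDerivAt_moment_zero hI ht) hk.ne').congr_deriv ?_
  rw [decel, Model.normMoment, Model.normMoment, Model.vSq, Model.omega, Model.hubble_eq,
    ← Model.moment_zero]
  rcases n with _ | n
  · simp only [pow_zero, zero_add, pow_one, Nat.cast_zero, Pi.one_apply, Pi.mul_apply]
    field_simp
    ring
  · simp only [Nat.add_sub_cancel, Nat.cast_add, Nat.cast_one, Pi.pow_apply, Pi.div_apply,
      Pi.mul_apply, pow_succ]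
    field_simp
    ring

lemma hasDerivAt_normMoment_one : HasDerivAt (M.normMoment 1) (M.hubble t *
    ((decel ((3 * γ - 2) / 2) (M.vSq t) (M.omega t) - 2) * M.normMoment 1 t + 6 * M.vSq t
      + (2 - (3 * γ - 2) / 2) * M.omega t - 2 * M.normMoment 2 t
      + 2 * M.normMoment 1 t ^ 2)) t := by
  have hT' : (M.mixed t).trace ≠ 0 := by
    rw [Model.hubble_eq] at hT; intro h0; simp [h0] at hT
  refine (h.hasDerivAt_normMoment hI ht hT hk (h.hasDerivAt_moment_one hI ht)).congr_deriv ?_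
  generalize decel ((3 * γ - 2) / 2) (M.vSq t) (M.omega t) = q
  rw [Model.normMoment, Model.normMoment, Model.vSq, Model.omega, Model.hubble_eq]
  push_cast
  field_simp
  ring

lemma hasDerivAt_normMoment_two : HasDerivAt (M.normMoment 2) (M.hubble t *
    ((2 * decel ((3 * γ - 2) / 2) (M.vSq t) (M.omega t) - 4) * M.normMoment 2 t
      + 12 * M.vSq t * M.normMoment 1 t
      + 2 * (2 - (3 * γ - 2) / 2) * M.omega t * M.normMoment 1 t - 2 * M.normMoment 3 t
      + 2 * M.normMoment 1 t * M.normMoment 2 t)) t := by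
  have hT' : (M.mixed t).trace ≠ 0 := by
    rw [Model.hubble_eq] at hT; intro h0; simp [h0] at hT
  refine (h.hasDerivAt_normMoment hI ht hT hk (h.hasDerivAt_moment_two hI ht)).congr_deriv ?_
  generalize decel ((3 * γ - 2) / 2) (M.vSq t) (M.omega t) = q
  rw [Model.normMoment, Model.normMoment, Model.normMoment, Model.vSq, Model.omega,
    Model.hubble_eq]
  push_cast
  field_simp
  ring

lemma hasDerivAt_normMoment_three : HasDerivAt (M.normMoment 3) (M.hubble t *
    ((3 * decel ((3 * γ - 2) / 2) (M.vSq t) (M.omega t) - 6) * M.normMoment 3 t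
      + 12 * M.vSq t * M.normMoment 2 t + 6 * M.vSq t * M.normMoment 1 t ^ 2
      + 3 * (2 - (3 * γ - 2) / 2) * M.omega t * M.normMoment 2 t - 2 * M.normMoment 4 t
      + 2 * M.normMoment 1 t * M.normMoment 3 t)) t := by
  have hT' : (M.mixed t).trace ≠ 0 := by
    rw [Model.hubble_eq] at hT; intro h0; simp [h0] at hT
  refine (h.hasDerivAt_normMoment hI ht hT hk (h.hasDerivAt_moment_three hI ht)).congr_deriv ?_
  generalize decel ((3 * γ - 2) / 2) (M.vSq t) (M.omega t) = q
  rw [Model.normMoment, Model.normMoment, Model.normMoment, Model.normMoment, Model.vSq,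
    Model.omega, Model.hubble_eq]
  push_cast
  field_simp
  ring

lemma hasDerivAt_shear : HasDerivAt M.shear (M.hubble t *
    ((decel ((3 * γ - 2) / 2) (M.vSq t) (M.omega t) - 2) * M.shear t + 4 * M.vSq t
      - 2 * M.tilt t)) t := by
  refine ((h.hasDerivAt_normMoment_one hI ht hT hk).sub_const 1).congr_deriv ?_
  rw [decel, Model.shear, Model.tilt]
  ring

lemma hasDerivAt_tilt : HasDerivAt M.tilt (M.hubble t *
    (2 * (decel ((3 * γ - 2) / 2) (M.vSq t) (M.omega t) - 2 + 3 / 2 * M.shear t) * M.tilt t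
      - 2 * M.coupling t)) t := by
  refine ((h.hasDerivAt_normMoment_two hI ht hT hk).sub
    ((h.hasDerivAt_normMoment_one hI ht hT hk).pow 2)).congr_deriv ?_
  rw [decel, Model.coupling, Model.shear, Model.tilt]
  push_cast
  ring

lemma hasDerivAt_coupling : HasDerivAt M.coupling (M.hubble t *
    (3 * (decel ((3 * γ - 2) / 2) (M.vSq t) (M.omega t) - 2 + M.shear t) * M.coupling t
      + M.tilt t ^ 2
      - transverse (M.shear t) (M.tilt t) (M.vSq t) (M.omega t) * M.tilt t)) t := by
  have hJ : M.spatialField t ≠ 0 := by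
    intro h0
    simp [Model.moment, Model.form, h0] at hk
  obtain ⟨E, hE⟩ := exists_isAlignedFrame (h.posDef t ht) hJ
  have h4 := normMoment_four h hI ht hT hE
  have d1 := h.hasDerivAt_normMoment_one hI ht hT hk
  have d2 := h.hasDerivAt_normMoment_two hI ht hT hk
  have d3 := h.hasDerivAt_normMoment_three hI ht hT hk
  have ds := h.hasDerivAt_shear hI ht hT hk
  have dw := h.hasDerivAt_tilt hI ht hT hk
  refine (((((d3.sub (d2.const_mul 3)).add (d1.const_mul 3)).sub_const 1).sub (ds.pow 3)).sub
    ((ds.const_mul (3 / 2)).mul dw)).congr_deriv ?_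
  simp only [transverse, Model.coupling, Model.shear, Model.tilt, decel] at h4 ⊢
  linear_combination (-2 * M.hubble t) * h4

end IsEvolution

/-! ### Expanding solutions -/

/-- Solution of a scalar homogeneous linear equation. -/
lemma eq_mul_exp_of_hasDerivAt_mul {I : Set ℝ} (hI : IsOpen I) (hI' : I.OrdConnected)
    {A f : ℝ → ℝ} (hA : ContinuousOn A I) (hf : ∀ t ∈ I, HasDerivAt f (A t * f t) t)
    {t₀ t : ℝ} (ht₀ : t₀ ∈ I) (ht : t ∈ I) : f t = f t₀ * Real.exp (∫ s in t₀..t, A s) := by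
  set B : ℝ → ℝ := fun u => ∫ s in t₀..u, A s
  have hB : ∀ u ∈ I, HasDerivAt B (A u) u := by
    intro u hu
    refine intervalIntegral.integral_hasDerivAt_right ?_ ?_ (hA.continuousAt (hI.mem_nhds hu))
    · exact (hA.mono (hI'.uIcc_subset ht₀ hu)).intervalIntegrable
    · exact hA.stronglyMeasurableAtFilter hI u hu
  have hd : ∀ u ∈ I, HasDerivAt (fun u => f u * Real.exp (-B u)) 0 u := by
    intro u hu
    refine ((hf u hu).mul (hB u hu).neg.exp).congr_deriv ?_
    ring
  have hc : f t * Real.exp (-B t) = f t₀ * Real.exp (-B t₀) :=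
    hI.is_const_of_deriv_eq_zero hI'.isPreconnected
      (fun u hu => (hd u hu).differentiableAt.differentiableWithinAt)
      (fun u hu => (hd u hu).deriv) ht ht₀
  have hB0 : B t₀ = 0 := intervalIntegral.integral_same
  rw [hB0, neg_zero, Real.exp_zero, mul_one] at hc
  rw [← hc, mul_assoc, ← Real.exp_add, neg_add_cancel, Real.exp_zero, mul_one]

section Expanding

variable {γ : ℝ} {M : Model} {a : ℝ} (h : IsEvolution γ M (Ioi a)) {t₀ : ℝ} (ht₀ : a < t₀)
include h ht₀

lemma spatialField_eq {t : ℝ} (ht : a < t) : M.spatialField t = M.spatialField t₀ := by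
  ext i
  exact isOpen_Ioi.is_const_of_deriv_eq_zero (convex_Ioi a).isPreconnected
    (fun s hs => (h.hasDerivAt_spatialField isOpen_Ioi hs i).differentiableAt.differentiableWithinAt)
    (fun s hs => (h.hasDerivAt_spatialField isOpen_Ioi hs i).deriv) ht ht₀

lemma ρ_pos (hρ : 0 < M.ρ t₀) {t : ℝ} (ht : a < t) : 0 < M.ρ t := by
  have hA : ContinuousOn (fun s => -γ * (M.mixed s).trace) (Ioi a) := fun s hs =>
    ((h.hasDerivAt_trace isOpen_Ioi hs).continuousAt.const_mul (-γ)).continuousWithinAt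
  rw [eq_mul_exp_of_hasDerivAt_mul isOpen_Ioi ordConnected_Ioi hA
    (fun s hs => h.hasDerivAt_ρ isOpen_Ioi hs) ht₀ ht]
  positivity

lemma hubble_pos (hH : 0 < M.hubble t₀) (hρ : 0 < M.ρ t₀) (hJ : M.spatialField t₀ ≠ 0) {t : ℝ}
    (ht : a < t) : 0 < M.hubble t := by
  have hne : ∀ s ∈ Ioi a, M.hubble s ≠ 0 := by
    intro s hs h0
    obtain ⟨E, hE⟩ := exists_isAlignedFrame (h.posDef s hs)
      (by rwa [spatialField_eq h ht₀ hs])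
    have hc := h.constraint isOpen_Ioi hs
    have hsymm : (Eᵀ * M.expansion s * E)ᵀ = Eᵀ * M.expansion s * E := by
      simp [Matrix.transpose_mul, expansion_symm isOpen_Ioi h.posDef hs, Matrix.mul_assoc]
    rw [hE.trace_mixed_sq, trace_mul_self_of_symm hsymm, ← M.moment_zero, hE.moment_eq,
      show (M.mixed s).trace = 0 by rw [Model.hubble_eq] at h0; linarith] at hc
    have h1 := ρ_pos h ht₀ hρ hs
    have h2 := hE.pos
    simp only [pow_zero, Matrix.one_apply_eq, mul_one] at hc
    generalize Eᵀ * M.expansion s * E = A at hc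
    have : 0 < M.frameField s E 0 ^ 2 := by positivity
    nlinarith [sq_nonneg (A 0 0), sq_nonneg (A 1 1), sq_nonneg (A 2 2), sq_nonneg (A 0 1),
      sq_nonneg (A 0 2), sq_nonneg (A 1 2)]
  have hcont : ContinuousOn M.hubble (Ioi a) := by
    have : M.hubble = fun s => (M.mixed s).trace / 3 := funext M.hubble_eq
    rw [this]
    exact fun s hs =>
      ((h.hasDerivAt_trace isOpen_Ioi hs).continuousAt.div_const 3).continuousWithinAt
  by_contra hneg
  obtain ⟨s, hs, hs0⟩ := isPreconnected_Ioi.intermediate_value (mem_Ioi.2 ht) (mem_Ioi.2 ht₀)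
    hcont ⟨not_lt.1 hneg, hH.le⟩
  exact hne s hs hs0

lemma isReducedFlow (hH : 0 < M.hubble t₀) (hρ : 0 < M.ρ t₀) (hJ : M.spatialField t₀ ≠ 0) :
    IsReducedFlow ((3 * γ - 2) / 2) (Ioi a) M.hubble M.shear M.tilt M.coupling M.vSq M.omega := by
  have hH' : ∀ t ∈ Ioi a, 0 < M.hubble t := fun t ht => hubble_pos h ht₀ hH hρ hJ ht
  have hρ' : ∀ t ∈ Ioi a, 0 < M.ρ t := fun t ht => ρ_pos h ht₀ hρ ht
  have hJ' : ∀ t ∈ Ioi a, M.spatialField t ≠ 0 := fun t ht => by rwa [spatialField_eq h ht₀ ht]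
  have hE : ∀ t ∈ Ioi a, ∃ E, IsAlignedFrame M t E := fun t ht =>
    exists_isAlignedFrame (h.posDef t ht) (hJ' t ht)
  have hk : ∀ t ∈ Ioi a, 0 < M.moment 0 t := by
    intro t ht
    obtain ⟨E, hE⟩ := hE t ht
    have := hE.pos
    rw [hE.moment_eq]
    simpa using by positivity
  have hT : ∀ t ∈ Ioi a, 0 < (M.mixed t).trace := fun t ht => by
    have := hH' t ht
    rw [Model.hubble_eq] at this
    linarith
  have hr : ∀ t ∈ Ioi a, ∃ S : State, IsReadOff S (M.shear t) (M.tilt t) (M.coupling t)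
      (M.vSq t) (M.omega t) := fun t ht => by
    obtain ⟨E, hE⟩ := hE t ht
    exact ⟨_, isReadOff_state h isOpen_Ioi ht (hH' t ht) hE⟩
  refine ⟨hH', ?_, ?_, ?_, ?_, ?_, ?_, ?_, ?_, ?_, ?_, ?_⟩ <;> intro t ht
  · have := hk t ht
    have := hT t ht
    rw [Model.vSq]; positivity
  · have := hρ' t ht
    have := hT t ht
    rw [Model.omega]; positivity
  · obtain ⟨S, hS⟩ := hr t ht
    rw [← hS.tilt]; positivity
  · obtain ⟨S, hS⟩ := hr t ht
    rw [← hS.transverse]; positivity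
  · obtain ⟨S, hS⟩ := hr t ht
    rw [← hS.transverse, ← hS.coupling, ← hS.tilt]
    nlinarith [sq_nonneg ((S.1 1 1 - S.1 2 2) / 2 * (2 * S.1 0 1 * S.1 0 2)
      - S.1 1 2 * (S.1 0 1 ^ 2 - S.1 0 2 ^ 2))]
  · exact h.hasDerivAt_hubble isOpen_Ioi ht (hH' t ht)
  · exact h.hasDerivAt_shear isOpen_Ioi ht (hH' t ht) (hk t ht)
  · exact h.hasDerivAt_tilt isOpen_Ioi ht (hH' t ht) (hk t ht)
  · exact h.hasDerivAt_coupling isOpen_Ioi ht (hH' t ht) (hk t ht)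
  · exact h.hasDerivAt_vSq isOpen_Ioi ht (hH' t ht) (hk t ht)
  · exact h.hasDerivAt_omega isOpen_Ioi ht (hH' t ht)

end Expanding

/-! ### Barbalat's lemma with a rescaled time -/

lemma le_of_hasDerivAt_nonneg {f f' : ℝ → ℝ} {a b : ℝ} (hab : a ≤ b)
    (hf : ∀ t ∈ Icc a b, HasDerivAt f (f' t) t) (hf' : ∀ t ∈ Icc a b, 0 ≤ f' t) : f a ≤ f b := by
  refine monotoneOn_of_deriv_nonneg (convex_Icc a b)
    (fun t ht => (hf t ht).continuousAt.continuousWithinAt)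
    (fun t ht => (hf t (interior_subset ht)).differentiableAt.differentiableWithinAt)
    (fun t ht => ?_) (left_mem_Icc.2 hab) (right_mem_Icc.2 hab) hab
  rw [(hf t (interior_subset ht)).deriv]
  exact hf' t (interior_subset ht)

section Barbalat

variable {a C L : ℝ} {f F G H τ : ℝ → ℝ} (hf : ∀ t > a, HasDerivAt f (H t * F t) t)
  (hF : ∀ t > a, HasDerivAt F (H t * G t) t) (hτ : ∀ t > a, HasDerivAt τ (H t) t)
  (hH : ∀ t > a, 0 < H t) (hG : ∀ t > a, |G t| ≤ C) (hτ' : Tendsto τ atTop atTop)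
  (hfL : Tendsto f atTop (𝓝 L))
include hf hF hτ hH hG hτ' hfL

lemma eventually_lt_of_tendsto {ε : ℝ} (hε : 0 < ε) : ∀ᶠ t in atTop, F t < ε := by
  set D := |C| + 1
  have hD : 0 < D := by positivity
  have hCD : C ≤ D := (le_abs_self C).trans (by simp [D])
  set δ := ε / (2 * D) with hδ
  have hδ0 : 0 < δ := by positivity
  have hη : 0 < ε * δ / 4 := by positivity
  obtain ⟨N, hN⟩ := Metric.tendsto_atTop.1 hfL (ε * δ / 4) hη
  filter_upwards [eventually_ge_atTop N, eventually_gt_atTop a] with t htN hta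
  by_contra hlt
  rw [not_lt] at hlt
  obtain ⟨b, hb1, hb2⟩ := ((hτ'.eventually_ge_atTop (τ t + δ)).and (eventually_ge_atTop t)).exists
  obtain ⟨t₁, ht₁, he⟩ := intermediate_value_Icc hb2
    (fun u hu => (hτ u (hta.trans_le hu.1)).continuousAt.continuousWithinAt)
    (show τ t + δ ∈ Icc (τ t) (τ b) from ⟨by linarith, hb1⟩)
  have hFu : ∀ u ∈ Icc t t₁, ε / 2 ≤ F u := by
    intro u hu
    have h1 : D * τ t + F t ≤ D * τ u + F u := by
      refine le_of_hasDerivAt_nonneg (f := fun u => D * τ u + F u) hu.1 (fun x hx =>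
        ((hτ x (hta.trans_le hx.1)).const_mul D).add (hF x (hta.trans_le hx.1))) fun x hx => ?_
      have hx' := hta.trans_le hx.1
      have := (abs_le.1 (hG x hx')).1
      have := hH x hx'
      nlinarith
    have h2 : τ u ≤ τ t₁ := le_of_hasDerivAt_nonneg hu.2
      (fun x hx => hτ x (hta.trans_le (hu.1.trans hx.1)))
      (fun x hx => (hH x (hta.trans_le (hu.1.trans hx.1))).le)
    have h3 : D * δ = ε / 2 := by rw [hδ]; field_simp
    nlinarith
  have h4 : f t - ε / 2 * τ t ≤ f t₁ - ε / 2 * τ t₁ := by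
    refine le_of_hasDerivAt_nonneg (f := fun u => f u - ε / 2 * τ u) ht₁.1 (fun x hx =>
        (hf x (hta.trans_le hx.1)).sub ((hτ x (hta.trans_le hx.1)).const_mul (ε / 2)))
        fun x hx => ?_
    have := hFu x hx
    have := hH x (hta.trans_le hx.1)
    nlinarith
  have h5 := hN t htN
  have h6 := hN t₁ (htN.trans ht₁.1)
  rw [Real.dist_eq, abs_lt] at h5 h6
  rw [he] at h4
  nlinarith

/-- If `f` converges, `f' = H F` and `F' = H G` with `G` bounded, and the rescaled time with
derivative `H > 0` is unbounded, then `F` tends to zero. -/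
lemma tendsto_zero_of_tendsto : Tendsto F atTop (𝓝 0) := by
  rw [Metric.tendsto_nhds]
  intro ε hε
  have h1 := eventually_lt_of_tendsto hf hF hτ hH hG hτ' hfL hε
  have h2 := eventually_lt_of_tendsto (f := fun t => -f t) (F := fun t => -F t)
    (G := fun t => -G t) (fun t ht => (hf t ht).neg.congr_deriv (by ring))
    (fun t ht => (hF t ht).neg.congr_deriv (by ring)) hτ hH (fun t ht => by simpa using hG t ht)
    hτ' hfL.neg hε
  filter_upwards [h1, h2] with t ht1 ht2
  rw [Real.dist_eq, sub_zero, abs_lt]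
  constructor <;> linarith

end Barbalat

/-! ### Bounds on the reduced state space -/

section Bounds

variable {s w z V W : ℝ} (hV : 0 < V) (hW : 0 < W) (hw : 0 ≤ w) (hy : 0 ≤ transverse s w V W)
include hV hW hw hy

lemma reduced_bounds :
    s ^ 2 < 4 ∧ V < 1 ∧ W < 1 ∧ w < 3 ∧ transverse s w V W < 6 := by
  rw [transverse] at hy ⊢
  refine ⟨?_, ?_, ?_, ?_, ?_⟩ <;> nlinarith [sq_nonneg s]

lemma denom_pos {σ : ℝ} (hσ : 0 < σ) (hσ2 : σ < 2) : 0 < 1 - σ * s / 4 := by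
  have := abs_lt_of_sq_lt_sq (show s ^ 2 < 2 ^ 2 by linarith [(reduced_bounds hV hW hw hy).1]) (by norm_num)
  nlinarith [abs_lt.1 this]

lemma denom_lt_two {σ : ℝ} (hσ : 0 < σ) (hσ2 : σ < 2) : 1 - σ * s / 4 < 2 := by
  have := abs_lt_of_sq_lt_sq (show s ^ 2 < 2 ^ 2 by linarith [(reduced_bounds hV hW hw hy).1]) (by norm_num)
  nlinarith [abs_lt.1 this]

end Bounds

/-! ### The Lyapunov function -/

/-- A function that increases along the reduced flow. -/
def lyapunov (σ s V W : ℝ) : ℝ :=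
  σ * Real.log V + 2 * Real.log W - (4 + 2 * σ) * Real.log (1 - σ * s / 4)

/-- The rate of growth of `lyapunov` per unit of `∫ H dt`. -/
def lyapunovRate (σ s w V W : ℝ) : ℝ :=
  2 / (1 - σ * s / 4) * ((s - σ) ^ 2 + (4 - σ ^ 2) * transverse s w V W / 6
    + (2 + σ) * (4 - 5 * σ) / 6 * w)

lemma x_sub_one_sub_log_ge {x : ℝ} (hx : 0 < x) : (√x - 1) ^ 2 ≤ x - 1 - Real.log x := by
  have h1 := Real.log_le_sub_one_of_pos (Real.sqrt_pos.2 hx)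
  rw [Real.log_sqrt hx.le] at h1
  nlinarith [Real.sq_sqrt hx.le]

/-- Quantitative maximality of the equilibrium value of the Lyapunov function. -/
lemma lyapunov_gap {σ : ℝ} (hσ : 0 < σ) (hσ2 : σ < 2) {s w V W : ℝ} (hV : 0 < V) (hW : 0 < W)
    (hw : 0 ≤ w) (hy : 0 ≤ transverse s w V W) :
    (2 + σ) / (4 * (1 - σ * s / 4) ^ 2) * ((s - σ) ^ 2
        + (4 - σ ^ 2) * (w / 3 + transverse s w V W / 6))
      + 2 * (√(W * (1 - σ * σ / 4) ^ 2 / ((2 - σ) / 2 * (1 - σ * s / 4) ^ 2)) - 1) ^ 2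
      ≤ lyapunov σ σ (σ * (2 - σ) / 4) ((2 - σ) / 2) - lyapunov σ s V W := by
  have hD := denom_pos hV hW hw hy hσ hσ2
  have hD0 : 0 < 1 - σ * σ / 4 := by nlinarith
  have h2σ : 0 < 2 - σ := by linarith
  set D := 1 - σ * s / 4 with hDdef
  set D₀ := 1 - σ * σ / 4 with hD0def
  set A := V * D₀ ^ 2 / (σ * (2 - σ) / 4 * D ^ 2) with hA
  set B := W * D₀ ^ 2 / ((2 - σ) / 2 * D ^ 2) with hB
  have hA0 : 0 < A := by positivity
  have hB0 : 0 < B := by positivity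
  have lA : Real.log A = Real.log V + 2 * Real.log D₀ - Real.log (σ * (2 - σ) / 4)
      - 2 * Real.log D := by
    rw [hA, Real.log_div (by positivity) (by positivity), Real.log_mul (by positivity)
      (by positivity), Real.log_mul (by positivity) (by positivity), Real.log_pow, Real.log_pow]
    push_cast; ring
  have lB : Real.log B = Real.log W + 2 * Real.log D₀ - Real.log ((2 - σ) / 2)
      - 2 * Real.log D := by
    rw [hB, Real.log_div (by positivity) (by positivity), Real.log_mul (by positivity)
      (by positivity), Real.log_mul (by positivity) (by positivity), Real.log_pow, Real.log_pow]
    push_cast; ring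
  have e1 : lyapunov σ σ (σ * (2 - σ) / 4) ((2 - σ) / 2) - lyapunov σ s V W
      = -σ * Real.log A - 2 * Real.log B := by
    rw [lA, lB, lyapunov, lyapunov, ← hDdef, ← hD0def]; ring
  have e2 : σ * (A - 1) + 2 * (B - 1)
      = -((2 + σ) / (4 * D ^ 2) * ((s - σ) ^ 2
        + (4 - σ ^ 2) * (w / 3 + transverse s w V W / 6))) := by
    rw [hA, hB, transverse]
    field_simp
    rw [hDdef, hD0def]
    ring
  have h1 := Real.log_le_sub_one_of_pos hA0
  have h2 := x_sub_one_sub_log_ge hB0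
  rw [e1]
  nlinarith

/-! ### Convergence of the reduced flow -/

/-- The vector field of the reduced system, in the variables `(s, w, z, V, W)`. -/
def reducedField (σ : ℝ) (x : Fin 5 → ℝ) : Fin 5 → ℝ :=
  ![(decel σ (x 3) (x 4) - 2) * x 0 + 4 * x 3 - 2 * x 1,
    2 * (decel σ (x 3) (x 4) - 2 + 3 / 2 * x 0) * x 1 - 2 * x 2,
    3 * (decel σ (x 3) (x 4) - 2 + x 0) * x 2 + x 1 ^ 2
      - transverse (x 0) (x 1) (x 3) (x 4) * x 1,
    2 * (decel σ (x 3) (x 4) - x 0) * x 3,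
    2 * (decel σ (x 3) (x 4) - σ) * x 4]

lemma continuous_reducedField (σ : ℝ) : Continuous (reducedField σ) := by
  refine continuous_pi fun i => ?_
  fin_cases i <;> simp [reducedField, decel, transverse] <;> fun_prop

namespace IsReducedFlow

variable {σ a : ℝ} {H s w z V W : ℝ → ℝ} (h : IsReducedFlow σ (Ioi a) H s w z V W)
include h

lemma bounds {t : ℝ} (ht : a < t) : s t ^ 2 < 4 ∧ V t < 1 ∧ W t < 1 ∧ w t < 3 ∧
    transverse (s t) (w t) (V t) (W t) < 6 :=
  reduced_bounds (h.V_pos t ht) (h.W_pos t ht) (h.w_nonneg t ht) (h.y_nonneg t ht)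

lemma hasDerivAt_point {t : ℝ} (ht : a < t) :
    HasDerivAt (fun t => ![s t, w t, z t, V t, W t])
      (H t • reducedField σ ![s t, w t, z t, V t, W t]) t := by
  rw [hasDerivAt_pi]
  intro i
  fin_cases i
  · exact h.s_deriv t ht
  · exact h.w_deriv t ht
  · exact h.z_deriv t ht
  · exact h.V_deriv t ht
  · exact h.W_deriv t ht

lemma point_mem {t : ℝ} (ht : a < t) :
    ![s t, w t, z t, V t, W t] ∈ Icc (![-2, 0, -6, 0, 0] : Fin 5 → ℝ) ![2, 3, 6, 1, 1] := by
  obtain ⟨h1, h2, h3, h4, h5⟩ := h.bounds ht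
  have hw := h.w_nonneg t ht
  have hV := h.V_pos t ht
  have hW := h.W_pos t ht
  have hs := abs_le.1 (abs_le_of_sq_le_sq (show s t ^ 2 ≤ 2 ^ 2 by linarith) (by norm_num))
  have hz2 : z t ^ 2 ≤ 6 ^ 2 := by
    have := h.z_sq_le t ht
    have := h.y_nonneg t ht
    have : w t ^ 2 ≤ 9 := by nlinarith
    nlinarith
  have hz := abs_le.1 (abs_le_of_sq_le_sq hz2 (by norm_num))
  constructor <;> intro i <;> fin_cases i <;> simp <;> linarith

/-- A rescaled time with derivative `H`. -/
lemma exists_time (hσ : 0 < σ) (hσ2 : σ < 2) : ∃ τ : ℝ → ℝ, (∀ t > a, HasDerivAt τ (H t) t) ∧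
    Tendsto τ atTop atTop := by
  set τ : ℝ → ℝ := fun t => -(Real.log (W t) + 2 * Real.log (H t)) / (2 * (1 + σ)) with hτ
  have hd : ∀ t > a, HasDerivAt τ (H t) t := by
    intro t ht
    have hW := h.W_pos t ht
    have hH := h.H_pos t ht
    refine ((((h.W_deriv t ht).log hW.ne').add
      (((h.H_deriv t ht).log hH.ne').const_mul 2)).neg.div_const (2 * (1 + σ))).congr_deriv ?_
    field_simp
    ring
  refine ⟨τ, hd, ?_⟩
  set b := a + 1
  have hb : a < b := by simp [b]
  have hH0 := h.H_pos b hb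
  have hinv : ∀ t ≥ b, (H t)⁻¹ ≤ (H b)⁻¹ + 3 * (t - b) := by
    intro t ht
    have := le_of_hasDerivAt_nonneg (f := fun u => 3 * u - (H u)⁻¹) ht (fun u hu =>
      ((hasDerivAt_id u).const_mul 3).sub ((h.H_deriv u (hb.trans_le hu.1)).inv
        (h.H_pos u (hb.trans_le hu.1)).ne')) fun u hu => by
        have hu' := hb.trans_le hu.1
        have := h.H_pos u hu'
        have := h.V_pos u hu'
        have := h.W_pos u hu'
        rw [decel]
        field_simp
        nlinarith
    linarith
  have hlow : ∀ t ≥ b, τ b + (Real.log ((H b)⁻¹ + 3 * (t - b)) / 3 - Real.log ((H b)⁻¹) / 3)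
      ≤ τ t := by
    intro t ht
    have hpos : ∀ u ≥ b, 0 < (H b)⁻¹ + 3 * (u - b) := fun u hu => by
      have : 0 < (H b)⁻¹ := by positivity
      linarith
    have := le_of_hasDerivAt_nonneg (f := fun u => τ u - Real.log ((H b)⁻¹ + 3 * (u - b)) / 3) ht
      (fun u hu => (hd u (hb.trans_le hu.1)).sub
        ((((((hasDerivAt_id u).sub_const b).const_mul 3).const_add (H b)⁻¹).log
          (hpos u hu.1).ne').div_const 3)) fun u hu => by
        have h1 := hinv u hu.1
        have h2 := hpos u hu.1
        have h3 := h.H_pos u (hb.trans_le hu.1)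
        have h4 : ((H b)⁻¹ + 3 * (u - b))⁻¹ ≤ H u := by
          rw [inv_le_comm₀ h2 h3]; exact h1
        have : 3 * 1 / ((H b)⁻¹ + 3 * (u - b)) / 3 = ((H b)⁻¹ + 3 * (u - b))⁻¹ := by
          field_simp
        simp only [id]
        linarith
    simp only [sub_self, mul_zero, add_zero] at this
    linarith
  have hlim : Tendsto (fun t => τ b + (Real.log ((H b)⁻¹ + 3 * (t - b)) / 3
      - Real.log ((H b)⁻¹) / 3)) atTop atTop := by
    refine tendsto_atTop_add_const_left _ _ (tendsto_atTop_add_const_right _ _ ?_)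
    refine Tendsto.atTop_div_const (by norm_num) (Real.tendsto_log_atTop.comp ?_)
    refine tendsto_atTop_add_const_left _ _ (Tendsto.const_mul_atTop (by norm_num) ?_)
    exact tendsto_atTop_add_const_right _ _ tendsto_id
  refine tendsto_atTop_mono' _ ?_ hlim
  filter_upwards [eventually_ge_atTop b] with t ht using hlow t ht

/-- If the quantity `f` converges along the flow and its rate of change is a smooth function of the
state, then this rate tends to zero. -/
lemma tendsto_rate_zero (hσ : 0 < σ) (hσ2 : σ < 2) {Ψ : (Fin 5 → ℝ) → ℝ}
    (hΨ : ContDiffOn ℝ 1 Ψ {x | 0 < 1 - σ * x 0 / 4}) {f : ℝ → ℝ} {L : ℝ}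
    (hf : ∀ t > a, HasDerivAt f (H t * Ψ ![s t, w t, z t, V t, W t]) t)
    (hL : Tendsto f atTop (𝓝 L)) :
    Tendsto (fun t => Ψ ![s t, w t, z t, V t, W t]) atTop (𝓝 0) := by
  have hU : IsOpen {x : Fin 5 → ℝ | 0 < 1 - σ * x 0 / 4} :=
    isOpen_lt continuous_const (by fun_prop)
  have hK : Icc (![-2, 0, -6, 0, 0] : Fin 5 → ℝ) ![2, 3, 6, 1, 1]
      ⊆ {x | 0 < 1 - σ * x 0 / 4} := by
    intro x hx
    have : x 0 ≤ 2 := hx.2 0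
    simp only [mem_ofPred_eq]
    nlinarith
  obtain ⟨τ, hτ, hτ'⟩ := h.exists_time hσ hσ2
  have hcont : ContinuousOn (fun x => fderiv ℝ Ψ x (reducedField σ x))
      (Icc (![-2, 0, -6, 0, 0] : Fin 5 → ℝ) ![2, 3, 6, 1, 1]) :=
    ((hΨ.continuousOn_fderiv_of_isOpen hU le_rfl).mono hK).clm_apply
      (continuous_reducedField σ).continuousOn
  obtain ⟨C, hC⟩ := isCompact_Icc.exists_bound_of_continuousOn hcont
  refine tendsto_zero_of_tendsto (H := H) (C := C) hf
    (G := fun t => fderiv ℝ Ψ ![s t, w t, z t, V t, W t]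
      (reducedField σ ![s t, w t, z t, V t, W t])) (fun t ht => ?_) hτ h.H_pos
    (fun t ht => hC _ (h.point_mem ht)) hτ' hL
  have hd : HasFDerivAt Ψ (fderiv ℝ Ψ ![s t, w t, z t, V t, W t]) ![s t, w t, z t, V t, W t] :=
    ((hΨ.differentiableOn one_ne_zero).differentiableAt
      (hU.mem_nhds (hK (h.point_mem ht)))).hasFDerivAt
  refine (hd.comp_hasDerivAt t (h.hasDerivAt_point ht)).congr_deriv ?_
  rw [map_smul, smul_eq_mul]

lemma hasDerivAt_lyapunov (hσ : 0 < σ) (hσ2 : σ < 2) {t : ℝ} (ht : a < t) :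
    HasDerivAt (fun t => lyapunov σ (s t) (V t) (W t))
      (H t * lyapunovRate σ (s t) (w t) (V t) (W t)) t := by
  have hV := h.V_pos t ht
  have hW := h.W_pos t ht
  have hD := denom_pos hV hW (h.w_nonneg t ht) (h.y_nonneg t ht) hσ hσ2
  refine (((((h.V_deriv t ht).log hV.ne').const_mul σ).add
    (((h.W_deriv t ht).log hW.ne').const_mul 2)).sub
    (((((h.s_deriv t ht).const_mul σ).div_const 4).const_sub 1).log hD.ne'
      |>.const_mul (4 + 2 * σ))).congr_deriv ?_
  have hD' : 4 - σ * s t ≠ 0 := by linarith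
  rw [lyapunovRate, transverse, decel]
  field_simp
  ring

lemma lyapunovRate_nonneg (hσ : 0 < σ) (hσ' : σ ≤ 4 / 5) {t : ℝ} (ht : a < t) :
    (s t - σ) ^ 2 + (4 - σ ^ 2) * transverse (s t) (w t) (V t) (W t) / 6
      ≤ lyapunovRate σ (s t) (w t) (V t) (W t) := by
  have hV := h.V_pos t ht
  have hW := h.W_pos t ht
  have hw := h.w_nonneg t ht
  have hy := h.y_nonneg t ht
  have hD := denom_pos hV hW hw hy hσ (by linarith)
  have hD2 := denom_lt_two hV hW hw hy hσ (by linarith)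
  have h1 : 1 ≤ 2 / (1 - σ * s t / 4) := by rw [one_le_div hD]; exact hD2.le
  have h2 : 0 ≤ (2 + σ) * (4 - 5 * σ) / 6 * w t := by
    have : 0 ≤ 4 - 5 * σ := by linarith
    positivity
  have h3 : 0 ≤ (s t - σ) ^ 2 + (4 - σ ^ 2) * transverse (s t) (w t) (V t) (W t) / 6 := by
    have : 0 ≤ 4 - σ ^ 2 := by nlinarith
    positivity
  rw [lyapunovRate]
  nlinarith

lemma lyapunov_mono (hσ : 0 < σ) (hσ' : σ ≤ 4 / 5) {t₁ t₂ : ℝ} (ht₁ : a < t₁) (ht : t₁ ≤ t₂) :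
    lyapunov σ (s t₁) (V t₁) (W t₁) ≤ lyapunov σ (s t₂) (V t₂) (W t₂) := by
  refine le_of_hasDerivAt_nonneg ht
    (fun t ht => h.hasDerivAt_lyapunov hσ (by linarith) (ht₁.trans_le ht.1)) fun t ht => ?_
  have ht' := ht₁.trans_le ht.1
  refine mul_nonneg (h.H_pos t ht').le (le_trans ?_ (h.lyapunovRate_nonneg hσ hσ' ht'))
  have := h.y_nonneg t ht'
  have : 0 ≤ 4 - σ ^ 2 := by nlinarith
  positivity

lemma exists_tendsto_lyapunov (hσ : 0 < σ) (hσ' : σ ≤ 4 / 5) :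
    ∃ L, Tendsto (fun t => lyapunov σ (s t) (V t) (W t)) atTop (𝓝 L) := by
  set b := a + 1
  have hb : a < b := by simp [b]
  have hmono : Monotone fun t => lyapunov σ (s (max t b)) (V (max t b)) (W (max t b)) :=
    fun t₁ t₂ ht => h.lyapunov_mono hσ hσ' (hb.trans_le (le_max_right _ _)) (max_le_max_right b ht)
  have hbdd : BddAbove (range fun t => lyapunov σ (s (max t b)) (V (max t b)) (W (max t b))) := by
    refine ⟨lyapunov σ σ (σ * (2 - σ) / 4) ((2 - σ) / 2), ?_⟩
    rintro _ ⟨t, rfl⟩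
    have ht : a < max t b := hb.trans_le (le_max_right _ _)
    have hy := h.y_nonneg _ ht
    have hw := h.w_nonneg _ ht
    have := lyapunov_gap hσ (by linarith) (h.V_pos _ ht) (h.W_pos _ ht) hw hy
    have h4 : 0 ≤ 4 - σ ^ 2 := by nlinarith
    have : 0 ≤ (2 + σ) / (4 * (1 - σ * s (max t b) / 4) ^ 2) * ((s (max t b) - σ) ^ 2
        + (4 - σ ^ 2) * (w (max t b) / 3
          + transverse (s (max t b)) (w (max t b)) (V (max t b)) (W (max t b)) / 6))
      + 2 * (√(W (max t b) * (1 - σ * σ / 4) ^ 2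
        / ((2 - σ) / 2 * (1 - σ * s (max t b) / 4) ^ 2)) - 1) ^ 2 := by positivity
    simp only
    linarith
  refine ⟨_, (tendsto_atTop_ciSup hmono hbdd).congr' ?_⟩
  filter_upwards [eventually_ge_atTop b] with t ht
  rw [max_eq_left ht]

/-- Along the reduced flow the state converges to the equilibrium. -/
theorem tendsto (hσ : 0 < σ) (hσ' : σ ≤ 4 / 5) :
    Tendsto s atTop (𝓝 σ) ∧ Tendsto w atTop (𝓝 0) ∧
    Tendsto (fun t => transverse (s t) (w t) (V t) (W t)) atTop (𝓝 0) ∧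
    Tendsto W atTop (𝓝 ((2 - σ) / 2)) := by
  have hσ2 : σ < 2 := by linarith
  have h4 : 0 < 4 - σ ^ 2 := by nlinarith
  have hev : ∀ᶠ t in atTop, a < t := eventually_gt_atTop a
  obtain ⟨L, hL⟩ := h.exists_tendsto_lyapunov hσ hσ'
  have hrate : Tendsto (fun t => lyapunovRate σ (s t) (w t) (V t) (W t)) atTop (𝓝 0) := by
    refine h.tendsto_rate_zero hσ hσ2
      (Ψ := fun x => lyapunovRate σ (x 0) (x 1) (x 3) (x 4)) ?_
      (fun t ht => h.hasDerivAt_lyapunov hσ hσ2 ht) hL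
    unfold lyapunovRate transverse
    refine ContDiffOn.mul (ContDiffOn.div contDiffOn_const (by fun_prop) fun x hx => hx.ne')
      (by fun_prop)
  have hsq : Tendsto (fun t => (s t - σ) ^ 2) atTop (𝓝 0) := by
    refine squeeze_zero' (Eventually.of_forall fun t => sq_nonneg _) ?_ hrate
    filter_upwards [hev] with t ht
    have := h.lyapunovRate_nonneg hσ hσ' ht
    have := mul_nonneg h4.le (h.y_nonneg t ht)
    linarith
  have hs : Tendsto s atTop (𝓝 σ) := by
    have := (hsq.sqrt).congr fun t => Real.sqrt_sq_eq_abs _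
    rw [Real.sqrt_zero] at this
    simpa using ((tendsto_zero_iff_abs_tendsto_zero _).2 this).add_const σ
  have hy : Tendsto (fun t => transverse (s t) (w t) (V t) (W t)) atTop (𝓝 0) := by
    have h1 : Tendsto (fun t => 6 / (4 - σ ^ 2) * lyapunovRate σ (s t) (w t) (V t) (W t)) atTop
        (𝓝 0) := by simpa using hrate.const_mul (6 / (4 - σ ^ 2))
    refine squeeze_zero' (hev.mono fun t ht => h.y_nonneg t ht) ?_ h1
    filter_upwards [hev] with t ht
    have := h.lyapunovRate_nonneg hσ hσ' ht
    rw [div_mul_eq_mul_div, le_div_iff₀ h4]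
    nlinarith [sq_nonneg (s t - σ)]
  have hs' : Tendsto (fun t => (decel σ (V t) (W t) - 2) * s t + 4 * V t - 2 * w t) atTop
      (𝓝 0) := by
    refine h.tendsto_rate_zero hσ hσ2
      (Ψ := fun x => (decel σ (x 3) (x 4) - 2) * x 0 + 4 * x 3 - 2 * x 1) ?_ h.s_deriv hs
    unfold decel
    fun_prop
  have hz : Tendsto z atTop (𝓝 0) := by
    have h1 : Tendsto (fun t => √(9 / 2 * transverse (s t) (w t) (V t) (W t))) atTop (𝓝 0) := by
      simpa using (hy.const_mul (9 / 2)).sqrt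
    refine squeeze_zero_norm' ?_ h1
    filter_upwards [hev] with t ht
    refine Real.abs_le_sqrt ?_
    have h1 := h.z_sq_le t ht
    have h2 := h.y_nonneg t ht
    have h3 : w t ^ 2 ≤ 9 := by nlinarith [h.w_nonneg t ht, (h.bounds ht).2.2.2.1]
    nlinarith
  have hz' : Tendsto (fun t => 3 * (decel σ (V t) (W t) - 2 + s t) * z t + w t ^ 2
      - transverse (s t) (w t) (V t) (W t) * w t) atTop (𝓝 0) := by
    refine h.tendsto_rate_zero hσ hσ2
      (Ψ := fun x => 3 * (decel σ (x 3) (x 4) - 2 + x 0) * x 2 + x 1 ^ 2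
        - transverse (x 0) (x 1) (x 3) (x 4) * x 1) ?_ h.z_deriv hz
    unfold decel transverse
    fun_prop
  have hw : Tendsto w atTop (𝓝 0) := by
    have hb1 : IsBoundedUnder (· ≤ ·) atTop ((‖·‖) ∘ fun t =>
        3 * (decel σ (V t) (W t) - 2 + s t)) := by
      refine ⟨18, eventually_map.2 ?_⟩
      filter_upwards [hev] with t ht
      obtain ⟨h1, h2, h3, -, -⟩ := h.bounds ht
      have hs := abs_le.1 (abs_le_of_sq_le_sq (show s t ^ 2 ≤ 2 ^ 2 by linarith) (by norm_num))
      have := h.V_pos t ht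
      have := h.W_pos t ht
      simp only [Function.comp, decel, Real.norm_eq_abs]
      rw [abs_le]
      constructor <;> nlinarith
    have hb2 : IsBoundedUnder (· ≤ ·) atTop ((‖·‖) ∘ w) := by
      refine ⟨3, eventually_map.2 ?_⟩
      filter_upwards [hev] with t ht
      have := h.w_nonneg t ht
      have := (h.bounds ht).2.2.2.1
      simp only [Function.comp, Real.norm_eq_abs]
      rw [abs_le]
      constructor <;> linarith
    have h1 := hz.zero_mul_isBoundedUnder_le hb1
    have h2 := hy.zero_mul_isBoundedUnder_le hb2
    have h3 : Tendsto (fun t => w t ^ 2) atTop (𝓝 0) := by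
      have := (hz'.sub h1).add h2
      simp only [sub_zero, add_zero] at this
      exact this.congr fun t => by ring
    have h4 := (h3.sqrt).congr fun t => Real.sqrt_sq_eq_abs _
    rw [Real.sqrt_zero] at h4
    exact (tendsto_zero_iff_abs_tendsto_zero _).2 h4
  refine ⟨hs, hw, hy, ?_⟩
  have hVW : Tendsto (fun t => V t + W t) atTop (𝓝 (1 - σ ^ 2 / 4)) := by
    have := (((hs.pow 2).const_mul (1 / 4)).add (hw.const_mul (1 / 3))).add (hy.const_mul (1 / 6))
    have := this.const_sub 1
    refine (this.congr fun t => ?_).trans_eq ?_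
    · rw [transverse]; ring
    · congr 1; ring
  have hb : IsBoundedUnder (· ≤ ·) atTop ((‖·‖) ∘ fun t => decel σ (V t) (W t) - 2) := by
    refine ⟨6, eventually_map.2 ?_⟩
    filter_upwards [hev] with t ht
    obtain ⟨-, h2, h3, -, -⟩ := h.bounds ht
    have := h.V_pos t ht
    have := h.W_pos t ht
    simp only [Function.comp, decel, Real.norm_eq_abs]
    rw [abs_le]
    constructor <;> nlinarith
  have hsσ : Tendsto (fun t => s t - σ) atTop (𝓝 0) := by simpa using hs.sub_const σ
  have h5 := hsσ.zero_mul_isBoundedUnder_le hb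
  have h6 := (hVW.const_mul (4 - 2 * σ)).sub ((hs'.sub h5).add (hw.const_mul 2))
  have h7 := h6.const_mul (1 / (4 - σ ^ 2))
  refine (h7.congr fun t => ?_).trans_eq ?_
  · rw [decel]; field_simp; ring
  · congr 1; field_simp; ring

end IsReducedFlow

/-! ### Convergence of states -/

lemma isReadOff_of_mem_stateSpace {S : State} (hS : S ∈ stateSpace) :
    IsReadOff S (S.1 0 0) (S.1 0 1 ^ 2 + S.1 0 2 ^ 2)
      ((S.1 1 1 - S.1 2 2) / 2 * (S.1 0 1 ^ 2 - S.1 0 2 ^ 2) + 2 * S.1 1 2 * S.1 0 1 * S.1 0 2)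
      (S.2.1 0 ^ 2) S.2.2 := by
  obtain ⟨hsymm, htr, -, h1, h2, -, hc⟩ := hS
  refine ⟨rfl, rfl, rfl, ?_, rfl, rfl⟩
  rw [trace_mul_self_of_symm hsymm, Fin.sum_univ_three, h1, h2] at hc
  rw [Matrix.trace_fin_three] at htr
  rw [transverse]
  linear_combination 6 * hc
    + (S.1 0 0 - S.1 1 1 - S.1 2 2) / 2 * htr

lemma tendsto_zero_of_sq_le {ι : Type*} {l : Filter ι} {f g : ι → ℝ}
    (hfg : ∀ᶠ i in l, f i ^ 2 ≤ g i) (hg : Tendsto g l (𝓝 0)) : Tendsto f l (𝓝 0) := by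
  refine squeeze_zero_norm' (hfg.mono fun i hi => Real.abs_le_sqrt hi) ?_
  simpa using hg.sqrt

/-- Convergence of the scalar invariants implies convergence of the state. -/
lemma tendsto_wonderlandState {ι : Type*} {l : Filter ι} {S : ι → State} {γ : ℝ}
    (hγ : 2 / 3 < γ) (hγ2 : γ < 2)
    (hS : ∀ᶠ i in l, S i ∈ stateSpace)
    (hs : Tendsto (fun i => (S i).1 0 0) l (𝓝 ((3 * γ - 2) / 2)))
    (hw : Tendsto (fun i => (S i).1 0 1 ^ 2 + (S i).1 0 2 ^ 2) l (𝓝 0))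
    (hy : Tendsto (fun i => ((S i).1 1 1 - (S i).1 2 2) ^ 2 / 2 + 2 * (S i).1 1 2 ^ 2) l (𝓝 0))
    (hW : Tendsto (fun i => (S i).2.2) l (𝓝 ((2 - (3 * γ - 2) / 2) / 2))) :
    Tendsto S l (𝓝 (wonderlandState γ)) := by
  have h01 : Tendsto (fun i => (S i).1 0 1) l (𝓝 0) :=
    tendsto_zero_of_sq_le (Eventually.of_forall fun i => by nlinarith [sq_nonneg ((S i).1 0 2)]) hw
  have h02 : Tendsto (fun i => (S i).1 0 2) l (𝓝 0) :=
    tendsto_zero_of_sq_le (Eventually.of_forall fun i => by nlinarith [sq_nonneg ((S i).1 0 1)]) hw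
  have h12 : Tendsto (fun i => (S i).1 1 2) l (𝓝 0) :=
    tendsto_zero_of_sq_le (Eventually.of_forall fun i => by
      nlinarith [sq_nonneg ((S i).1 1 2), sq_nonneg ((S i).1 1 1 - (S i).1 2 2)]) hy
  have hdiff : Tendsto (fun i => (S i).1 1 1 - (S i).1 2 2) l (𝓝 0) := by
    have : Tendsto (fun i => 2 * (((S i).1 1 1 - (S i).1 2 2) ^ 2 / 2 + 2 * (S i).1 1 2 ^ 2)) l
        (𝓝 0) := by simpa using hy.const_mul 2
    exact tendsto_zero_of_sq_le (Eventually.of_forall fun i => by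
      nlinarith [sq_nonneg ((S i).1 1 2)]) this
  have h11 : Tendsto (fun i => (S i).1 1 1) l (𝓝 (-(3 * γ - 2) / 4)) := by
    have := (hdiff.sub hs).const_mul (1 / 2)
    refine (this.congr' ?_).trans_eq (by congr 1; ring)
    filter_upwards [hS] with i hi
    have := hi.2.1
    rw [Matrix.trace_fin_three] at this
    linear_combination (-1 / 2) * this
  have h22 : Tendsto (fun i => (S i).1 2 2) l (𝓝 (-(3 * γ - 2) / 4)) := by
    simpa using h11.sub hdiff
  have hV : Tendsto (fun i => (S i).2.1 0) l (𝓝 (√(3 * (2 - γ) * (3 * γ - 2)) / 4)) := by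
    have h1 := ((((hs.pow 2).const_mul (1 / 4)).add (hw.const_mul (1 / 3))).add
      (hy.const_mul (1 / 6))).add hW
    have h2 : Tendsto (fun i => (S i).2.1 0 ^ 2) l (𝓝 (3 * (2 - γ) * (3 * γ - 2) / 16)) := by
      refine ((h1.const_sub 1).congr' ?_).trans_eq (by congr 1; ring)
      filter_upwards [hS] with i hi
      rw [(isReadOff_of_mem_stateSpace hi).transverse, transverse]
      ring
    have h3 : √(3 * (2 - γ) * (3 * γ - 2)) / 4 = √(3 * (2 - γ) * (3 * γ - 2) / 16) := by
      have h0 : 0 ≤ 3 * (2 - γ) * (3 * γ - 2) :=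
        mul_nonneg (by linarith) (by linarith)
      rw [Real.sqrt_div h0, show (16 : ℝ) = 4 ^ 2 by norm_num, Real.sqrt_sq (by norm_num)]
    rw [h3]
    refine h2.sqrt.congr' ?_
    filter_upwards [hS] with i hi
    exact Real.sqrt_sq hi.2.2.1.le
  refine Tendsto.prodMk_nhds ?_ (Tendsto.prodMk_nhds ?_ ?_)
  · have hsy : ∀ p q, (fun i => (S i).1 p q) =ᶠ[l] fun i => (S i).1 q p := by
      intro p q
      filter_upwards [hS] with i hi
      exact congrFun (congrFun hi.1 q) p
    refine tendsto_pi_nhds.2 fun p => tendsto_pi_nhds.2 fun q => ?_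
    fin_cases p <;> fin_cases q <;> simp
    · exact hs
    · exact h01
    · exact h02
    · exact h01.congr' (hsy 0 1)
    · exact h11.trans_eq (by congr 1; ring)
    · exact h12
    · exact h02.congr' (hsy 0 2)
    · exact h12.congr' (hsy 1 2)
    · exact h22.trans_eq (by congr 1; ring)
  · refine tendsto_pi_nhds.2 fun p => ?_
    fin_cases p <;> simp
    · exact hV
    · refine tendsto_const_nhds.congr' ?_
      filter_upwards [hS] with i hi using hi.2.2.2.1.symm
    · refine tendsto_const_nhds.congr' ?_
      filter_upwards [hS] with i hi using hi.2.2.2.2.1.symm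
  · exact hW.trans_eq (by congr 1; ring)

/-! ### Level sets of the Lyapunov function -/

/-- The Lyapunov function as a function of the state. -/
def stateLyapunov (σ : ℝ) (S : State) : ℝ := lyapunov σ (S.1 0 0) (S.2.1 0 ^ 2) S.2.2

lemma stateLyapunov_wonderlandState {γ : ℝ} (hγ : 2 / 3 < γ) (hγ2 : γ < 2) :
    stateLyapunov ((3 * γ - 2) / 2) (wonderlandState γ)
      = lyapunov ((3 * γ - 2) / 2) ((3 * γ - 2) / 2)
        ((3 * γ - 2) / 2 * (2 - (3 * γ - 2) / 2) / 4) ((2 - (3 * γ - 2) / 2) / 2) := by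
  have h0 : 0 ≤ 3 * (2 - γ) * (3 * γ - 2) := mul_nonneg (by linarith) (by linarith)
  have h1 : (√(3 * (2 - γ) * (3 * γ - 2)) / 4) ^ 2
      = (3 * γ - 2) / 2 * (2 - (3 * γ - 2) / 2) / 4 := by
    rw [div_pow, Real.sq_sqrt h0]; ring
  have h2 : 3 * (2 - γ) / 4 = (2 - (3 * γ - 2) / 2) / 2 := by ring
  simp only [stateLyapunov, wonderlandState, Matrix.diagonal_apply_eq, Matrix.cons_val_zero, h1,
    h2]

lemma continuousAt_stateLyapunov {γ : ℝ} (hγ : 2 / 3 < γ) (hγ2 : γ < 2) :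
    ContinuousAt (stateLyapunov ((3 * γ - 2) / 2)) (wonderlandState γ) := by
  have c1 : Continuous fun S : State => S.1 0 0 :=
    (continuous_apply 0).comp ((continuous_apply 0).comp continuous_fst)
  have c2 : Continuous fun S : State => S.2.1 0 :=
    (continuous_apply 0).comp (continuous_fst.comp continuous_snd)
  have c3 : Continuous fun S : State => S.2.2 := continuous_snd.comp continuous_snd
  have hpos : 0 < 3 * (2 - γ) * (3 * γ - 2) := mul_pos (by linarith) (by linarith)
  unfold stateLyapunov lyapunov
  refine ((continuousAt_const.mul ((c2.pow 2).continuousAt.log ?_)).add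
    (continuousAt_const.mul (c3.continuousAt.log ?_))).sub
    (continuousAt_const.mul (ContinuousAt.log (f := fun S : State =>
      1 - (3 * γ - 2) / 2 * S.1 0 0 / 4) (by fun_prop) ?_))
  · have : 0 < √(3 * (2 - γ) * (3 * γ - 2)) := Real.sqrt_pos.2 hpos
    change (√(3 * (2 - γ) * (3 * γ - 2)) / 4) ^ 2 ≠ 0
    positivity
  · simp only [wonderlandState]
    linarith
  · simp only [wonderlandState, Matrix.diagonal_apply_eq, Matrix.cons_val_zero]
    nlinarith

lemma tendsto_comap_stateLyapunov {γ : ℝ} (hγ : 2 / 3 < γ) (hγ2 : γ < 2) :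
    Tendsto id (comap (stateLyapunov ((3 * γ - 2) / 2))
      (𝓝 (stateLyapunov ((3 * γ - 2) / 2) (wonderlandState γ))) ⊓ 𝓟 stateSpace)
      (𝓝 (wonderlandState γ)) := by
  set σ := (3 * γ - 2) / 2 with hσdef
  set l := comap (stateLyapunov σ) (𝓝 (stateLyapunov σ (wonderlandState γ))) ⊓ 𝓟 stateSpace
  have hσ : 0 < σ := by rw [hσdef]; linarith
  have hσ2 : σ < 2 := by rw [hσdef]; linarith
  have h4 : 0 < 4 - σ ^ 2 := by nlinarith
  have hmem : ∀ᶠ S in l, S ∈ stateSpace := mem_inf_of_right (mem_principal_self _)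
  set gap : State → ℝ := fun S => stateLyapunov σ (wonderlandState γ) - stateLyapunov σ S with hgap
  have hlim : Tendsto gap l (𝓝 0) := by
    have : Tendsto (stateLyapunov σ) l (𝓝 (stateLyapunov σ (wonderlandState γ))) :=
      tendsto_comap.mono_left inf_le_left
    simpa [hgap] using this.const_sub (stateLyapunov σ (wonderlandState γ))
  have key : ∀ S ∈ stateSpace, 0 < 1 - σ * S.1 0 0 / 4 ∧ (2 + σ) / 16 * ((S.1 0 0 - σ) ^ 2
      + (4 - σ ^ 2) * ((S.1 0 1 ^ 2 + S.1 0 2 ^ 2) / 3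
        + ((S.1 1 1 - S.1 2 2) ^ 2 / 2 + 2 * S.1 1 2 ^ 2) / 6)) ≤ gap S ∧
      2 * (√(S.2.2 * (1 - σ * σ / 4) ^ 2 / ((2 - σ) / 2 * (1 - σ * S.1 0 0 / 4) ^ 2)) - 1) ^ 2
        ≤ gap S := by
    intro S hS
    have hr := (isReadOff_of_mem_stateSpace hS).transverse
    have hw : 0 ≤ S.1 0 1 ^ 2 + S.1 0 2 ^ 2 := by positivity
    have hV : 0 < S.2.1 0 ^ 2 := by have := hS.2.2.1; positivity
    have hy : 0 ≤ transverse (S.1 0 0) (S.1 0 1 ^ 2 + S.1 0 2 ^ 2) (S.2.1 0 ^ 2) S.2.2 := by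
      rw [← hr]; positivity
    have hg := lyapunov_gap hσ hσ2 hV hS.2.2.2.2.2.1 hw hy
    have hD := denom_pos hV hS.2.2.2.2.2.1 hw hy hσ hσ2
    have hD2 := denom_lt_two hV hS.2.2.2.2.2.1 hw hy hσ hσ2
    rw [← stateLyapunov_wonderlandState hγ hγ2, ← hr] at hg
    change _ ≤ gap S at hg
    have hN : 0 ≤ (S.1 0 0 - σ) ^ 2 + (4 - σ ^ 2) * ((S.1 0 1 ^ 2 + S.1 0 2 ^ 2) / 3
        + ((S.1 1 1 - S.1 2 2) ^ 2 / 2 + 2 * S.1 1 2 ^ 2) / 6) := by positivity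
    have hc : (2 + σ) / 16 ≤ (2 + σ) / (4 * (1 - σ * S.1 0 0 / 4) ^ 2) := by
      apply div_le_div_of_nonneg_left (by positivity) (by positivity)
      nlinarith
    refine ⟨hD, ?_, ?_⟩
    · have := mul_le_mul_of_nonneg_right hc hN
      have h2 : 0 ≤ 2 * (√(S.2.2 * (1 - σ * σ / 4) ^ 2
        / ((2 - σ) / 2 * (1 - σ * S.1 0 0 / 4) ^ 2)) - 1) ^ 2 := by positivity
      linarith
    · have h2 : 0 ≤ (2 + σ) / (4 * (1 - σ * S.1 0 0 / 4) ^ 2) * ((S.1 0 0 - σ) ^ 2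
        + (4 - σ ^ 2) * ((S.1 0 1 ^ 2 + S.1 0 2 ^ 2) / 3
        + ((S.1 1 1 - S.1 2 2) ^ 2 / 2 + 2 * S.1 1 2 ^ 2) / 6)) := by positivity
      linarith
  have hlim' : Tendsto (fun S => 16 / (2 + σ) * gap S) l (𝓝 0) := by
    simpa using hlim.const_mul (16 / (2 + σ))
  have hbound : ∀ S ∈ stateSpace, (S.1 0 0 - σ) ^ 2
      + (4 - σ ^ 2) * ((S.1 0 1 ^ 2 + S.1 0 2 ^ 2) / 3
        + ((S.1 1 1 - S.1 2 2) ^ 2 / 2 + 2 * S.1 1 2 ^ 2) / 6) ≤ 16 / (2 + σ) * gap S := by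
    intro S hS
    have := (key S hS).2.1
    rw [div_mul_eq_mul_div, le_div_iff₀ (by positivity)]
    linarith
  have hs : Tendsto (fun S : State => S.1 0 0) l (𝓝 σ) := by
    have : Tendsto (fun S : State => S.1 0 0 - σ) l (𝓝 0) := by
      refine tendsto_zero_of_sq_le ?_ hlim'
      filter_upwards [hmem] with S hS
      refine le_trans ?_ (hbound S hS)
      have : 0 ≤ (4 - σ ^ 2) * ((S.1 0 1 ^ 2 + S.1 0 2 ^ 2) / 3
        + ((S.1 1 1 - S.1 2 2) ^ 2 / 2 + 2 * S.1 1 2 ^ 2) / 6) := by positivity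
      linarith
    simpa using this.add_const σ
  have hlim'' : Tendsto (fun S => 6 / (4 - σ ^ 2) * (16 / (2 + σ) * gap S)) l (𝓝 0) := by
    simpa using hlim'.const_mul (6 / (4 - σ ^ 2))
  have hbound' : ∀ S ∈ stateSpace, 2 * (S.1 0 1 ^ 2 + S.1 0 2 ^ 2)
        + ((S.1 1 1 - S.1 2 2) ^ 2 / 2 + 2 * S.1 1 2 ^ 2)
        ≤ 6 / (4 - σ ^ 2) * (16 / (2 + σ) * gap S) := by
    intro S hS
    have := hbound S hS
    rw [div_mul_eq_mul_div, le_div_iff₀ h4]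
    nlinarith [sq_nonneg (S.1 0 0 - σ)]
  refine tendsto_wonderlandState hγ hγ2 hmem hs ?_ ?_ ?_
  · refine squeeze_zero' (Eventually.of_forall fun S => by positivity) ?_ hlim''
    filter_upwards [hmem] with S hS
    refine le_trans ?_ (hbound' S hS)
    simp only [id]
    have : 0 ≤ S.1 0 1 ^ 2 + S.1 0 2 ^ 2 := by positivity
    have : 0 ≤ (S.1 1 1 - S.1 2 2) ^ 2 / 2 + 2 * S.1 1 2 ^ 2 := by positivity
    linarith
  · refine squeeze_zero' (Eventually.of_forall fun S => by positivity) ?_ hlim''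
    filter_upwards [hmem] with S hS
    refine le_trans ?_ (hbound' S hS)
    simp only [id]
    have : 0 ≤ S.1 0 1 ^ 2 + S.1 0 2 ^ 2 := by positivity
    linarith
  · have hD0 : 1 - σ * σ / 4 ≠ 0 := by nlinarith
    have h2σ : 2 - σ ≠ 0 := by linarith
    have hB : Tendsto (fun S : State => √(S.2.2 * (1 - σ * σ / 4) ^ 2
        / ((2 - σ) / 2 * (1 - σ * S.1 0 0 / 4) ^ 2))) l (𝓝 1) := by
      have : Tendsto (fun S : State => √(S.2.2 * (1 - σ * σ / 4) ^ 2
        / ((2 - σ) / 2 * (1 - σ * S.1 0 0 / 4) ^ 2)) - 1) l (𝓝 0) := by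
        refine tendsto_zero_of_sq_le ?_ hlim
        filter_upwards [hmem] with S hS
        have := (key S hS).2.2
        nlinarith [sq_nonneg (√(S.2.2 * (1 - σ * σ / 4) ^ 2
          / ((2 - σ) / 2 * (1 - σ * S.1 0 0 / 4) ^ 2)) - 1)]
      simpa using this.add_const 1
    have hD : Tendsto (fun S : State => (2 - σ) / 2 * (1 - σ * S.1 0 0 / 4) ^ 2
        / (1 - σ * σ / 4) ^ 2) l (𝓝 ((2 - σ) / 2 * (1 - σ * σ / 4) ^ 2 / (1 - σ * σ / 4) ^ 2)) :=
      ((((hs.const_mul σ).div_const 4).const_sub 1).pow 2).const_mul ((2 - σ) / 2)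
        |>.div_const _
    refine (((hB.pow 2).mul hD).congr' ?_).trans_eq ?_
    · filter_upwards [hmem] with S hS
      have hD := (key S hS).1
      have hW := hS.2.2.2.2.2.1
      have : 0 < 2 - σ := by linarith
      have hD' : 4 - σ * S.1 0 0 ≠ 0 := by linarith
      rw [Real.sq_sqrt (by positivity)]
      simp only [id]
      field_simp
    · rw [one_pow, one_mul, mul_div_cancel_right₀ _ (pow_ne_zero 2 hD0)]

/-! ### Attraction and stability -/

section Attractor

variable {γ : ℝ} {M : Model} {a : ℝ}

lemma stateLyapunov_state (h : IsEvolution γ M (Ioi a)) {t : ℝ} (ht : a < t)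
    (hH : 0 < M.hubble t) {E : Matrix (Fin 3) (Fin 3) ℝ} (hE : IsAlignedFrame M t E) (σ : ℝ) :
    stateLyapunov σ (M.state t E) = lyapunov σ (M.shear t) (M.vSq t) (M.omega t) := by
  have hr := isReadOff_state h isOpen_Ioi (mem_Ioi.2 ht) hH hE
  rw [stateLyapunov, hr.shear, hr.vSq, hr.omega]

lemma spatialField_ne_zero (h : IsEvolution γ M (Ioi a)) {t : ℝ} (ht : a < t) (hJ : M.J t ≠ 0) :
    M.spatialField t ≠ 0 := by
  intro h0
  apply hJ
  ext μ
  induction μ using Fin.cases with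
  | zero => exact h.spatial t ht
  | succ i => exact congrFun h0 i

lemma IsAlignedFrame.spatialField_ne_zero {t : ℝ} {E : Matrix (Fin 3) (Fin 3) ℝ}
    (hE : IsAlignedFrame M t E) : M.spatialField t ≠ 0 := by
  intro h0
  have h1 := hE.pos
  rw [show M.frameField t E = M.spatialField t ᵥ* E from rfl, h0] at h1
  simp at h1

theorem tendsto_state (hγ : 2 / 3 < γ) (hγ' : γ ≤ 6 / 5) (h : IsEvolution γ M (Ioi a)) {t₀ : ℝ}
    (ht₀ : a < t₀) (hH : 0 < M.hubble t₀) (hρ : 0 < M.ρ t₀) (hJ : M.J t₀ ≠ 0)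
    {E : ℝ → Matrix (Fin 3) (Fin 3) ℝ} (hE : ∀ t > a, IsAlignedFrame M t (E t)) :
    Tendsto (fun t => M.state t (E t)) atTop (𝓝 (wonderlandState γ)) := by
  have hJ' := spatialField_ne_zero h ht₀ hJ
  have hflow := isReducedFlow h ht₀ hH hρ hJ'
  obtain ⟨hs, hw, hy, hW⟩ := hflow.tendsto (by linarith) (by linarith)
  have hev : ∀ᶠ t in atTop, a < t := eventually_gt_atTop a
  have hr : ∀ t > a, IsReadOff (M.state t (E t)) (M.shear t) (M.tilt t) (M.coupling t)
      (M.vSq t) (M.omega t) := fun t ht =>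
    isReadOff_state h isOpen_Ioi ht (hflow.H_pos t ht) (hE t ht)
  refine tendsto_wonderlandState hγ (by linarith) ?_ (hs.congr' ?_) (hw.congr' ?_) (hy.congr' ?_)
    (hW.congr' ?_)
  · filter_upwards [hev] with t ht
    exact state_mem_stateSpace h isOpen_Ioi ht (hflow.H_pos t ht) (hE t ht) (ρ_pos h ht₀ hρ ht)
  · filter_upwards [hev] with t ht using (hr t ht).shear.symm
  · filter_upwards [hev] with t ht using (hr t ht).tilt.symm
  · filter_upwards [hev] with t ht using (hr t ht).transverse.symm
  · filter_upwards [hev] with t ht using (hr t ht).omega.symm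

theorem wonderlandState_stable (hγ : 2 / 3 < γ) (hγ' : γ ≤ 6 / 5) {U : Set State}
    (hU : U ∈ 𝓝 (wonderlandState γ)) :
    ∃ U₀ ∈ 𝓝 (wonderlandState γ), ∀ (a : ℝ) (M : Model), IsSolution γ M (Ioi a) → ∀ t₀ > a,
      0 < M.hubble t₀ → 0 < M.ρ t₀ →
      ∀ E₀, IsAlignedFrame M t₀ E₀ → M.state t₀ E₀ ∈ U₀ →
        ∀ t ≥ t₀, ∀ E, IsAlignedFrame M t E → M.state t E ∈ U := by
  set σ := (3 * γ - 2) / 2 with hσdef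
  have hσ : 0 < σ := by rw [hσdef]; linarith
  have hσ' : σ ≤ 4 / 5 := by rw [hσdef]; linarith
  set m := stateLyapunov σ (wonderlandState γ) with hm
  obtain ⟨N, hN, hNU⟩ : ∃ N ∈ 𝓝 m, ∀ S ∈ stateSpace, stateLyapunov σ S ∈ N → S ∈ U := by
    have h1 := tendsto_comap_stateLyapunov hγ (by linarith) hU
    rw [mem_map, preimage_id, mem_inf_principal] at h1
    obtain ⟨N, hN, hsub⟩ := h1
    exact ⟨N, hN, fun S hS hSN => hsub hSN hS⟩
  obtain ⟨ε, hε, hball⟩ := Metric.mem_nhds_iff.1 hN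
  refine ⟨stateLyapunov σ ⁻¹' Ioi (m - ε),
    (continuousAt_stateLyapunov hγ (by linarith)).preimage_mem_nhds
      (Ioi_mem_nhds (by linarith)), ?_⟩
  intro a M hM t₀ ht₀ hH hρ E₀ hE₀ hmem t ht E hE
  have h := (isSolution_iff_isEvolution γ isOpen_Ioi).1 hM
  have hta : a < t := lt_of_lt_of_le ht₀ ht
  have hflow := isReducedFlow h ht₀ hH hρ hE₀.spatialField_ne_zero
  have hHt := hflow.H_pos t hta
  refine hNU _ (state_mem_stateSpace h isOpen_Ioi hta hHt hE (ρ_pos h ht₀ hρ hta)) (hball ?_)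
  have h1 := hflow.lyapunov_mono hσ hσ' ht₀ ht
  have h2 : lyapunov σ (M.shear t) (M.vSq t) (M.omega t) ≤ m := by
    have hy := hflow.y_nonneg t hta
    have hw := hflow.w_nonneg t hta
    have hg := lyapunov_gap hσ (by linarith) (hflow.V_pos t hta) (hflow.W_pos t hta) hw hy
    have h4 : 0 ≤ 4 - σ ^ 2 := by nlinarith
    rw [← stateLyapunov_wonderlandState hγ (by linarith), ← hm] at hg
    have := le_trans (by positivity) hg
    linarith
  rw [mem_preimage, mem_Ioi, stateLyapunov_state h ht₀ hH hE₀] at hmem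
  rw [Metric.mem_ball, Real.dist_eq, stateLyapunov_state h hta hHt hE, abs_lt]
  constructor <;> linarith

end Attractor

/-! ### The Wonderland geometry -/

/-- The common exponent of the two transverse scale factors. -/
def transverseExponent (γ : ℝ) : ℝ := (2 - γ) / (2 * γ)

lemma wonderlandMetric_eq {γ : ℝ} (hγ : 0 < γ) (t : ℝ) : wonderlandMetric γ t
    = Matrix.diagonal ![t ^ 2, t ^ (2 * transverseExponent γ), t ^ (2 * transverseExponent γ)] := by
  have : (2 - γ) / γ = 2 * transverseExponent γ := by
    rw [transverseExponent]; field_simp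
  rw [wonderlandMetric, this]

lemma wonderlandMetric_posDef (γ : ℝ) {t : ℝ} (ht : 0 < t) : (wonderlandMetric γ t).PosDef := by
  rw [wonderlandMetric, Matrix.posDef_diagonal_iff]
  intro i
  fin_cases i <;> simp <;> positivity

lemma diagonal_three_apply (f : ℝ → Fin 3 → ℝ) (i j : Fin 3) :
    (fun t => Matrix.diagonal (f t) i j) = if i = j then fun t => f t i else fun _ => 0 := by
  funext t
  by_cases h : i = j <;> simp [h]

section Metric

variable {γ : ℝ} (hγ : 0 < γ) {M : Model} (hM : M.g = wonderlandMetric γ) {t : ℝ} (ht : 0 < t)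
include hγ hM ht

lemma wonderland_expansion : M.expansion t = Matrix.diagonal
    ![t, transverseExponent γ * t ^ (2 * transverseExponent γ) / t,
      transverseExponent γ * t ^ (2 * transverseExponent γ) / t] := by
  set β := transverseExponent γ with hβ
  have hd : ∀ i, HasDerivAt (fun s : ℝ => (![s ^ 2, s ^ (2 * β), s ^ (2 * β)] : Fin 3 → ℝ) i)
      (2 * (![t, β * t ^ (2 * β) / t, β * t ^ (2 * β) / t] : Fin 3 → ℝ) i) t := by
    have h1 : HasDerivAt (fun s : ℝ => s ^ (2 * β)) (2 * (β * t ^ (2 * β) / t)) t := by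
      refine (Real.hasDerivAt_rpow_const (Or.inl ht.ne')).congr_deriv ?_
      rw [Real.rpow_sub_one ht.ne']
      ring
    intro i
    fin_cases i
    · simpa using hasDerivAt_pow 2 t
    · exact h1
    · exact h1
  ext i j
  simp only [Model.expansion, Matrix.of_apply, hM, wonderlandMetric_eq hγ, ← hβ]
  rw [diagonal_three_apply]
  by_cases hij : i = j
  · subst hij
    rw [if_pos rfl, (hd i).deriv, Matrix.diagonal_apply_eq]
    ring
  · rw [if_neg hij, Matrix.diagonal_apply_ne _ hij]
    simp

lemma wonderland_inv : (M.g t)⁻¹ = Matrix.diagonal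
    ![(t ^ 2)⁻¹, (t ^ (2 * transverseExponent γ))⁻¹, (t ^ (2 * transverseExponent γ))⁻¹] := by
  have hu : 0 < t ^ (2 * transverseExponent γ) := by positivity
  apply Matrix.inv_eq_right_inv
  rw [hM, wonderlandMetric_eq hγ, Matrix.diagonal_mul_diagonal, ← Matrix.diagonal_one]
  congr 1
  funext i
  fin_cases i <;> simp [ht.ne', hu.ne']

lemma wonderland_mixed : M.mixed t = Matrix.diagonal
    ![1 / t, transverseExponent γ / t, transverseExponent γ / t] := by
  have hu : 0 < t ^ (2 * transverseExponent γ) := by positivity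
  rw [Model.mixed, wonderland_inv hγ hM ht, wonderland_expansion hγ hM ht,
    Matrix.diagonal_mul_diagonal]
  congr 1
  funext i
  fin_cases i <;> simp <;> field_simp

lemma wonderland_trace : (M.mixed t).trace = 2 / γ / t := by
  rw [wonderland_mixed hγ hM ht, Matrix.trace_fin_three]
  simp only [Matrix.diagonal_apply_eq, transverseExponent]
  simp
  field_simp
  ring

lemma wonderland_hubble : M.hubble t = 2 / (3 * γ) / t := by
  rw [Model.hubble_eq, wonderland_trace hγ hM ht]
  field_simp

lemma wonderland_hasEntryDeriv_mixed : HasEntryDeriv M.mixed (-(1 / t) • M.mixed t) t := by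
  intro i j
  have hev : (fun s => M.mixed s i j) =ᶠ[𝓝 t] fun s => Matrix.diagonal
      (fun k => (![1, transverseExponent γ, transverseExponent γ] : Fin 3 → ℝ) k / s) i j := by
    filter_upwards [lt_mem_nhds ht] with s hs
    rw [wonderland_mixed hγ hM hs]
    congr 2
    funext k
    fin_cases k <;> rfl
  refine HasDerivAt.congr_of_eventuallyEq ?_ hev
  have h0 : M.mixed t i j = Matrix.diagonal
      (fun k => (![1, transverseExponent γ, transverseExponent γ] : Fin 3 → ℝ) k / t) i j :=
    hev.eq_of_nhds
  rw [Matrix.smul_apply, h0, diagonal_three_apply]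
  by_cases hij : i = j
  · subst hij
    rw [if_pos rfl, Matrix.diagonal_apply_eq]
    refine ((hasDerivAt_const t _).div (hasDerivAt_id t) ht.ne').congr_deriv ?_
    simp only [id, smul_eq_mul]
    field_simp
    ring
  · rw [if_neg hij, Matrix.diagonal_apply_ne _ hij, smul_zero]
    exact hasDerivAt_const _ _

end Metric

section Solution

variable {γ : ℝ} (hγ : 0 < γ) {M : Model} (hM : IsWonderland γ M) {t : ℝ} (ht : 0 < t)
include hγ hM ht

lemma wonderland_mixed_eq : -(1 / t) • M.mixed t = -(M.mixed t).trace • M.mixed t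
      + Matrix.vecMulVec ((M.g t)⁻¹ *ᵥ M.spatialField t) (M.spatialField t)
      + ((2 - γ) / 2 * M.ρ t) • (1 : Matrix (Fin 3) (Fin 3) ℝ) := by
  have h := (isSolution_iff_isEvolution γ isOpen_Ioi).1 hM.solution
  ext i j
  exact (wonderland_hasEntryDeriv_mixed hγ hM.metric_eq ht i j).unique
    (h.hasEntryDeriv_mixed isOpen_Ioi ht i j)

lemma wonderland_matter : M.spatialField t 1 = 0 ∧ M.spatialField t 2 = 0 ∧
    M.spatialField t 0 ^ 2 = 2 * transverseExponent γ * (1 - transverseExponent γ) ∧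
    (2 - γ) / 2 * M.ρ t = 2 * transverseExponent γ ^ 2 / t ^ 2 := by
  have hu : 0 < t ^ (2 * transverseExponent γ) := by positivity
  have he := wonderland_mixed_eq hγ hM ht
  rw [wonderland_trace hγ hM.metric_eq ht, wonderland_mixed hγ hM.metric_eq ht,
    wonderland_inv hγ hM.metric_eq ht] at he
  have e := fun i j => congrFun (congrFun he i) j
  simp only [Matrix.add_apply, Matrix.smul_apply, Matrix.vecMulVec_apply, Matrix.mulVec_diagonal,
    smul_eq_mul] at e
  have e12 := e 1 2
  have e11 := e 1 1
  have e22 := e 2 2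
  have e00 := e 0 0
  simp only [Matrix.diagonal_apply_eq, Matrix.one_apply_eq, Matrix.cons_val_zero,
    Matrix.cons_val_one, Matrix.cons_val] at e00 e11 e22
  simp only [Fin.isValue, ne_eq, Fin.reduceEq, not_false_eq_true, Matrix.diagonal_apply_ne,
    mul_zero, Matrix.cons_val_one, zero_add, Matrix.one_apply_ne, add_zero] at e12
  have hγβ : 2 / γ = 1 + 2 * transverseExponent γ := by
    rw [transverseExponent]; field_simp; ring
  set u := t ^ (2 * transverseExponent γ)
  set β := transverseExponent γ
  have h12 : M.spatialField t 1 * M.spatialField t 2 = 0 := by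
    have : u⁻¹ * (M.spatialField t 1 * M.spatialField t 2) = 0 := by
      rw [← mul_assoc]; exact e12.symm
    exact (mul_eq_zero.1 this).resolve_left (by positivity)
  have hsq : M.spatialField t 1 ^ 2 = M.spatialField t 2 ^ 2 := by
    have : u⁻¹ * (M.spatialField t 1 ^ 2 - M.spatialField t 2 ^ 2) = 0 := by
      linear_combination e22 - e11
    exact sub_eq_zero.1 ((mul_eq_zero.1 this).resolve_left (by positivity))
  have h1 : M.spatialField t 1 = 0 := by
    rcases mul_eq_zero.1 h12 with h | h
    · exact h
    · rw [h] at hsq; simpa using hsq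
  have h2 : M.spatialField t 2 = 0 := by
    rw [h1] at hsq; simpa using hsq.symm
  have hρ : (2 - γ) / 2 * M.ρ t = 2 * β ^ 2 / t ^ 2 := by
    rw [h1, hγβ, mul_zero, add_zero] at e11
    field_simp at e11 ⊢
    linear_combination -e11
  refine ⟨h1, h2, ?_, hρ⟩
  rw [hρ, hγβ] at e00
  field_simp at e00
  linear_combination -e00

omit ht in
lemma range_of_isWonderland : 2 / 3 < γ ∧ γ < 2 := by
  obtain ⟨h1, h2, h0, hρ⟩ := wonderland_matter hγ hM one_pos
  have hpos := hM.fluid_pos 1 one_pos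
  have hJ : M.spatialField 1 0 ≠ 0 := by
    intro h
    apply hM.field_ne 1 one_pos
    ext μ
    induction μ using Fin.cases with
    | zero => exact hM.solution.spatial 1 (mem_Ioi.2 one_pos)
    | succ i =>
      fin_cases i
      exacts [h, h1, h2]
  have hJ2 : 0 < M.spatialField 1 0 ^ 2 := by positivity
  have hβ : 2 * γ * transverseExponent γ = 2 - γ := by rw [transverseExponent]; field_simp
  rw [h0] at hJ2
  have hβ0 : transverseExponent γ ≠ 0 := by
    intro h; simp [h] at hJ2
  have h2γ : 0 < 2 - γ := by
    have : 0 < (2 - γ) / 2 * M.ρ 1 := by rw [hρ]; positivity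
    linarith [pos_of_mul_pos_left this hpos.le]
  have hβpos : 0 < transverseExponent γ := by rw [transverseExponent]; positivity
  have hβ1 : 0 < 1 - transverseExponent γ :=
    pos_of_mul_pos_right hJ2 (by positivity)
  constructor
  · nlinarith
  · linarith

end Solution

/-! ### Existence of Wonderland -/

/-- The fields of Wonderland. -/
def wonderlandModel (γ : ℝ) : Model where
  g := wonderlandMetric γ
  ρ := fun t => (2 - γ) / (γ ^ 2 * t ^ 2)
  J := fun _ =>
    Pi.single 1 (Real.sqrt (2 * transverseExponent γ * (1 - transverseExponent γ)))

lemma two_div_eq {γ : ℝ} (hγ : 0 < γ) : 2 / γ = 1 + 2 * transverseExponent γ := by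
  rw [transverseExponent]; field_simp; ring

lemma eq_two_div {γ : ℝ} (hγ : 0 < γ) : γ = 2 / (1 + 2 * transverseExponent γ) := by
  rw [← two_div_eq hγ]; field_simp

lemma transverseExponent_pos {γ : ℝ} (hγ : 2 / 3 < γ) (hγ' : γ < 2) :
    0 < transverseExponent γ := by
  have : 0 < 2 - γ := by linarith
  rw [transverseExponent]
  positivity

lemma transverseExponent_lt_one {γ : ℝ} (hγ : 2 / 3 < γ) : transverseExponent γ < 1 := by
  rw [transverseExponent, div_lt_one (by linarith)]
  linarith

lemma wonderlandModel_spatialField (γ t : ℝ) : (wonderlandModel γ).spatialField t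
    = Pi.single 0 (Real.sqrt (2 * transverseExponent γ * (1 - transverseExponent γ))) := by
  funext i
  fin_cases i <;> rfl

lemma wonderlandModel_isEvolution {γ : ℝ} (hγ : 2 / 3 < γ) (hγ' : γ < 2) :
    IsEvolution γ (wonderlandModel γ) (Ioi 0) := by
  have h0 : 0 < γ := by linarith
  have hβ := transverseExponent_pos hγ hγ'
  have hβ' := transverseExponent_lt_one hγ
  have hγβ := eq_two_div h0
  have hM : (wonderlandModel γ).g = wonderlandMetric γ := rfl
  have hj : Real.sqrt (2 * transverseExponent γ * (1 - transverseExponent γ)) ^ 2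
      = 2 * transverseExponent γ * (1 - transverseExponent γ) :=
    Real.sq_sqrt (mul_nonneg (by positivity) (by linarith))
  have hrpow : ∀ a : ℝ, ContDiffOn ℝ 2 (fun t : ℝ => t ^ a) (Ioi 0) := fun a t ht =>
    (Real.contDiffAt_rpow_const_of_ne (ne_of_gt ht)).contDiffWithinAt
  refine ⟨fun t ht => wonderlandMetric_posDef γ ht, fun i j => ?_, ?_, fun μ => contDiffOn_const,
    fun t ht => rfl, fun t ht i j => ?_, fun t ht => ?_, fun t ht => ?_, fun t ht i => ?_⟩
  · rw [hM]
    simp only [wonderlandMetric]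
    rw [diagonal_three_apply]
    split_ifs
    · fin_cases i
      · exact contDiffOn_id.pow 2
      · exact hrpow _
      · exact hrpow _
    · exact contDiffOn_const
  · refine contDiffOn_const.div (contDiffOn_const.mul (contDiffOn_id.pow 2)) fun t ht => ?_
    have : 0 < t := ht
    positivity
  · have ht' : 0 < t := ht
    set β := transverseExponent γ with hβdef
    have hu : 0 < t ^ (2 * β) := by positivity
    have hd : ∀ i, HasDerivAt (fun s : ℝ =>
        (![s, β * s ^ (2 * β) / s, β * s ^ (2 * β) / s] : Fin 3 → ℝ) i)
        ((![1, (2 * β - 1) * β * t ^ (2 * β) / t ^ 2, (2 * β - 1) * β * t ^ (2 * β) / t ^ 2]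
          : Fin 3 → ℝ) i) t := by
      have h1 : HasDerivAt (fun s : ℝ => β * s ^ (2 * β) / s)
          ((2 * β - 1) * β * t ^ (2 * β) / t ^ 2) t := by
        refine (((Real.hasDerivAt_rpow_const (p := 2 * β) (Or.inl ht'.ne')).const_mul β).div
          (hasDerivAt_id t) ht'.ne').congr_deriv ?_
        rw [Real.rpow_sub_one ht'.ne']
        simp only [id]
        field_simp
      intro i
      fin_cases i
      exacts [hasDerivAt_id t, h1, h1]
    have hev : (fun s => (wonderlandModel γ).expansion s i j) =ᶠ[𝓝 t] fun s => Matrix.diagonal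
        ![s, β * s ^ (2 * β) / s, β * s ^ (2 * β) / s] i j := by
      filter_upwards [lt_mem_nhds ht'] with s hs
      rw [wonderland_expansion h0 hM hs]
    rw [hev.deriv_eq, diagonal_three_apply, wonderland_expansion h0 hM ht',
      wonderland_mixed h0 hM ht', Matrix.diagonal_mul_diagonal, Matrix.trace_diagonal, hM,
      wonderlandMetric_eq h0, ← hβdef, wonderlandModel_spatialField, ← hβdef, Fin.sum_univ_three]
    simp only [wonderlandModel]
    by_cases hij : i = j
    · subst hij
      rw [if_pos rfl, (hd i).deriv]
      simp only [Matrix.diagonal_apply_eq, hγβ]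
      fin_cases i
      · simp
        field_simp
        linear_combination -2 * hj
      · simp
        field_simp
        ring
      · simp
        field_simp
        ring
    · rw [if_neg hij]
      have hz : ∀ r : ℝ, (Pi.single 0 r : Fin 3 → ℝ) i * (Pi.single 0 r : Fin 3 → ℝ) j = 0 := by
        intro r
        rcases eq_or_ne i 0 with rfl | hi
        · simp [Pi.single_eq_of_ne (Ne.symm hij)]
        · simp [hi]
      simp only [Matrix.diagonal_apply_ne _ hij, deriv_const, hz]
      ring
  · have ht' : 0 < t := ht
    have h1 : ∀ i, deriv (fun s => (wonderlandModel γ).mixed s i i) t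
        = (-(1 / t) • (wonderlandModel γ).mixed t) i i := fun i =>
      (wonderland_hasEntryDeriv_mixed h0 hM ht' i i).deriv
    simp only [h1]
    rw [wonderland_mixed h0 hM ht', Matrix.diagonal_mul_diagonal, Matrix.trace_diagonal]
    simp only [wonderlandModel, Fin.sum_univ_three, Matrix.smul_apply, Matrix.diagonal_apply_eq]
    set β := transverseExponent γ
    rw [hγβ]
    simp
    field_simp
    ring
  · have ht' : 0 < t := ht
    rw [wonderland_trace h0 hM ht']
    simp only [wonderlandModel]
    have : HasDerivAt (fun s : ℝ => (2 - γ) / (γ ^ 2 * s ^ 2))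
        (-(2 * ((2 - γ) / (γ ^ 2 * t ^ 3)))) t := by
      refine ((hasDerivAt_const t (2 - γ)).div ((hasDerivAt_pow 2 t).const_mul (γ ^ 2))
        (by positivity)).congr_deriv ?_
      push_cast
      field_simp
      ring
    rw [this.deriv]
    field_simp
  · simp [wonderlandModel]

lemma wonderlandModel_isWonderland {γ : ℝ} (hγ : 2 / 3 < γ) (hγ' : γ < 2) :
    IsWonderland γ (wonderlandModel γ) where
  metric_eq := rfl
  solution := (isSolution_iff_isEvolution γ isOpen_Ioi).2 (wonderlandModel_isEvolution hγ hγ')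
  fluid_pos t ht := by
    have : 0 < 2 - γ := by linarith
    simp only [wonderlandModel]
    positivity
  field_ne t ht h := by
    have h1 := congrFun h 1
    have hβ := transverseExponent_pos hγ hγ'
    have hβ' : 0 < 1 - transverseExponent γ := by linarith [transverseExponent_lt_one hγ]
    simp only [wonderlandModel, Pi.single_eq_same, Pi.zero_apply] at h1
    exact (Real.sqrt_pos.2 (by positivity)).ne' h1

theorem exists_isWonderland_iff {γ : ℝ} (hγ : 0 < γ) :
    (∃ M : Model, IsWonderland γ M) ↔ 2 / 3 < γ ∧ γ < 2 :=
  ⟨fun ⟨_, hM⟩ => range_of_isWonderland hγ hM,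
    fun h => ⟨_, wonderlandModel_isWonderland h.1 h.2⟩⟩

/-! ### The Wonderland state -/

theorem wonderlandState_mem {γ : ℝ} (hγ : 2 / 3 < γ) (hγ' : γ < 2) :
    wonderlandState γ ∈ stateSpace := by
  have h1 : 0 < 2 - γ := by linarith
  have h2 : 0 < 3 * γ - 2 := by linarith
  have h3 : 0 < 3 * (2 - γ) * (3 * γ - 2) := by positivity
  refine ⟨by simp [wonderlandState], ?_, ?_, rfl, rfl, ?_, ?_⟩
  · simp [wonderlandState, Fin.sum_univ_three]
    ring
  · simp only [wonderlandState, Matrix.cons_val_zero]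
    positivity
  · simp only [wonderlandState]
    positivity
  · simp only [wonderlandState, Matrix.diagonal_mul_diagonal, Matrix.trace_diagonal,
      Fin.sum_univ_three, Matrix.cons_val_zero, Matrix.cons_val_one, Matrix.cons_val, div_pow,
      Real.sq_sqrt h3.le]
    ring

lemma wonderlandState_prolate {γ : ℝ} (hγ : 2 / 3 < γ) :
    (wonderlandState γ).1 1 1 < (wonderlandState γ).1 0 0 := by
  simp only [wonderlandState, Matrix.diagonal_apply_eq, Matrix.cons_val_zero, Matrix.cons_val_one]
  linarith

lemma continuous_wonderlandState : Continuous wonderlandState := by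
  unfold wonderlandState
  refine Continuous.prodMk (Continuous.matrix_diagonal (continuous_pi fun i => ?_))
    (Continuous.prodMk (continuous_pi fun i => ?_) (by fun_prop))
  · fin_cases i <;> simp <;> fun_prop
  · fin_cases i <;> simp <;> fun_prop

theorem tendsto_wonderlandState_flrw :
    Tendsto wonderlandState (𝓝[>] (2 / 3)) (𝓝 flrwState) := by
  have : wonderlandState (2 / 3) = flrwState := by
    simp only [wonderlandState, flrwState]
    refine Prod.ext ?_ (Prod.ext ?_ ?_)
    · ext i j
      fin_cases i <;> fin_cases j <;> norm_num
    · funext i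
      fin_cases i <;> norm_num
    · norm_num
  rw [← this]
  exact continuous_wonderlandState.continuousAt.continuousWithinAt

theorem tendsto_wonderlandState_kasner :
    Tendsto wonderlandState (𝓝[<] 2) (𝓝 kasnerState) := by
  have : wonderlandState 2 = kasnerState := by
    simp only [wonderlandState, kasnerState]
    refine Prod.ext ?_ (Prod.ext ?_ ?_)
    · ext i j
      fin_cases i <;> fin_cases j <;> norm_num
    · funext i
      fin_cases i <;> norm_num
    · norm_num
  rw [← this]
  exact continuous_wonderlandState.continuousAt.continuousWithinAt

/-! ### Symmetries and kinematics of Wonderland -/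

section Properties

variable {γ : ℝ} (hγ : 0 < γ) {M : Model} (hM : IsWonderland γ M)
include hγ hM

lemma wonderland_spatialField {t : ℝ} (ht : 0 < t) :
    M.spatialField t = Pi.single 0 (M.spatialField t 0) := by
  obtain ⟨h1, h2, -, -⟩ := wonderland_matter hγ hM ht
  funext i
  fin_cases i <;> simp [h1, h2]

lemma wonderland_field {t : ℝ} (ht : 0 < t) : M.J t = Pi.single 1 (M.J t 1) := by
  obtain ⟨h1, h2, -, -⟩ := wonderland_matter hγ hM ht
  funext μ
  induction μ using Fin.cases with
  | zero => simpa using hM.solution.spatial t ht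
  | succ i =>
    fin_cases i
    · simp
    · exact h1
    · exact h2

lemma wonderland_isLRSAboutX : IsLRSAboutX M (Ioi 0) := by
  intro φ x hx
  have hx' : 0 < x 0 := hx
  have h0 : (rotX φ *ᵥ x) 0 = x 0 := by
    simp [rotX, Matrix.mulVec, dotProduct, Fin.sum_univ_four]
  have hJ := wonderland_field hγ hM hx'
  have hcs := Real.sin_sq_add_cos_sq φ
  constructor
  · have hm : ∀ y : Point, M.metric y = Matrix.diagonal
        ![-1, y 0 ^ 2, y 0 ^ ((2 - γ) / γ), y 0 ^ ((2 - γ) / γ)] := by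
      intro y
      simp only [metric_eq_block, hM.metric_eq, wonderlandMetric]
      ext μ ν
      fin_cases μ <;> fin_cases ν <;> rfl
    rw [hm, hm, h0]
    generalize x 0 ^ ((2 - γ) / γ) = u
    ext μ ν
    fin_cases μ <;> fin_cases ν <;>
      simp [rotX, Matrix.mul_apply, Fin.sum_univ_four, Matrix.diagonal] <;>
      first | linear_combination u * hcs | ring
  · simp only [Model.field, h0]
    rw [hJ]
    generalize M.J (x 0) 1 = j
    funext μ
    fin_cases μ <;> simp [rotX, Matrix.vecMul, dotProduct, Fin.sum_univ_four]

lemma wonderland_deceleration {t : ℝ} (ht : 0 < t) : M.deceleration t = 3 * γ / 2 - 1 := by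
  have hev : M.hubble =ᶠ[𝓝 t] fun s => 2 / (3 * γ) / s := by
    filter_upwards [lt_mem_nhds ht] with s hs using wonderland_hubble hγ hM.metric_eq hs
  have hd : HasDerivAt (fun s : ℝ => 2 / (3 * γ) / s) (-(2 / (3 * γ) / t ^ 2)) t := by
    refine ((hasDerivAt_const t _).div (hasDerivAt_id t) ht.ne').congr_deriv ?_
    simp only [id]
    field_simp
    ring
  rw [Model.deceleration, hev.deriv_eq, hd.deriv, wonderland_hubble hγ hM.metric_eq ht]
  field_simp
  ring

lemma wonderland_isSelfSimilar : IsSelfSimilar M (Ioi 0) := by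
  set β := transverseExponent γ with hβ
  set c : Fin 3 → ℝ := ![0, 1 - β, 1 - β] with hc
  refine ⟨fun x => Fin.cases (x 0) fun i => c i * x i.succ, ?_, 1, one_ne_zero, fun x hx => ?_⟩
  · rw [contDiffOn_pi]
    intro μ
    refine ContDiff.contDiffOn ?_
    induction μ using Fin.cases with
    | zero => exact contDiff_apply ℝ ℝ (0 : Fin 4)
    | succ i => exact contDiff_const.mul (contDiff_apply ℝ ℝ i.succ)
  have hx' : 0 < x 0 := hx
  refine ⟨hx'.ne', ?_⟩
  have p00 : pd 0 (fun y : Point => y 0) x = 1 := by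
    rw [pd_zero_comp (fun t => t)]; simp
  have pi0 : ∀ i : Fin 3, pd i.succ (fun y : Point => y 0) x = 0 := fun i =>
    pd_succ_comp (fun t => t) x i
  have pj : ∀ (μ : Fin 4) (j : Fin 3), pd μ (fun y : Point => c j * y j.succ) x
      = c j * (Pi.single μ 1 : Fin 4 → ℝ) j.succ := by
    intro μ j
    have : (fun t : ℝ => c j * (x + t • (Pi.single μ 1 : Fin 4 → ℝ)) j.succ)
        = fun t => c j * x j.succ + t * (c j * (Pi.single μ 1 : Fin 4 → ℝ) j.succ) := by
      funext t
      simp only [Pi.add_apply, Pi.smul_apply, smul_eq_mul]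
      ring
    rw [pd, lineDeriv, this]
    simp
  apply matrix_four_ext
  · simp [lieDeriv, sum_fin_four, p00, pj, metric_eq_block]
    norm_num
  · intro j
    simp [lieDeriv, sum_fin_four, p00, pi0, pj, metric_eq_block]
  · intro j
    simp [lieDeriv, sum_fin_four, p00, pi0, pj, metric_eq_block]
  · intro i j
    have hmain : 2 * (x 0 * M.expansion (x 0) i j) + M.g (x 0) i j * c i + M.g (x 0) i j * c j
        = 2 * M.g (x 0) i j := by
      rw [wonderland_expansion hγ hM.metric_eq hx', hM.metric_eq, wonderlandMetric_eq hγ, ← hβ]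
      have : 0 < x 0 ^ (2 * β) := by positivity
      by_cases hij : i = j
      · subst hij
        simp only [Matrix.diagonal_apply_eq]
        fin_cases i <;> simp [hc] <;> field_simp <;> ring
      · simp [Matrix.diagonal_apply_ne _ hij]
    have : (lieDeriv (fun x => Fin.cases (x 0) fun i => c i * x i.succ) M.metric x) i.succ j.succ
        = 2 * (x 0 * M.expansion (x 0) i j) + M.g (x 0) i j * c i + M.g (x 0) i j * c j := by
      simp only [lieDeriv, Matrix.of_apply, sum_fin_four, pd_zero_metric_succ, pd_succ_metric]
      simp only [Fin.cases_zero, Fin.cases_succ, pi0, pj, metric_eq_block, block_zero_succ,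
        block_succ_zero, block_succ_succ, Pi.single_apply, Fin.succ_inj, mul_ite, mul_one,
        mul_zero, zero_add, add_zero, Finset.sum_add_distrib, Finset.sum_ite_eq',
        Finset.mem_univ, if_true]
      ring
    rw [this, hmain]
    simp [metric_eq_block]

lemma wonderland_state {t : ℝ} (ht : 0 < t) {E : Matrix (Fin 3) (Fin 3) ℝ}
    (hE : IsAlignedFrame M t E) : M.state t E = wonderlandState γ := by
  obtain ⟨hγ1, hγ2⟩ := range_of_isWonderland hγ hM
  obtain ⟨h1, h2, h0, hρ⟩ := wonderland_matter hγ hM ht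
  have hβ := transverseExponent_pos hγ1 hγ2
  have hβ' : 0 < 1 - transverseExponent γ := by linarith [transverseExponent_lt_one hγ1]
  have hγβ := eq_two_div hγ
  have hf := wonderland_spatialField hγ hM ht
  have hH := wonderland_hubble hγ hM.metric_eq ht
  have hmom : M.frameField t E 0 ^ 2 = M.spatialField t 0 ^ 2 / t ^ 2 := by
    have := hE.moment_eq 0
    rw [pow_zero, Matrix.one_apply_eq, mul_one, M.moment_zero, Model.fieldSq,
      wonderland_inv hγ hM.metric_eq ht, hf] at this
    rw [← this]
    simp [dotProduct, Matrix.mulVec_diagonal, Fin.sum_univ_three]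
    field_simp
  have hθ : M.expansion t = (transverseExponent γ / t) • M.g t
      + ((1 - transverseExponent γ) * t / M.spatialField t 0 ^ 2) •
        Matrix.vecMulVec (M.spatialField t) (M.spatialField t) := by
    have hne : M.spatialField t 0 ≠ 0 := by
      intro h; rw [h] at h0
      have : 0 < 2 * transverseExponent γ * (1 - transverseExponent γ) := by positivity
      rw [← h0] at this
      simp at this
    rw [wonderland_expansion hγ hM.metric_eq ht, hM.metric_eq, wonderlandMetric_eq hγ, hf]
    ext i j
    simp only [Matrix.add_apply, Matrix.smul_apply, Matrix.vecMulVec_apply]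
    fin_cases i <;> fin_cases j <;> simp <;> field_simp
    ring
  have hframe : Eᵀ * M.expansion t * E = (transverseExponent γ / t) • (1 : Matrix _ _ ℝ)
      + ((1 - transverseExponent γ) * t / M.spatialField t 0 ^ 2) •
        Matrix.vecMulVec (M.frameField t E) (M.frameField t E) := by
    have hv : Eᵀ * Matrix.vecMulVec (M.spatialField t) (M.spatialField t) * E
        = Matrix.vecMulVec (M.frameField t E) (M.frameField t E) := by
      rw [Matrix.mul_vecMulVec, Matrix.vecMulVec_mul, Matrix.mulVec_transpose]
      rfl
    rw [hθ, Matrix.mul_add, Matrix.add_mul, Matrix.mul_smul, Matrix.smul_mul, hE.orthonormal,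
      Matrix.mul_smul, Matrix.smul_mul, hv]
  have hJ2 : 0 < M.spatialField t 0 ^ 2 := by rw [h0]; positivity
  refine Prod.ext ?_ (Prod.ext ?_ ?_)
  · simp only [Model.state, wonderlandState]
    rw [hframe, hH, hE.frameField_eq]
    have hmm : M.frameField t E 0 * M.frameField t E 0 = M.spatialField t 0 ^ 2 / t ^ 2 := by
      rw [← hmom]; ring
    set j2 := M.spatialField t 0 ^ 2
    ext i j
    simp only [Matrix.sub_apply, Matrix.add_apply, Matrix.smul_apply, Matrix.vecMulVec_apply]
    set β := transverseExponent γ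
    rw [hγβ]
    fin_cases i <;> fin_cases j <;> simp [hmm] <;> field_simp <;> ring
  · simp only [Model.state, wonderlandState]
    rw [hE.frameField_eq]
    have hp := hE.pos
    have hHpos : 0 < M.hubble t := by rw [hH]; positivity
    have : (Real.sqrt 6 * M.hubble t)⁻¹ * M.frameField t E 0
        = Real.sqrt (3 * (2 - γ) * (3 * γ - 2)) / 4 := by
      have h3 : 0 ≤ 3 * (2 - γ) * (3 * γ - 2) :=
        mul_nonneg (by linarith) (by linarith)
      rw [← sq_eq_sq₀ (by positivity) (by positivity), mul_pow, inv_pow, mul_pow, div_pow,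
        Real.sq_sqrt h3, Real.sq_sqrt (by norm_num), hmom, h0, hH]
      set β := transverseExponent γ
      rw [hγβ]
      field_simp
      ring
    funext i
    fin_cases i
    · simpa using this
    · simp
    · simp
  · simp only [Model.state, wonderlandState]
    have hρ' : M.ρ t = 2 / (2 - γ) * (2 * transverseExponent γ ^ 2 / t ^ 2) := by
      have : 2 - γ ≠ 0 := by linarith
      rw [← hρ]
      field_simp
    have h2 : 2 - γ ≠ 0 := by linarith
    rw [hρ', hH, transverseExponent]
    field_simp
    ring

end Properties

/-! ### Global solutions of autonomous differential equations -/

section ODE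

variable {X : Type*} [NormedAddCommGroup X] [NormedSpace ℝ X]

lemma exists_hasDerivAt_of_lipschitz_bounded [CompleteSpace X] {f : X → X} {K C : NNReal}
    (hf : LipschitzWith K f) (hC : ∀ x, ‖f x‖ ≤ C) (t₀ : ℝ) (x₀ : X) :
    ∃ α : ℝ → X, α t₀ = x₀ ∧ ∀ t, HasDerivAt α (f (α t)) t := by
  have hloc : ∀ n : ℕ, ∃ α : ℝ → X, α t₀ = x₀ ∧
      ∀ t ∈ Ioo (t₀ - (n + 1)) (t₀ + (n + 1)), HasDerivAt α (f (α t)) t := by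
    intro n
    have hn : (0 : ℝ) < n + 1 := by positivity
    have hP : IsPicardLindelof (fun _ => f) (tmin := t₀ - (n + 1)) (tmax := t₀ + (n + 1))
        ⟨t₀, by constructor <;> linarith⟩ x₀ (C * (n + 1)) 0 C K := by
      refine IsPicardLindelof.of_time_independent (fun x _ => hC x) hf.lipschitzOnWith ?_
      simp
    obtain ⟨α, h0, hα⟩ := hP.exists_eq_forall_mem_Icc_hasDerivWithinAt₀
    exact ⟨α, h0, fun t ht =>
      (hα t (Ioo_subset_Icc_self ht)).hasDerivAt (Icc_mem_nhds ht.1 ht.2)⟩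
  choose α hα0 hα using hloc
  have hle : ∀ m n : ℕ, m ≤ n →
      EqOn (α m) (α n) (Ioo (t₀ - (m + 1)) (t₀ + (m + 1))) := by
    intro m n hmn
    have hm : (0 : ℝ) < m + 1 := by positivity
    have hmn' : (m : ℝ) ≤ n := by exact_mod_cast hmn
    exact ODE_solution_unique_of_mem_Ioo (v := fun _ => f) (s := fun _ => univ)
      (fun _ _ => hf.lipschitzOnWith) (t₀ := t₀) ⟨by linarith, by linarith⟩
      (fun t ht => ⟨hα m t ht, trivial⟩)
      (fun t ht => ⟨hα n t ⟨by linarith [ht.1], by linarith [ht.2]⟩, trivial⟩)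
      ((hα0 m).trans (hα0 n).symm)
  have heq : ∀ m n : ℕ, ∀ t ∈ Ioo (t₀ - (m + 1)) (t₀ + (m + 1)),
      t ∈ Ioo (t₀ - (n + 1)) (t₀ + (n + 1)) → α m t = α n t := by
    intro m n t hm hn
    rcases le_total m n with h | h
    · exact hle m n h hm
    · exact (hle n m h hn).symm
  have hmem : ∀ t, t ∈ Ioo (t₀ - (⌊|t - t₀|⌋₊ + 1)) (t₀ + (⌊|t - t₀|⌋₊ + 1)) := by
    intro t
    have h := abs_lt.1 (Nat.lt_floor_add_one |t - t₀|)
    constructor <;> linarith [h.1, h.2]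
  refine ⟨fun t => α ⌊|t - t₀|⌋₊ t, hα0 _, fun t => ?_⟩
  refine (hα _ t (hmem t)).congr_of_eventuallyEq ?_
  filter_upwards [isOpen_Ioo.mem_nhds (hmem t)] with s hs using heq _ _ s (hmem s) hs

/-- An a priori bound, uniform over all slowed-down solutions, gives a solution for all later
times. -/
lemma exists_hasDerivAt_Ioi_of_bound [FiniteDimensional ℝ X] {f : X → X} (hf : ContDiff ℝ 1 f)
    {t₀ : ℝ} {x₀ : X} {R : ℝ}
    (hR : ∀ (ψ : ℝ → ℝ) (α : ℝ → X), Continuous ψ → (∀ t, 0 ≤ ψ t) → α t₀ = x₀ →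
      (∀ t, HasDerivAt α (ψ t • f (α t)) t) → ∀ t ≥ t₀, ‖α t‖ ≤ R) :
    ∃ a < t₀, ∃ α : ℝ → X, α t₀ = x₀ ∧ ∀ t > a, HasDerivAt α (f (α t)) t := by
  have : CompleteSpace X := FiniteDimensional.complete ℝ X
  have hpos : 0 < |R| + 1 := by positivity
  let φ : ContDiffBump (0 : X) := ⟨|R| + 1, |R| + 2, hpos, by linarith⟩
  have hφ : ContDiff ℝ 1 fun x => φ x • f x := φ.contDiff.smul hf
  have hcomp : HasCompactSupport fun x => φ x • f x := φ.hasCompactSupport.smul_right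
  obtain ⟨K, hK⟩ := ContDiff.lipschitzWith_of_hasCompactSupport hcomp hφ one_ne_zero
  obtain ⟨C, hC⟩ := hcomp.exists_bound_of_continuous hφ.continuous
  obtain ⟨α, hα0, hα⟩ := exists_hasDerivAt_of_lipschitz_bounded (C := C.toNNReal) hK
    (fun x => (hC x).trans (Real.le_coe_toNNReal C)) t₀ x₀
  have hcont : Continuous α := continuous_iff_continuousAt.2 fun t => (hα t).continuousAt
  have hbd := hR (fun t => φ (α t)) α (φ.continuous.comp hcont) (fun t => φ.nonneg) hα0 hα
  have hone : ∀ t, ‖α t‖ ≤ |R| + 1 → HasDerivAt α (f (α t)) t := by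
    intro t ht
    have h1 : φ (α t) = 1 := φ.one_of_mem_closedBall (by simpa using ht)
    simpa [h1] using hα t
  have hev : ∀ᶠ t in 𝓝 t₀, ‖α t‖ < |R| + 1 :=
    hcont.norm.continuousAt.eventually_lt_const
      (by linarith [hbd t₀ le_rfl, le_abs_self R])
  obtain ⟨ε, hε, hball⟩ := Metric.eventually_nhds_iff.1 hev
  refine ⟨t₀ - ε, by linarith, α, hα0, fun t ht => hone t ?_⟩
  rcases le_or_gt t₀ t with h | h
  · linarith [hbd t h, le_abs_self R]
  · refine (hball ?_).le
    rw [Real.dist_eq, abs_lt]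
    constructor <;> linarith

lemma contDiffOn_of_hasDerivAt {f : X → X} {I : Set ℝ} (hI : IsOpen I) {α : ℝ → X}
    (hα : ∀ t ∈ I, HasDerivAt α (f (α t)) t) (n : ℕ) (hf : ContDiff ℝ n f) :
    ContDiffOn ℝ n α I := by
  induction n with
  | zero =>
    exact contDiffOn_zero.2 fun t ht => (hα t ht).continuousAt.continuousWithinAt
  | succ n ih =>
    have hn := ih (hf.of_le (by exact_mod_cast n.le_succ))
    push_cast
    rw [contDiffOn_succ_iff_deriv_of_isOpen hI]
    refine ⟨fun t ht => (hα t ht).differentiableAt.differentiableWithinAt, by simp, ?_⟩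
    refine ((hf.of_le (by exact_mod_cast n.le_succ)).comp_contDiffOn hn).congr fun t ht => ?_
    exact (hα t ht).deriv

end ODE

/-! ### The field equations in a propagated orthonormal frame -/

/-- The evolution equations for the frame components of the expansion tensor, the field strength and
the density, run at speed `ψ`. -/
structure IsFrameFlow (γ : ℝ) (ψ : ℝ → ℝ) (Θ : ℝ → Matrix (Fin 3) (Fin 3) ℝ) (j : ℝ → Fin 3 → ℝ)
    (ρ : ℝ → ℝ) (I : Set ℝ) : Prop where
  continuousOn_speed : ContinuousOn ψ I
  hasEntryDeriv : ∀ t ∈ I, HasEntryDeriv Θ (ψ t • (-(Θ t).trace • Θ t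
    + Matrix.vecMulVec (j t) (j t) + ((2 - γ) / 2 * ρ t) • (1 : Matrix (Fin 3) (Fin 3) ℝ))) t
  hasDerivAt_field : ∀ t ∈ I, ∀ i, HasDerivAt (fun s => j s i) (ψ t * -(j t ᵥ* Θ t) i) t
  hasDerivAt_density : ∀ t ∈ I, HasDerivAt ρ (ψ t * (-γ * (Θ t).trace * ρ t)) t

namespace IsFrameFlow

variable {γ : ℝ} {ψ : ℝ → ℝ} {Θ : ℝ → Matrix (Fin 3) (Fin 3) ℝ} {j : ℝ → Fin 3 → ℝ} {ρ : ℝ → ℝ}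
  {I : Set ℝ} (h : IsFrameFlow γ ψ Θ j ρ I)

include h

lemma hasDerivAt_trace {t : ℝ} (ht : t ∈ I) : HasDerivAt (fun s => (Θ s).trace)
    (ψ t * (-(Θ t).trace ^ 2 + j t ⬝ᵥ j t + 3 / 2 * (2 - γ) * ρ t)) t := by
  refine (h.hasEntryDeriv t ht).trace.congr_deriv ?_
  simp only [Matrix.trace_add, Matrix.trace_smul, Matrix.trace_vecMulVec, Matrix.trace_one,
    Fintype.card_fin, smul_eq_mul]
  push_cast
  ring

lemma continuousOn_trace : ContinuousOn (fun s => (Θ s).trace) I := fun _ ht =>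
  (h.hasDerivAt_trace ht).continuousAt.continuousWithinAt

lemma hasDerivAt_constraint {t : ℝ} (ht : t ∈ I) :
    HasDerivAt (fun s => (Θ s).trace ^ 2 - (Θ s * Θ s).trace - 2 * ρ s - j s ⬝ᵥ j s)
      (-2 * ψ t * (Θ t).trace *
        ((Θ t).trace ^ 2 - (Θ t * Θ t).trace - 2 * ρ t - j t ⬝ᵥ j t)) t := by
  have h1 := h.hasDerivAt_trace ht
  have h2 := ((h.hasEntryDeriv t ht).mul (h.hasEntryDeriv t ht)).trace
  have h3 : HasDerivAt (fun s => j s ⬝ᵥ j s)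
      (∑ i, (ψ t * -(j t ᵥ* Θ t) i * j t i + j t i * (ψ t * -(j t ᵥ* Θ t) i))) t :=
    HasDerivAt.fun_sum fun i _ => (h.hasDerivAt_field t ht i).mul (h.hasDerivAt_field t ht i)
  refine (((h1.pow 2).sub h2).sub ((h.hasDerivAt_density t ht).const_mul 2)).sub h3
    |>.congr_deriv ?_
  have e1 : ∑ i, (ψ t * -(j t ᵥ* Θ t) i * j t i + j t i * (ψ t * -(j t ᵥ* Θ t) i))
      = -2 * ψ t * ((j t ᵥ* Θ t) ⬝ᵥ j t) := by
    simp only [dotProduct, Finset.mul_sum]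
    exact Finset.sum_congr rfl fun i _ => by ring
  have e2 : (Θ t *ᵥ j t) ⬝ᵥ j t = (j t ᵥ* Θ t) ⬝ᵥ j t := by
    rw [dotProduct_comm, Matrix.dotProduct_mulVec]
  have e3 : (j t ᵥ* Θ t) ⬝ᵥ j t = j t ⬝ᵥ (j t ᵥ* Θ t) := dotProduct_comm _ _
  rw [e1]
  simp only [Matrix.smul_mul, Matrix.mul_smul, Matrix.add_mul, Matrix.mul_add, Matrix.trace_add,
    Matrix.trace_smul, Matrix.vecMulVec_mul, Matrix.mul_vecMulVec, Matrix.trace_vecMulVec,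
    Matrix.one_mul, Matrix.mul_one, smul_eq_mul, e2, ← e3]
  push_cast
  ring

variable (hI : IsOpen I) (hI' : I.OrdConnected) {t₀ : ℝ} (ht₀ : t₀ ∈ I)
include hI hI' ht₀

lemma symm (hs : (Θ t₀)ᵀ = Θ t₀) {t : ℝ} (ht : t ∈ I) : (Θ t)ᵀ = Θ t := by
  ext k l
  have hA : ContinuousOn (fun s => -(ψ s * (Θ s).trace)) I :=
    (h.continuousOn_speed.mul h.continuousOn_trace).neg
  have hd : ∀ s ∈ I, HasDerivAt (fun s => Θ s l k - Θ s k l)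
      (-(ψ s * (Θ s).trace) * (Θ s l k - Θ s k l)) s := by
    intro s hs
    refine ((h.hasEntryDeriv s hs l k).sub (h.hasEntryDeriv s hs k l)).congr_deriv ?_
    simp only [Matrix.smul_apply, Matrix.add_apply, Matrix.vecMulVec_apply, smul_eq_mul,
      Matrix.one_apply, eq_comm (a := l) (b := k)]
    ring
  have := eq_mul_exp_of_hasDerivAt_mul hI hI' hA hd ht₀ ht
  rw [show Θ t₀ l k = Θ t₀ k l from congrFun (congrFun hs k) l, sub_self, zero_mul] at this
  exact sub_eq_zero.1 this

lemma density_pos (hρ : 0 < ρ t₀) {t : ℝ} (ht : t ∈ I) : 0 < ρ t := by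
  have hA : ContinuousOn (fun s => ψ s * (-γ * (Θ s).trace)) I :=
    h.continuousOn_speed.mul (continuousOn_const.mul h.continuousOn_trace)
  rw [eq_mul_exp_of_hasDerivAt_mul hI hI' hA
    (fun s hs => (h.hasDerivAt_density s hs).congr_deriv (by ring)) ht₀ ht]
  positivity

variable (hc : (Θ t₀).trace ^ 2 - (Θ t₀ * Θ t₀).trace - 2 * ρ t₀ - j t₀ ⬝ᵥ j t₀ = 0)
include hc

lemma constraint {t : ℝ} (ht : t ∈ I) :
    (Θ t).trace ^ 2 - (Θ t * Θ t).trace - 2 * ρ t - j t ⬝ᵥ j t = 0 := by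
  have hA : ContinuousOn (fun s => -2 * ψ s * (Θ s).trace) I :=
    (continuousOn_const.mul h.continuousOn_speed).mul h.continuousOn_trace
  have := eq_mul_exp_of_hasDerivAt_mul hI hI' hA
    (fun s hs' => h.hasDerivAt_constraint hs') ht₀ ht
  rw [this, hc, zero_mul]

lemma hasDerivAt_trace' {t : ℝ} (ht : t ∈ I) : HasDerivAt (fun s => (Θ s).trace)
    (-(ψ t * ((Θ t * Θ t).trace + (3 * γ - 2) / 2 * ρ t))) t := by
  refine (h.hasDerivAt_trace ht).congr_deriv ?_
  linear_combination -ψ t * h.constraint hI hI' ht₀ hc ht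

omit h hI hI' ht₀ hc in
lemma trace_mul_self_nonneg {A : Matrix (Fin 3) (Fin 3) ℝ} (hA : Aᵀ = A) :
    0 ≤ (A * A).trace := by
  rw [trace_mul_self_of_symm hA]; positivity

variable (hs : (Θ t₀)ᵀ = Θ t₀) (hρ : 0 < ρ t₀) (hT : 0 < (Θ t₀).trace)
include hs hρ hT

lemma trace_pos {t : ℝ} (ht : t ∈ I) : 0 < (Θ t).trace := by
  have hne : ∀ s ∈ I, (Θ s).trace ≠ 0 := by
    intro s hs' h0
    have h1 := h.constraint hI hI' ht₀ hc hs'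
    have h2 := trace_mul_self_nonneg (h.symm hI hI' ht₀ hs hs')
    have h3 := h.density_pos hI hI' ht₀ hρ hs'
    have h4 : 0 ≤ j s ⬝ᵥ j s := Finset.sum_nonneg fun k _ => mul_self_nonneg _
    rw [h0] at h1
    linarith
  by_contra hneg
  obtain ⟨s, hs', h0⟩ := (hI'.isPreconnected.intermediate_value ht ht₀ h.continuousOn_trace)
    ⟨not_lt.1 hneg, hT.le⟩
  exact hne s hs' h0

omit hT in
lemma trace_le (hγ : 2 / 3 < γ) (hψ : ∀ t ∈ I, 0 ≤ ψ t) {t : ℝ} (ht : t ∈ I) (htt : t₀ ≤ t) :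
    (Θ t).trace ≤ (Θ t₀).trace := by
  have hsub : Icc t₀ t ⊆ I := hI'.out ht₀ ht
  refine antitoneOn_of_deriv_nonpos (convex_Icc t₀ t) (h.continuousOn_trace.mono hsub)
    (fun s hs' => (h.hasDerivAt_trace (hsub (interior_subset hs'))).differentiableAt
      |>.differentiableWithinAt) (fun s hs' => ?_) (left_mem_Icc.2 htt) (right_mem_Icc.2 htt) htt
  have hs' := hsub (interior_subset hs')
  rw [(h.hasDerivAt_trace' hI hI' ht₀ hc hs').deriv]
  have h2 := trace_mul_self_nonneg (h.symm hI hI' ht₀ hs hs')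
  have h3 := h.density_pos hI hI' ht₀ hρ hs'
  have h4 : 0 ≤ (3 * γ - 2) / 2 * ρ s := mul_nonneg (by linarith) h3.le
  have := mul_nonneg (hψ s hs') (add_nonneg h2 h4)
  linarith

lemma bounds (hγ : 2 / 3 < γ) (hψ : ∀ t ∈ I, 0 ≤ ψ t) {t : ℝ} (ht : t ∈ I) (htt : t₀ ≤ t) :
    (∀ k l, |Θ t k l| ≤ (Θ t₀).trace) ∧ (∀ k, |j t k| ≤ (Θ t₀).trace) ∧
      |ρ t| ≤ (Θ t₀).trace ^ 2 := by
  have h1 := h.constraint hI hI' ht₀ hc ht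
  have hsy := h.symm hI hI' ht₀ hs ht
  have h2 := trace_mul_self_nonneg hsy
  have h3 := h.density_pos hI hI' ht₀ hρ ht
  have h4 : 0 ≤ j t ⬝ᵥ j t := Finset.sum_nonneg fun k _ => mul_self_nonneg _
  have h5 := h.trace_pos hI hI' ht₀ hc hs hρ hT ht
  have h6 := h.trace_le hI hI' ht₀ hc hs hρ hγ hψ ht htt
  have h7 : (Θ t).trace ^ 2 ≤ (Θ t₀).trace ^ 2 := pow_le_pow_left₀ h5.le h6 2
  refine ⟨fun k l => abs_le_of_sq_le_sq ?_ hT.le, fun k => abs_le_of_sq_le_sq ?_ hT.le, ?_⟩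
  · have : Θ t k l ^ 2 ≤ (Θ t * Θ t).trace := by
      have e : (Θ t * Θ t).trace = ∑ a, ∑ b, Θ t a b ^ 2 := by
        simp only [Matrix.trace, Matrix.diag_apply, Matrix.mul_apply]
        refine Finset.sum_congr rfl fun a _ => Finset.sum_congr rfl fun b _ => ?_
        rw [show Θ t b a = Θ t a b from congrFun (congrFun hsy a) b]
        ring
      rw [e]
      refine le_trans ?_ (Finset.single_le_sum (fun a _ => Finset.sum_nonneg fun b _ =>
        sq_nonneg (Θ t a b)) (Finset.mem_univ k))
      exact Finset.single_le_sum (f := fun b => Θ t k b ^ 2) (fun b _ => sq_nonneg _)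
        (Finset.mem_univ l)
    linarith
  · have : j t k ^ 2 ≤ j t ⬝ᵥ j t := by
      simp only [dotProduct, ← sq]
      exact Finset.single_le_sum (f := fun b => j t b ^ 2) (fun b _ => sq_nonneg _)
        (Finset.mem_univ k)
    linarith
  · rw [abs_of_pos h3]
    linarith

end IsFrameFlow

/-- Damping beyond the size of `Θ` keeps the solutions of `F' = Θ F - μ F` bounded. -/
lemma frame_sq_le {ψ : ℝ → ℝ} {Θ F : ℝ → Matrix (Fin 3) (Fin 3) ℝ} {μ t₀ : ℝ}
    (hψ : ∀ t, 0 ≤ ψ t) (hF : ∀ t, HasEntryDeriv F (ψ t • (Θ t * F t - (3 * μ) • F t)) t)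
    (hΘ : ∀ t ≥ t₀, ∀ k l, |Θ t k l| ≤ μ) {t : ℝ} (ht : t₀ ≤ t) :
    ∑ k, ∑ l, F t k l ^ 2 ≤ ∑ k, ∑ l, F t₀ k l ^ 2 := by
  have hd : ∀ s, HasDerivAt (fun s => ∑ k, ∑ l, F s k l ^ 2)
      (∑ k, ∑ l, 2 * F s k l * (ψ s * ((Θ s * F s) k l - 3 * μ * F s k l))) s := by
    intro s
    refine HasDerivAt.fun_sum fun k _ => HasDerivAt.fun_sum fun l _ => ?_
    refine ((hF s k l).pow 2).congr_deriv ?_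
    simp
  have hanti : AntitoneOn (fun s => ∑ k, ∑ l, F s k l ^ 2) (Ici t₀) := by
    refine antitoneOn_of_deriv_nonpos (convex_Ici t₀)
      (fun s _ => (hd s).continuousAt.continuousWithinAt)
      (fun s _ => (hd s).differentiableAt.differentiableWithinAt) fun s hs => ?_
    rw [interior_Ici] at hs
    rw [(hd s).deriv, Finset.sum_comm]
    refine Finset.sum_nonpos fun l _ => ?_
    have e : ∑ k, 2 * F s k l * (ψ s * ((Θ s * F s) k l - 3 * μ * F s k l))
        = 2 * ψ s * ∑ k, ∑ m, (Θ s k m * F s k l * F s m l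
          - μ / 2 * (F s k l ^ 2 + F s m l ^ 2)) := by
      simp only [Matrix.mul_apply, Fin.sum_univ_three]
      ring
    rw [e]
    refine mul_nonpos_of_nonneg_of_nonpos (by linarith [hψ s]) (Finset.sum_nonpos fun k _ =>
      Finset.sum_nonpos fun m _ => ?_)
    have h1 := abs_le.1 (hΘ s hs.le k m)
    nlinarith [sq_nonneg (F s k l + F s m l), sq_nonneg (F s k l - F s m l)]
  exact hanti self_mem_Ici ht ht

/-! ### From the frame equations to a solution -/

/-- The model whose metric is `Fᵀ F`, with a constant field strength. -/
def frameModel (F : ℝ → Matrix (Fin 3) (Fin 3) ℝ) (ρ : ℝ → ℝ) (f : Fin 3 → ℝ) : Model where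
  g := fun t => (F t)ᵀ * F t
  ρ := ρ
  J := fun _ => Fin.cons 0 f

lemma frameModel_spatialField (F : ℝ → Matrix (Fin 3) (Fin 3) ℝ) (ρ : ℝ → ℝ) (f : Fin 3 → ℝ)
    (t : ℝ) : (frameModel F ρ f).spatialField t = f := rfl

lemma HasEntryDeriv.det_of_mul {F : ℝ → Matrix (Fin 3) (Fin 3) ℝ} {A : Matrix (Fin 3) (Fin 3) ℝ}
    {t : ℝ} (hF : HasEntryDeriv F (A * F t) t) :
    HasDerivAt (fun s => (F s).det) (A.trace * (F t).det) t := by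
  simp only [Matrix.det_fin_three]
  refine ((((((hF 0 0).mul (hF 1 1)).mul (hF 2 2)).sub (((hF 0 0).mul (hF 1 2)).mul (hF 2 1))).sub
    (((hF 0 1).mul (hF 1 0)).mul (hF 2 2))).add (((hF 0 1).mul (hF 1 2)).mul (hF 2 0))).add
    (((hF 0 2).mul (hF 1 0)).mul (hF 2 1)) |>.sub (((hF 0 2).mul (hF 1 1)).mul (hF 2 0))
    |>.congr_deriv ?_
  simp only [Matrix.mul_apply, Matrix.trace_fin_three, Fin.sum_univ_three, Pi.mul_apply]
  ring

section FrameModel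

variable {γ : ℝ} {Θ F : ℝ → Matrix (Fin 3) (Fin 3) ℝ} {j : ℝ → Fin 3 → ℝ} {ρ : ℝ → ℝ} {a t₀ : ℝ}
  (h : IsFrameFlow γ (fun _ => 1) Θ j ρ (Ioi a))
  (hF : ∀ t ∈ Ioi a, HasEntryDeriv F (Θ t * F t) t) (ht₀ : a < t₀) (hF₀ : F t₀ = 1)
include h hF ht₀ hF₀

lemma isUnit_det_frame {t : ℝ} (ht : a < t) : IsUnit (F t).det := by
  rw [eq_mul_exp_of_hasDerivAt_mul isOpen_Ioi ordConnected_Ioi h.continuousOn_trace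
    (fun s hs => (hF s hs).det_of_mul) ht₀ ht, hF₀, Matrix.det_one, one_mul]
  exact (Real.exp_pos _).ne'.isUnit

lemma frame_field_eq {t : ℝ} (ht : a < t) : j t ᵥ* F t = j t₀ := by
  have hd : ∀ s ∈ Ioi a, ∀ k, HasDerivAt (fun s => (j s ᵥ* F s) k) 0 s := by
    intro s hs k
    have : HasDerivAt (fun s => ∑ i, j s i * F s i k)
        (∑ i, (1 * -(j s ᵥ* Θ s) i * F s i k + j s i * (Θ s * F s) i k)) s :=
      HasDerivAt.fun_sum fun i _ => (h.hasDerivAt_field s hs i).mul (hF s hs i k)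
    refine this.congr_deriv ?_
    have e := congrFun (Matrix.vecMul_vecMul (j s) (Θ s) (F s)) k
    simp only [Matrix.vecMul, dotProduct] at e ⊢
    rw [Finset.sum_add_distrib, ← e]
    simp
  have hc : ∀ k, (j t ᵥ* F t) k = (j t₀ ᵥ* F t₀) k := fun k =>
    isOpen_Ioi.is_const_of_deriv_eq_zero isPreconnected_Ioi
      (fun s hs => (hd s hs k).differentiableAt.differentiableWithinAt)
      (fun s hs => (hd s hs k).deriv) ht ht₀
  rw [funext hc, hF₀, Matrix.vecMul_one]

lemma frameModel_posDef (f : Fin 3 → ℝ) {t : ℝ} (ht : a < t) :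
    ((frameModel F ρ f).g t).PosDef := by
  have hu := isUnit_det_frame h hF ht₀ hF₀ ht
  have hg : (frameModel F ρ f).g t = (F t)ᴴ * F t := by
    rw [Matrix.conjTranspose_eq_transpose_of_trivial]; rfl
  rw [hg]
  exact Matrix.PosDef.conjTranspose_mul_self _
    (Matrix.mulVec_injective_iff_isUnit.2 ((Matrix.isUnit_iff_isUnit_det _).2 hu))

variable (hs : (Θ t₀)ᵀ = Θ t₀)
include hs

omit hF₀ in
lemma frameModel_expansion (f : Fin 3 → ℝ) {t : ℝ} (ht : a < t) :
    (frameModel F ρ f).expansion t = (F t)ᵀ * Θ t * F t := by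
  ext k l
  have hd := ((hF t ht).transpose.mul (hF t ht)) k l
  simp only [Model.expansion, Matrix.of_apply, frameModel]
  rw [hd.deriv, Matrix.transpose_mul, h.symm isOpen_Ioi ordConnected_Ioi ht₀ hs ht,
    ← Matrix.mul_assoc, Matrix.add_apply]
  ring

lemma frameModel_mixed (f : Fin 3 → ℝ) {t : ℝ} (ht : a < t) :
    (frameModel F ρ f).mixed t = (F t)⁻¹ * Θ t * F t := by
  have hu := isUnit_det_frame h hF ht₀ hF₀ ht
  have hu' : IsUnit (F t)ᵀ.det := by rwa [Matrix.det_transpose]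
  rw [Model.mixed, frameModel_expansion h hF ht₀ hs f ht]
  simp only [frameModel, Matrix.mul_inv_rev, Matrix.mul_assoc,
    Matrix.nonsing_inv_mul_cancel_left _ _ hu']

lemma frameModel_trace_mixed (f : Fin 3 → ℝ) {t : ℝ} (ht : a < t) :
    ((frameModel F ρ f).mixed t).trace = (Θ t).trace := by
  have hu := isUnit_det_frame h hF ht₀ hF₀ ht
  rw [frameModel_mixed h hF ht₀ hF₀ hs f ht, Matrix.mul_assoc, Matrix.trace_mul_comm,
    Matrix.mul_nonsing_inv_cancel_right _ _ hu]

variable (hc : (Θ t₀).trace ^ 2 - (Θ t₀ * Θ t₀).trace - 2 * ρ t₀ - j t₀ ⬝ᵥ j t₀ = 0)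
  (hF2 : ∀ k l, ContDiffOn ℝ 2 (fun t => F t k l) (Ioi a)) (hρ1 : ContDiffOn ℝ 1 ρ (Ioi a))
include hc hF2 hρ1

lemma frameModel_isEvolution : IsEvolution γ (frameModel F ρ (j t₀)) (Ioi a) := by
  refine ⟨fun t ht => frameModel_posDef h hF ht₀ hF₀ _ ht, fun k l => ?_, hρ1,
    fun μ => contDiffOn_const, fun t ht => rfl, fun t ht k l => ?_, fun t ht => ?_, fun t ht => ?_,
    fun t ht i => ?_⟩
  · simp only [frameModel, Matrix.mul_apply, Matrix.transpose_apply]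
    exact ContDiffOn.sum fun i _ => (hF2 i k).mul (hF2 i l)
  · have hu := isUnit_det_frame h hF ht₀ hF₀ ht
    have hev : (fun s => (frameModel F ρ (j t₀)).expansion s k l) =ᶠ[𝓝 t]
        fun s => ((F s)ᵀ * Θ s * F s) k l := by
      filter_upwards [isOpen_Ioi.mem_nhds ht] with s hs'
      rw [frameModel_expansion h hF ht₀ hs _ hs']
    have hd := (((hF t ht).transpose.mul (h.hasEntryDeriv t ht)).mul (hF t ht)) k l
    rw [hev.deriv_eq, hd.deriv, frameModel_trace_mixed h hF ht₀ hF₀ hs _ ht,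
      frameModel_mixed h hF ht₀ hF₀ hs _ ht, frameModel_expansion h hF ht₀ hs _ ht,
      frameModel_spatialField]
    have e1 : (F t)ᵀ * Θ t * F t * ((F t)⁻¹ * Θ t * F t) = (F t)ᵀ * Θ t * Θ t * F t := by
      simp only [Matrix.mul_assoc, Matrix.mul_nonsing_inv_cancel_left _ _ hu]
    have e2 : (F t)ᵀ * Matrix.vecMulVec (j t) (j t) * F t
        = Matrix.vecMulVec (j t₀) (j t₀) := by
      rw [Matrix.mul_vecMulVec, Matrix.vecMulVec_mul, Matrix.mulVec_transpose,
        frame_field_eq h hF ht₀ hF₀ ht]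
    have key : ((Θ t * F t)ᵀ * Θ t + (F t)ᵀ * ((1 : ℝ) • (-(Θ t).trace • Θ t
        + Matrix.vecMulVec (j t) (j t) + ((2 - γ) / 2 * ρ t) • (1 : Matrix (Fin 3) (Fin 3) ℝ))))
          * F t + (F t)ᵀ * Θ t * (Θ t * F t)
        = (2 : ℝ) • ((F t)ᵀ * Θ t * F t * ((F t)⁻¹ * Θ t * F t))
          - (Θ t).trace • ((F t)ᵀ * Θ t * F t) + Matrix.vecMulVec (j t₀) (j t₀)
          + ((2 - γ) / 2 * ρ t) • ((F t)ᵀ * F t) := by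
      rw [e1, ← e2, Matrix.transpose_mul, h.symm isOpen_Ioi ordConnected_Ioi ht₀ hs ht]
      simp only [one_smul, Matrix.mul_add, Matrix.add_mul, Matrix.mul_smul, Matrix.smul_mul,
        Matrix.mul_one, ← Matrix.mul_assoc]
      module
    have := congrFun (congrFun key k) l
    rw [this]
    simp [Matrix.vecMulVec_apply, frameModel]
  · have hu := isUnit_det_frame h hF ht₀ hF₀ ht
    have hev : ∀ᶠ s in 𝓝 t, s ∈ Ioi a := isOpen_Ioi.mem_nhds ht
    have hm : ∀ i, DifferentiableAt ℝ (fun s => (frameModel F ρ (j t₀)).mixed s i i) t := by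
      intro i
      have hinv := (hF t ht).inv (hev.mono fun s hs' => isUnit_det_frame h hF ht₀ hF₀ hs')
      refine (((hinv.mul (h.hasEntryDeriv t ht)).mul (hF t ht)) i i).differentiableAt
        |>.congr_of_eventuallyEq ?_
      filter_upwards [hev] with s hs'
      rw [frameModel_mixed h hF ht₀ hF₀ hs _ hs']
    have htr : (fun s => ((frameModel F ρ (j t₀)).mixed s).trace) =ᶠ[𝓝 t]
        fun s => (Θ s).trace := by
      filter_upwards [hev] with s hs' using frameModel_trace_mixed h hF ht₀ hF₀ hs _ hs'
    have e : ∑ i, deriv (fun s => (frameModel F ρ (j t₀)).mixed s i i) t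
        = deriv (fun s => ((frameModel F ρ (j t₀)).mixed s).trace) t := by
      simp only [Matrix.trace, Matrix.diag_apply]
      exact (deriv_fun_sum fun i _ => hm i).symm
    rw [e, htr.deriv_eq, (h.hasDerivAt_trace' isOpen_Ioi ordConnected_Ioi ht₀ hc ht).deriv,
      frameModel_mixed h hF ht₀ hF₀ hs _ ht]
    have e2 : ((F t)⁻¹ * Θ t * F t * ((F t)⁻¹ * Θ t * F t)).trace = (Θ t * Θ t).trace := by
      simp only [Matrix.mul_assoc, Matrix.mul_nonsing_inv_cancel_left _ _ hu]
      rw [Matrix.trace_mul_comm]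
      simp only [Matrix.mul_assoc, Matrix.mul_nonsing_inv _ hu, Matrix.mul_one]
    rw [e2]
    simp only [frameModel]
    ring
  · rw [frameModel_trace_mixed h hF ht₀ hF₀ hs _ ht]
    exact (h.hasDerivAt_density t ht).deriv.trans (one_mul _)
  · simp [frameModel]

end FrameModel

/-! ### Existence of solutions with given initial state -/

/-- Frame components of the expansion tensor and the field strength, the density, and a rescaled
coframe. -/
abbrev FrameData := (Fin 3 → Fin 3 → ℝ) × (Fin 3 → ℝ) × ℝ × (Fin 3 → Fin 3 → ℝ)

/-- The right-hand side of the frame equations. The coframe is rescaled by an exponential of rate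
`3 * μ`. -/
def frameVectorField (γ μ : ℝ) (x : FrameData) : FrameData :=
  (fun k l => -(∑ m, x.1 m m) * x.1 k l + x.2.1 k * x.2.1 l
      + (2 - γ) / 2 * x.2.2.1 * (1 : Matrix (Fin 3) (Fin 3) ℝ) k l,
    fun k => -∑ m, x.2.1 m * x.1 m k,
    -γ * (∑ m, x.1 m m) * x.2.2.1,
    fun k l => (∑ m, x.1 k m * x.2.2.2 m l) - 3 * μ * x.2.2.2 k l)

lemma contDiff_frameVectorField (γ μ : ℝ) {n : WithTop ℕ∞} :
    ContDiff ℝ n (frameVectorField γ μ) := by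
  unfold frameVectorField
  fun_prop

section Curve

variable {γ μ t c : ℝ} {α : ℝ → FrameData}
  (hα : HasDerivAt α (c • frameVectorField γ μ (α t)) t)
include hα

lemma hasEntryDeriv_frameData_expansion : HasEntryDeriv (fun s => Matrix.of (α s).1)
    (c • (-(Matrix.of (α t).1).trace • Matrix.of (α t).1
      + Matrix.vecMulVec (α t).2.1 (α t).2.1
      + ((2 - γ) / 2 * (α t).2.2.1) • (1 : Matrix (Fin 3) (Fin 3) ℝ))) t := by
  intro k l
  exact hasDerivAt_pi.1 (hasDerivAt_pi.1 hα.fst k) l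

lemma hasDerivAt_frameData_field (k : Fin 3) : HasDerivAt (fun s => (α s).2.1 k)
    (c * -((α t).2.1 ᵥ* Matrix.of (α t).1) k) t :=
  hasDerivAt_pi.1 hα.snd.fst k

lemma hasDerivAt_frameData_density : HasDerivAt (fun s => (α s).2.2.1)
    (c * (-γ * (Matrix.of (α t).1).trace * (α t).2.2.1)) t :=
  hα.snd.snd.fst

lemma hasEntryDeriv_frameData_coframe : HasEntryDeriv (fun s => Matrix.of (α s).2.2.2)
    (c • (Matrix.of (α t).1 * Matrix.of (α t).2.2.2 - (3 * μ) • Matrix.of (α t).2.2.2)) t := by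
  intro k l
  exact hasDerivAt_pi.1 (hasDerivAt_pi.1 hα.snd.snd.snd k) l

end Curve

lemma isFrameFlow_of_hasDerivAt {γ μ : ℝ} {ψ : ℝ → ℝ} {α : ℝ → FrameData} {I : Set ℝ}
    (hψ : ContinuousOn ψ I) (hα : ∀ t ∈ I, HasDerivAt α (ψ t • frameVectorField γ μ (α t)) t) :
    IsFrameFlow γ ψ (fun s => Matrix.of (α s).1) (fun s => (α s).2.1) (fun s => (α s).2.2.1) I where
  continuousOn_speed := hψ
  hasEntryDeriv t ht := hasEntryDeriv_frameData_expansion (hα t ht)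
  hasDerivAt_field t ht := hasDerivAt_frameData_field (hα t ht)
  hasDerivAt_density t ht := hasDerivAt_frameData_density (hα t ht)

lemma frameData_bound {γ μ : ℝ} (hγ : 2 / 3 < γ) {ψ : ℝ → ℝ} {α : ℝ → FrameData}
    (hψ : Continuous ψ) (hψ' : ∀ t, 0 ≤ ψ t)
    (hα : ∀ t, HasDerivAt α (ψ t • frameVectorField γ μ (α t)) t) {t₀ : ℝ}
    (hs : (Matrix.of (α t₀).1)ᵀ = Matrix.of (α t₀).1)
    (hc : (Matrix.of (α t₀).1).trace ^ 2 - (Matrix.of (α t₀).1 * Matrix.of (α t₀).1).trace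
      - 2 * (α t₀).2.2.1 - (α t₀).2.1 ⬝ᵥ (α t₀).2.1 = 0)
    (hρ : 0 < (α t₀).2.2.1) (hμ : (Matrix.of (α t₀).1).trace = μ) (hμ' : 0 < μ)
    (hF : Matrix.of (α t₀).2.2.2 = 1) {t : ℝ} (ht : t₀ ≤ t) : ‖α t‖ ≤ μ + μ ^ 2 + 3 := by
  have h := isFrameFlow_of_hasDerivAt (I := univ) hψ.continuousOn fun t _ => hα t
  have hb : ∀ s ≥ t₀, _ := fun s hs' => h.bounds isOpen_univ ordConnected_univ (mem_univ t₀) hc hs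
    hρ (by rwa [hμ]) hγ (fun t _ => hψ' t) (mem_univ s) hs'
  simp only [hμ] at hb
  have hfr := frame_sq_le hψ' (fun t => hasEntryDeriv_frameData_coframe (hα t))
    (fun s hs' => (hb s hs').1) ht
  obtain ⟨b1, b2, b3⟩ := hb t ht
  have hμ2 := sq_nonneg μ
  rw [hF] at hfr
  have hone : ∑ k, ∑ l, (1 : Matrix (Fin 3) (Fin 3) ℝ) k l ^ 2 = 3 := by
    simp [Matrix.one_apply]
  rw [hone] at hfr
  have b4 : ∀ k l, |(α t).2.2.2 k l| ≤ 3 := by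
    intro k l
    refine abs_le_of_sq_le_sq ?_ (by norm_num)
    have h1 : (α t).2.2.2 k l ^ 2 ≤ ∑ l, (α t).2.2.2 k l ^ 2 :=
      Finset.single_le_sum (f := fun l => (α t).2.2.2 k l ^ 2) (fun _ _ => sq_nonneg _)
        (Finset.mem_univ l)
    have h2 : ∑ l, (α t).2.2.2 k l ^ 2 ≤ ∑ k, ∑ l, (α t).2.2.2 k l ^ 2 :=
      Finset.single_le_sum (f := fun k => ∑ l, (α t).2.2.2 k l ^ 2)
        (fun _ _ => Finset.sum_nonneg fun _ _ => sq_nonneg _) (Finset.mem_univ k)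
    simp only [Matrix.of_apply] at hfr
    linarith
  have hR : 0 ≤ μ + μ ^ 2 + 3 := by positivity
  refine norm_prod_le_iff.2 ⟨?_, norm_prod_le_iff.2 ⟨?_, norm_prod_le_iff.2 ⟨?_, ?_⟩⟩⟩
  · refine (pi_norm_le_iff_of_nonneg hR).2 fun k => (pi_norm_le_iff_of_nonneg hR).2 fun l => ?_
    have := b1 k l
    simp only [Matrix.of_apply] at this
    rw [Real.norm_eq_abs]
    linarith
  · refine (pi_norm_le_iff_of_nonneg hR).2 fun k => ?_
    rw [Real.norm_eq_abs]
    linarith [b2 k]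
  · rw [Real.norm_eq_abs]
    linarith
  · refine (pi_norm_le_iff_of_nonneg hR).2 fun k => (pi_norm_le_iff_of_nonneg hR).2 fun l => ?_
    rw [Real.norm_eq_abs]
    linarith [b4 k l]

theorem exists_isSolution {γ : ℝ} (hγ : 2 / 3 < γ) {S₀ : State} (hS₀ : S₀ ∈ stateSpace) {H₀ : ℝ}
    (hH₀ : 0 < H₀) (t₀ : ℝ) :
    ∃ a < t₀, ∃ (M : Model) (E : _), IsSolution γ M (Ioi a) ∧ IsAlignedFrame M t₀ E ∧
      M.hubble t₀ = H₀ ∧ M.state t₀ E = S₀ := by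
  obtain ⟨hsym, htr, hV0, hV1, hV2, hΩ, hcon⟩ := hS₀
  set Θ₀ : Matrix (Fin 3) (Fin 3) ℝ := H₀ • (1 + S₀.1) with hΘ₀
  set j₀ : Fin 3 → ℝ := (Real.sqrt 6 * H₀) • S₀.2.1 with hj₀
  set ρ₀ : ℝ := 3 * H₀ ^ 2 * S₀.2.2 with hρ₀
  set μ : ℝ := 3 * H₀ with hμ
  have hμpos : 0 < μ := by positivity
  have hΘtr : Θ₀.trace = μ := by
    rw [hΘ₀, Matrix.trace_smul, Matrix.trace_add, Matrix.trace_one, htr, hμ]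
    simp only [Fintype.card_fin, smul_eq_mul]
    push_cast
    ring
  have hΘs : Θ₀ᵀ = Θ₀ := by
    rw [hΘ₀, Matrix.transpose_smul, Matrix.transpose_add, Matrix.transpose_one, hsym]
  have hjj : j₀ ⬝ᵥ j₀ = 6 * H₀ ^ 2 * ∑ a, S₀.2.1 a ^ 2 := by
    simp only [hj₀, dotProduct, Pi.smul_apply, smul_eq_mul, Finset.mul_sum]
    refine Finset.sum_congr rfl fun i _ => ?_
    have := Real.sq_sqrt (show (0 : ℝ) ≤ 6 by norm_num)
    linear_combination H₀ ^ 2 * S₀.2.1 i ^ 2 * this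
  have hcon₀ : Θ₀.trace ^ 2 - (Θ₀ * Θ₀).trace - 2 * ρ₀ - j₀ ⬝ᵥ j₀ = 0 := by
    have e : (Θ₀ * Θ₀).trace = H₀ ^ 2 * (3 + (S₀.1 * S₀.1).trace) := by
      simp only [hΘ₀, Matrix.smul_mul, Matrix.mul_smul, Matrix.trace_smul, Matrix.add_mul,
        Matrix.mul_add, Matrix.trace_add, Matrix.one_mul, Matrix.mul_one, htr, Matrix.trace_one,
        smul_eq_mul, Fintype.card_fin]
      push_cast
      ring
    rw [hΘtr, e, hjj, hρ₀, hμ]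
    linear_combination -6 * H₀ ^ 2 * hcon
  have hρpos : 0 < ρ₀ := by positivity
  set x₀ : FrameData := (fun k l => Θ₀ k l, j₀, ρ₀, fun k l => (1 : Matrix (Fin 3) (Fin 3) ℝ) k l)
    with hx₀
  obtain ⟨a, ha, α, hα₀, hα⟩ := exists_hasDerivAt_Ioi_of_bound
    (contDiff_frameVectorField γ μ) (t₀ := t₀) (x₀ := x₀) (R := μ + μ ^ 2 + 3) (by
      intro ψ α hψ hψ' hα₀ hα t ht
      exact frameData_bound hγ hψ hψ' hα (by rw [hα₀]; exact hΘs) (by rw [hα₀]; exact hcon₀)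
        (by rw [hα₀]; exact hρpos) (by rw [hα₀]; exact hΘtr) hμpos (by rw [hα₀]; rfl) ht)
  have hα1 : ∀ t ∈ Ioi a, HasDerivAt α ((1 : ℝ) • frameVectorField γ μ (α t)) t := fun t ht => by
    rw [one_smul]; exact hα t ht
  have hflow := isFrameFlow_of_hasDerivAt (ψ := fun _ => 1) continuousOn_const hα1
  set F : ℝ → Matrix (Fin 3) (Fin 3) ℝ := fun t =>
    Real.exp (3 * μ * (t - t₀)) • Matrix.of (α t).2.2.2 with hFdef
  have hF : ∀ t ∈ Ioi a, HasEntryDeriv F (Matrix.of (α t).1 * F t) t := by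
    intro t ht k l
    have h1 : HasDerivAt (fun s : ℝ => Real.exp (3 * μ * (s - t₀)))
        (Real.exp (3 * μ * (t - t₀)) * (3 * μ)) t := by
      simpa using (((hasDerivAt_id t).sub_const t₀).const_mul (3 * μ)).exp
    refine (h1.mul (hasEntryDeriv_frameData_coframe (hα1 t ht) k l)).congr_deriv ?_
    simp only [hFdef, Matrix.mul_smul, Matrix.smul_apply, Matrix.sub_apply, smul_eq_mul]
    ring
  have hF₀ : F t₀ = 1 := by
    simp only [hFdef, hα₀, sub_self, mul_zero, Real.exp_zero, one_smul]
    rfl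
  have hα2 : ContDiffOn ℝ 2 α (Ioi a) := by
    exact_mod_cast contDiffOn_of_hasDerivAt isOpen_Ioi hα 2 (contDiff_frameVectorField γ μ)
  have hF2 : ∀ k l, ContDiffOn ℝ 2 (fun t => F t k l) (Ioi a) := by
    intro k l
    have h1 : ContDiff ℝ 2 fun t : ℝ => Real.exp (3 * μ * (t - t₀)) := by fun_prop
    have h2 : ContDiffOn ℝ 2 (fun t => (α t).2.2.2 k l) (Ioi a) :=
      contDiffOn_pi.1 (contDiffOn_pi.1 hα2.snd.snd.snd k) l
    exact h1.contDiffOn.mul h2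
  have hρ1 : ContDiffOn ℝ 1 (fun t => (α t).2.2.1) (Ioi a) :=
    hα2.snd.snd.fst.of_le (by norm_num)
  have hs' : (Matrix.of (α t₀).1)ᵀ = Matrix.of (α t₀).1 := by rw [hα₀]; exact hΘs
  have hc' : (Matrix.of (α t₀).1).trace ^ 2 - (Matrix.of (α t₀).1 * Matrix.of (α t₀).1).trace
      - 2 * (α t₀).2.2.1 - (α t₀).2.1 ⬝ᵥ (α t₀).2.1 = 0 := by rw [hα₀]; exact hcon₀
  have hev := frameModel_isEvolution hflow hF ha hF₀ hs' hc' hF2 hρ1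
  have hθ := frameModel_expansion hflow hF ha hs' (α t₀).2.1 ha
  have hT := frameModel_trace_mixed hflow hF ha hF₀ hs' (α t₀).2.1 ha
  set M := frameModel F (fun t => (α t).2.2.1) (α t₀).2.1 with hM
  have hα₀1 : Matrix.of (α t₀).1 = Θ₀ := by rw [hα₀]; rfl
  have hH : M.hubble t₀ = H₀ := by
    rw [Model.hubble_eq, hT, hα₀1, hΘtr, hμ]
    ring
  have hfield : M.frameField t₀ 1 = j₀ := by
    rw [Model.frameField, Matrix.vecMul_one]
    have : (α t₀).2.1 = j₀ := by rw [hα₀]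
    rw [← this]
    rfl
  have h6 : 0 < Real.sqrt 6 * H₀ := by positivity
  refine ⟨a, ha, M, 1, (isSolution_iff_isEvolution γ isOpen_Ioi).2 hev, ⟨?_, ?_, ?_, ?_⟩, hH, ?_⟩
  · simp [hM, frameModel, hF₀]
  · rw [hfield, hj₀]
    exact mul_pos h6 hV0
  · simp [hfield, hj₀, hV1]
  · simp [hfield, hj₀, hV2]
  · refine Prod.ext ?_ (Prod.ext ?_ ?_)
    · simp only [Model.state]
      rw [hθ, hH, hF₀, hα₀1, hΘ₀]
      simp [smul_smul, hH₀.ne']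
    · simp only [Model.state]
      rw [hfield, hH, hj₀, smul_smul, inv_mul_cancel₀ h6.ne', one_smul]
    · simp only [Model.state]
      have : M.ρ t₀ = ρ₀ := by
        change (α t₀).2.2.1 = ρ₀
        rw [hα₀]
      rw [this, hH, hρ₀]
      field_simp

/-! ### Wonderland as the global attractor -/

theorem isGlobalAttractor_wonderlandState {γ : ℝ} (hγ : 2 / 3 < γ) (hγ' : γ ≤ 6 / 5) :
    IsGlobalAttractor γ (wonderlandState γ) where
  evolves S₀ hS₀ H₀ hH₀ t₀ := exists_isSolution hγ hS₀ hH₀ t₀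
  invariant a M hM t₀ ht₀ hH hρ hJ t ht := by
    have h := (isSolution_iff_isEvolution γ isOpen_Ioi).1 hM
    have hHt := hubble_pos h ht₀ hH hρ (spatialField_ne_zero h ht₀ hJ) ht
    exact ⟨hHt, fun E hE => state_mem_stateSpace h isOpen_Ioi ht hHt hE (ρ_pos h ht₀ hρ ht)⟩
  attracts a M hM t₀ ht₀ hH hρ hJ E hE :=
    tendsto_state hγ hγ' ((isSolution_iff_isEvolution γ isOpen_Ioi).1 hM) ht₀ hH hρ hJ hE
  stable U hU := wonderlandState_stable hγ hγ' hU

end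

end BianchiI

open BianchiI in
theorem mainTheorem3 :
    -- range of existence
    (∀ γ : ℝ, 0 < γ → ((∃ M : Model, IsWonderland γ M) ↔ 2 / 3 < γ ∧ γ < 2)) ∧
    -- properties of the solution
    (∀ γ : ℝ, 2 / 3 < γ → γ < 2 →
      wonderlandState γ ∈ stateSpace ∧
      (wonderlandState γ).1 1 1 < (wonderlandState γ).1 0 0 ∧
      ∀ M : Model, IsWonderland γ M →
        IsLRSAboutX M (Set.Ioi 0) ∧ IsSelfSimilar M (Set.Ioi 0) ∧
        ∀ t > 0, M.J t = Pi.single 1 (M.J t 1) ∧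
          0 < M.hubble t ∧ M.deceleration t = 3 * γ / 2 - 1 ∧
          ∀ E, IsAlignedFrame M t E → M.state t E = wonderlandState γ) ∧
    -- limits at the ends of the range
    Filter.Tendsto wonderlandState (nhdsWithin (2 / 3) (Set.Ioi (2 / 3))) (nhds flrwState) ∧
    Filter.Tendsto wonderlandState (nhdsWithin 2 (Set.Iio 2)) (nhds kasnerState) ∧
    -- global attractor
    (∀ γ : ℝ, 2 / 3 < γ → γ ≤ 6 / 5 → IsGlobalAttractor γ (wonderlandState γ)) := by
  refine ⟨fun γ hγ => exists_isWonderland_iff hγ, fun γ hγ hγ' => ?_, tendsto_wonderlandState_flrw,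
    tendsto_wonderlandState_kasner, fun γ hγ hγ' => isGlobalAttractor_wonderlandState hγ hγ'⟩
  have h0 : 0 < γ := by linarith
  refine ⟨wonderlandState_mem hγ hγ', wonderlandState_prolate hγ, fun M hM =>
    ⟨wonderland_isLRSAboutX h0 hM, wonderland_isSelfSimilar h0 hM, fun t ht =>
      ⟨wonderland_field h0 hM ht, ?_, wonderland_deceleration h0 hM ht, fun E hE =>
        wonderland_state h0 hM ht hE⟩⟩⟩
  rw [wonderland_hubble h0 hM.metric_eq ht]
  positivity
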